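/- Let $\beta\ge 2$ be an even integer. Let $f=f_N=f_0+N^{-1}g$ ($N=1,2,\dots$), where $f_0,g$ are complex functions of $u$ that may depend on a fixed parameter $x$ (suppressed in $f_0$, $g$; $g=0$ is allowed), such that $e^{Nf_N(u)}$ is analytic on $\mathbb C\setminus[0,\infty)$ for every $N\ge 1$ and is bounded near $u=1$ there for every sufficiently large $N$ (the bound may depend on $N$). Put $$R_{N,\beta}(x)=\oint_{\mathcal C}du_1\,e^{Nf(u_1)}\cdots\oint_{\mathcal C}du_\beta\,e^{Nf(u_\beta)}\prod_{1\le j<k\le\beta}|u_j-u_k|^{4/\beta},$$ where $\mathcal C$ is the unit circle, traversed once counterclockwise from $1$ to $1$, and $$\Gamma_{n,\beta}=\int_{\mathbb R^n}\prod_{i=1}^n e^{-y_i^2}\prod_{1\le j<k\le n}|y_j-y_k|^{4/\beta}\,dy_1\cdots dy_n .$$ Let $u_\pm\ne 0$ have arguments $\psi_\pm$ with $0<\psi_+<\psi_-<2\pi$, and suppose that $f_0$ is analytic at $u_\pm$ with $$f_0'(u_\pm)=0,\qquad f_0''(u_\pm)=R\,e^{\mathrm i\phi_\pm},\quad R>0,\qquad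 \Re f_0(u_+)=\Re f_0(u_-).$$ Let $\theta_\pm$ be the directions of steepest descent, $\cos(2\theta_\pm+\phi_\pm)=-1$, $\sin(2\theta_\pm+\phi_\pm)=0$, oriented counterclockwise and normalised by $$\psi_+<\theta_+<\psi_++\pi,\qquad \psi_--2\pi<\theta_-<\psi_--\pi .$$ Suppose that the saddle points lie on an admissible descent contour: there is a positive $C^1$ function $\rho$ on $[0,2\pi]$ with $\rho(0)=\rho(2\pi)=1$ such that the counterclockwise contour $\gamma(t)=\rho(t)e^{\mathrm it}$ around the origin, starting and ending at $1$, satisfies $\gamma(\psi_\pm)=u_\pm$, $\gamma'(\psi_\pm)=c_\pm e^{\mathrm i\theta_\pm}$ with $c_\pm>0$, and for every $\eta>0$ there is $\delta>0$ with $\Re f_0(\gamma(t))\le\Re f_0(u_+)-\delta$ for all $t\in(0,2\pi)$ with $|t-\psi_+|\ge\eta$ and $|t-\psi_-|\ge\eta$. Let $\tilde f(u)=f(u)-(2-2/\beta)N^{-1}\ln u$ and $\tilde f_\pm=\tilde f(u_\pm)$, where $\ln u_+=\ln|u_+|+\mathrm i\psi_+$ and $\ln u_-=\ln|u_-|+\mathrm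 i(\psi_--2\pi)$, and let powers of $u_+-u_-$ be taken with the argument lying in $\big(\tfrac{\psi_++\psi_-}{2}-\pi,\tfrac{\psi_++\psi_-}{2}\big)$. Then, as $N\to\infty$, $$R_{N,\beta}(x)=-\binom{\beta}{\beta/2}(\Gamma_{\beta/2,\beta})^2(u_+-u_-)^\beta\left(\frac{2}{NR}\right)^{\beta-1}e^{\beta N(\tilde f_++\tilde f_-)/2}\,e^{\mathrm i(\beta-1)(\theta_++\theta_-)}\Big[r_{N,\beta}(x)+\mathrm O(1/N)\Big],$$ where $$r_{N,\beta}(x)=1+2\sum_{k=1}^{\lfloor\sqrt{\beta/2}\rfloor}\left(\prod_{j=1}^k\frac{\Gamma(1+2j/\beta)}{\Gamma(1+2(j-k)/\beta)}\right)\frac{e^{\mathrm i2k^2(\theta_++\theta_-)/\beta}}{(u_+-u_-)^{4k^2/\beta}(NR)^{2k^2/\beta}}\cos\Big(-\mathrm ikN(\tilde f_+-\tilde f_-)+k(\theta_+-\theta_-)(3-2/\beta)\Big).$$ -/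

import Mathlib

open Complex Filter Topology Asymptotics MeasureTheory

noncomputable section

namespace BetaLaguerre

/-- The complex plane cut along the closed half-line `[0, ∞)`. -/
def cutPlane : Set ℂ := (Complex.ofReal '' Set.Ici 0)ᶜ

/-- The function `f = f₀ + N⁻¹ g` in the exponent `N f` (for a fixed value of the parameter `x`). -/
def phase (f₀ g : ℂ → ℂ) (N : ℕ) (u : ℂ) : ℂ := f₀ u + g u / N

/-- `∏_{1 ≤ j < k ≤ n} |u_j - u_k|^{4/β}`. -/
def pairProduct {E : Type*} [Norm E] [Sub E] (β : ℕ) {n : ℕ} (u : Fin n → E) : ℝ :=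
  ∏ j, ∏ k ∈ Finset.Ioi j, ‖u j - u k‖ ^ (4 / (β : ℝ))

/-- `∮ du_1 e^{N F(u_1)} ⋯ ∮ du_β e^{N F(u_β)} ∏_{j<k} |u_j - u_k|^{4/β}`, where every variable runs
counterclockwise once round the unit circle from `1` to `1`: `u_j = e^{i t_j}`,
`du_j = i e^{i t_j} dt_j`, `0 < t_j ≤ 2π`. -/
def circleBetaIntegral (β N : ℕ) (F : ℂ → ℂ) : ℂ :=
  ∫ t in Set.univ.pi (fun _ : Fin β => Set.Ioc (0 : ℝ) (2 * Real.pi)),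
    (∏ j, exp (N * F (exp (t j * I))) * (I * exp (t j * I))) *
      (pairProduct β (fun j => exp (t j * I)) : ℂ)

/-- `Γ_{n,β} = ∫_{ℝⁿ} ∏ e^{-u_i²} ∏_{j<k} |u_j - u_k|^{4/β} du`. -/
def gammaIntegral (n β : ℕ) : ℝ :=
  ∫ u : Fin n → ℝ, (∏ i, Real.exp (-(u i) ^ 2)) * pairProduct β u

/-- The curve with polar equation `r = ρ(t)`, `t` being the polar angle. -/
def polarPath (ρ : ℝ → ℝ) (t : ℝ) : ℂ := ρ t * exp (t * I)

/-- `f̃(u) = F(u) - (2 - 2/β) N⁻¹ ln u`, where `a` is the value of `arg u` used in `ln u`. -/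
def fTilde (β N : ℕ) (F : ℂ → ℂ) (u : ℂ) (a : ℝ) : ℂ :=
  F u - (2 - 2 / (β : ℂ)) / N * (Real.log ‖u‖ + a * I)

/-- The power `z ^ s` for the choice `α` of `arg z`. -/
def argPow (z : ℂ) (α s : ℝ) : ℂ := (‖z‖ ^ s : ℝ) * exp (s * α * I)

/-- The oscillatory sum `r_{N,β}`; here `d = u_+ - u_-`, `α` is the value of `arg d` used for the
powers of `d`, and `FP`, `FM` are the values of `f̃` at the saddle points `u_+`, `u_-`. -/
def oscSum (β N : ℕ) (R θP θM : ℝ) (d : ℂ) (α : ℝ) (FP FM : ℂ) : ℂ :=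
  1 + 2 * ∑ k ∈ Finset.Icc 1 ⌊Real.sqrt ((β : ℝ) / 2)⌋₊,
    ((∏ j ∈ Finset.Icc 1 k, Real.Gamma (1 + 2 * (j : ℝ) / β) /
        Real.Gamma (1 + 2 * ((j : ℝ) - k) / β) : ℝ) : ℂ) *
      (exp (I * (2 * (k : ℂ) ^ 2 * (θP + θM) / β)) /
        (argPow d α (4 * (k : ℝ) ^ 2 / β) *
          (((N : ℝ) * R) ^ (2 * (k : ℝ) ^ 2 / β) : ℝ))) *
      cos (-I * k * N * (FP - FM) + k * (θP - θM) * (3 - 2 / (β : ℂ)))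

end BetaLaguerre

end

open Complex Filter Topology Asymptotics MeasureTheory

noncomputable section

namespace BetaLaguerre

/-! In the coordinate z = -i ln u the circle becomes the segment (0, 2π), and |u_j - u_k| becomes 2
sin((t_k - t_j)/2) for t_j < t_k. If all variables run along one common curve in the strip 0 < Re z
< 2π whose real part increases, this sine stays in the right half-plane, so its principal power 4/β
continues holomorphically. This allows the β contours to be moved together to the descent contour
(`IsHeight.contourIntegral_eq`). Cauchy's theorem in one variable at a time does not apply, because
the continued integrand depends on the order of the variables. Instead the curves t + i s σ(t) are
taken for complex s: the integral is holomorphic in s; for imaginary s the curve is a real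
reparametrisation of the segment, so the integral is constant there; the identity theorem extends
this to s = 1.

On the descent contour only configurations with every variable near u_+ or u_- matter. If m of them
are at u_+ and β - m at u_-, distances inside a cluster are linear to leading order and distances
between clusters are constant. Laplace's method (`exists_laplace_bound`) gives Γ_{m,β} Γ_{β-m,β}
times the power N^{-(β-1) - 2(m-β/2)²/β}. The relative error is 1/N and not N^{-1/2}, because the
Gaussian weight is even and odd Taylor terms integrate to zero. The contour is only C¹, so it is
first made straight near the saddle points; a cone of quadratic descent around the steepest
direction keeps it admissible. Adding over the binomial(β, m) choices gives
`exists_circle_expansion`.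

What remains is algebra. With m = β/2 ± k, the two exponentials combine to a cosine. The coefficient
relative to k = 0 needs only the ratios Γ_{n+1,β}/Γ_{n,β}; these follow from integrating one weight
over interlacing points x, y in both orders, by Dixon's integral and a companion of it
(`orderedGaussian_succ`). Terms with 2k²/β ≥ 1 are O(1/N) and are dropped, which explains the upper
limit of the sum. The prescribed intervals for θ_± and for arg(u_+ - u_-) are exactly what makes the
principal powers of the continued integrand agree with the powers in the formula (`direction_cpow`,
`chord_cpow`). -/

/-! ### Vandermonde products and the bordered Cauchy determinant. -/

open Polynomial in
theorem det_eval_eq_det_vandermonde_mul {n : ℕ} (p : Fin (n + 1) → ℝ[X])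
    (hp : ∀ j, (p j).natDegree ≤ n) (z : Fin (n + 1) → ℝ) :
    (Matrix.of fun k j => (p j).eval (z k)).det =
      (Matrix.vandermonde z).det * (Matrix.of fun (l j : Fin (n + 1)) => (p j).coeff l).det := by
  rw [← Matrix.det_mul]
  congr 1
  ext k j
  rw [Matrix.of_apply, Matrix.mul_apply, eval_eq_sum_range' (Nat.lt_succ_of_le (hp j)),
    Finset.sum_range]
  exact Finset.sum_congr rfl fun l _ => by simp [Matrix.vandermonde_apply, mul_comm]

/-- The absolute value of the Vandermonde product. -/
def vand {n : ℕ} (x : Fin n → ℝ) : ℝ := ∏ j, ∏ k ∈ Finset.Ioi j, |x j - x k|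

theorem vand_nonneg {n : ℕ} (x : Fin n → ℝ) : 0 ≤ vand x :=
  Finset.prod_nonneg fun _ _ => Finset.prod_nonneg fun _ _ => abs_nonneg _

theorem vand_pos {n : ℕ} {x : Fin n → ℝ} (hx : Function.Injective x) : 0 < vand x :=
  Finset.prod_pos fun _ _ => Finset.prod_pos fun _ hk =>
    abs_pos.2 (sub_ne_zero.2 fun h => (Finset.mem_Ioi.1 hk).ne (hx h))

theorem continuous_vand {n : ℕ} : Continuous (vand (n := n)) := by
  unfold vand; fun_prop

theorem abs_det_vandermonde {n : ℕ} (x : Fin n → ℝ) :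
    |(Matrix.vandermonde x).det| = vand x := by
  rw [Matrix.det_vandermonde, Finset.abs_prod]
  refine Finset.prod_congr rfl fun j _ => ?_
  rw [Finset.abs_prod]
  exact Finset.prod_congr rfl fun k _ => abs_sub_comm _ _

theorem prod_prod_erase_abs {n : ℕ} (x : Fin n → ℝ) :
    ∏ i, ∏ j ∈ Finset.univ.erase i, |x i - x j| = vand x ^ 2 := by
  have h := Finset.prod_prod_Ioi_mul_eq_prod_prod_off_diag fun i j : Fin n => |x i - x j|
  rw [sq, vand, ← Finset.prod_mul_distrib]
  simp_rw [← Finset.prod_mul_distrib]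
  rw [Finset.prod_congr rfl fun i _ => Finset.prod_congr (g := fun j => |x j - x i|)
    (s₂ := {i}ᶜ) (by ext; simp) fun j _ => abs_sub_comm _ _, ← h]
  exact Finset.prod_congr rfl fun i _ => Finset.prod_congr rfl fun j _ => by
    rw [abs_sub_comm (x j)]

theorem vand_cons {n : ℕ} (t : ℝ) (y : Fin n → ℝ) :
    vand (Fin.cons t y : Fin (n + 1) → ℝ) = (∏ i, |t - y i|) * vand y := by
  simp only [vand]
  rw [Fin.prod_univ_succ, Fin.prod_Ioi_zero]
  simp [Fin.prod_Ioi_succ]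

open Polynomial in
/-- The Cauchy determinant, with one pole sent to infinity. -/
theorem abs_det_bordered_cauchy {n : ℕ} (x : Fin (n + 1) → ℝ) (y : Fin n → ℝ)
    (hy : Function.Injective y) (hxy : ∀ k i, x k ≠ y i) :
    |(Matrix.of fun k => (Fin.cons 1 fun i => (x k - y i)⁻¹ : Fin (n + 1) → ℝ)).det| *
      ∏ k, ∏ i, |x k - y i| = vand x * vand y := by
  -- Multiplying row k by ∏ (x_k - y_i) turns the entries into values at x_k of these polynomials of
  -- degree at most n. The determinant is therefore the Vandermonde determinant of x times a
  -- constant c that depends on y only.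
  set p : Fin (n + 1) → ℝ[X] := Fin.cons (∏ i, (X - C (y i)))
    fun i => ∏ j ∈ Finset.univ.erase i, (X - C (y j)) with hp
  have hdeg : ∀ j, (p j).natDegree ≤ n := by
    intro j
    refine Fin.cases ?_ (fun i => ?_) j
    · simp [hp, natDegree_prod_of_monic _ _ fun i _ => monic_X_sub_C (y i)]
    · simp only [hp, Fin.cons_succ]
      rw [natDegree_prod_of_monic _ _ fun i _ => monic_X_sub_C (y i)]
      simp
  set c := (Matrix.of fun (l j : Fin (n + 1)) => (p j).coeff l).det
  have key := det_eval_eq_det_vandermonde_mul p hdeg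
  have hV := vand_pos hy
  -- The constant is found at the points (x_0, y_1, …, y_n), where the matrix of values is upper
  -- triangular.
  have hc : |c| = vand y := by
    have h := congrArg abs (key (Fin.cons (x 0) y))
    rw [abs_mul, abs_det_vandermonde, vand_cons, Matrix.det_of_isUpperTriangular] at h
    · rw [Fin.prod_univ_succ, abs_mul] at h
      simp only [Matrix.of_apply, hp, Fin.cons_zero, Fin.cons_succ, eval_prod, eval_sub, eval_X,
        eval_C, Finset.abs_prod, prod_prod_erase_abs] at h
      have h0 : 0 < ∏ i, |x 0 - y i| :=
        Finset.prod_pos fun i _ => abs_pos.2 (sub_ne_zero.2 (hxy 0 i))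
      have : (∏ i, |x 0 - y i|) * vand y * (vand y - |c|) = 0 := by
        linear_combination h
      have := (mul_eq_zero.1 this).resolve_left (by positivity)
      linarith
    · intro k j hjk
      simp only [id] at hjk
      obtain ⟨k, rfl⟩ := Fin.exists_succ_eq.2 (Fin.ne_zero_of_lt hjk)
      simp only [Matrix.of_apply, Fin.cons_succ]
      revert hjk
      refine Fin.cases (fun _ => ?_) (fun i hik => ?_) j
      · simp only [hp, Fin.cons_zero, eval_prod]
        exact Finset.prod_eq_zero (Finset.mem_univ k) (by simp)
      · simp only [hp, Fin.cons_succ, eval_prod]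
        exact Finset.prod_eq_zero (Finset.mem_erase.2 ⟨(Fin.succ_lt_succ_iff.1 hik).ne',
          Finset.mem_univ k⟩) (by simp)
  have h := congrArg abs (key x)
  rw [abs_mul, abs_det_vandermonde, hc] at h
  rw [← h, ← mul_comm (∏ k, ∏ i, |x k - y i|)]
  simp_rw [← Finset.abs_prod]
  rw [← abs_mul, ← Matrix.det_mul_column]
  congr 2
  ext k j
  refine Fin.cases ?_ (fun i => ?_) j
  · simp [hp, eval_prod]
  · simp only [Matrix.of_apply, Fin.cons_succ, hp, eval_prod, eval_sub, eval_X, eval_C]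
    rw [← Finset.mul_prod_erase _ _ (Finset.mem_univ i), mul_right_comm,
      mul_inv_cancel₀ (sub_ne_zero.2 (hxy k i)), one_mul]

/-! ### Interlacing points and polynomials with real zeros. -/

/-- The points `y` strictly separate the points `x`. -/
def Interlace {n : ℕ} (x : Fin (n + 1) → ℝ) (y : Fin n → ℝ) : Prop :=
  ∀ i : Fin n, x i.castSucc < y i ∧ y i < x i.succ

namespace Interlace

variable {n : ℕ} {x : Fin (n + 1) → ℝ} {y : Fin n → ℝ}

theorem strictMono_left (h : Interlace x y) : StrictMono x :=
  Fin.strictMono_iff_lt_succ.2 fun i => (h i).1.trans (h i).2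

theorem strictMono_right (h : Interlace x y) : StrictMono y := fun i j hij =>
  (h i).2.trans_le ((h.strictMono_left.monotone (Fin.succ_le_castSucc_iff.2 hij)).trans (h j).1.le)

theorem lt_of_le (h : Interlace x y) {k : Fin (n + 1)} {i : Fin n} (hk : k ≤ i.castSucc) :
    x k < y i := (h.strictMono_left.monotone hk).trans_lt (h i).1

theorem lt_of_lt (h : Interlace x y) {k : Fin (n + 1)} {i : Fin n} (hk : i.castSucc < k) :
    y i < x k :=
  (h i).2.trans_le (h.strictMono_left.monotone (Fin.castSucc_lt_iff_succ_le.1 hk))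

theorem ne (h : Interlace x y) (k : Fin (n + 1)) (i : Fin n) : x k ≠ y i := by
  rcases le_or_gt k i.castSucc with hk | hk
  · exact (h.lt_of_le hk).ne
  · exact (h.lt_of_lt hk).ne'

end Interlace

theorem measurableSet_interlace {n : ℕ} :
    MeasurableSet {p : (Fin (n + 1) → ℝ) × (Fin n → ℝ) | Interlace p.1 p.2} := by
  have : {p : (Fin (n + 1) → ℝ) × (Fin n → ℝ) | Interlace p.1 p.2} =
      ⋂ i, ({p | p.1 i.castSucc < p.2 i} ∩ {p | p.2 i < p.1 i.succ}) := by
    ext; simp [Interlace]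
  rw [this]
  exact MeasurableSet.iInter fun i => (measurableSet_lt (by fun_prop) (by fun_prop)).inter
    (measurableSet_lt (by fun_prop) (by fun_prop))

section Roots

open Polynomial

theorem degree_prod_sub_prod_lt {n : ℕ} (a b : Fin n → ℝ) :
    (∏ i, (X - C (a i)) - ∏ i, (X - C (b i))).degree < (n : WithBot ℕ) := by
  have hd : ∀ a : Fin n → ℝ, (∏ i, (X - C (a i))).degree = (n : WithBot ℕ) := fun a => by
    rw [degree_prod_of_monic _ _ fun i _ => monic_X_sub_C (a i)]; simp
  have hm : ∀ a : Fin n → ℝ, (∏ i, (X - C (a i))).Monic :=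
    fun a => monic_prod_of_monic _ _ fun i _ => monic_X_sub_C _
  have := degree_sub_lt_left ((hd a).trans (hd b).symm) (hm a).ne_zero
    ((hm a).leadingCoeff.trans (hm b).leadingCoeff.symm)
  rwa [hd] at this

theorem coeff_prod_X_sub_C {n : ℕ} (a : Fin (n + 1) → ℝ) :
    (∏ i, (X - C (a i))).coeff n = -∑ i, a i := by
  have h := prod_X_sub_C_nextCoeff (s := Finset.univ) a
  rw [nextCoeff_of_natDegree_pos, natDegree_prod_of_monic _ _ fun i _ => monic_X_sub_C (a i)] at h
  · rw [← h]; simp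
  · rw [natDegree_prod_of_monic _ _ fun i _ => monic_X_sub_C (a i)]; simp

/-- The second elementary symmetric function carries the sum of squares, hence the Gaussian weight,
into comparisons of coefficients. -/
theorem coeff_prod_X_sub_C_two {n : ℕ} (a : Fin (n + 2) → ℝ) :
    (∏ i, (X - C (a i))).coeff n = ((∑ i, a i) ^ 2 - ∑ i, a i ^ 2) / 2 := by
  induction n with
  | zero =>
    change (∏ i : Fin 2, (X - C (a i))).coeff 0 =
      ((∑ i : Fin 2, a i) ^ 2 - ∑ i : Fin 2, a i ^ 2) / 2
    simp only [Fin.prod_univ_two, coeff_zero_eq_eval_zero, eval_mul, eval_sub, eval_X, eval_C,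
      Fin.sum_univ_two]
    ring
  | succ n ih =>
    rw [Fin.prod_univ_succ, sub_mul, coeff_sub, coeff_X_mul, coeff_C_mul, ih,
      coeff_prod_X_sub_C fun i : Fin (n + 2) => a i.succ, Fin.sum_univ_succ a,
      Fin.sum_univ_succ fun i => a i ^ 2]
    ring

theorem degree_prod_sub_prod_lt_of_sum_eq {n : ℕ} (a b : Fin (n + 1) → ℝ)
    (h : ∑ i, a i = ∑ i, b i) :
    (∏ i, (X - C (a i)) - ∏ i, (X - C (b i))).degree < (n : WithBot ℕ) := by
  rw [degree_lt_iff_coeff_zero]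
  intro m hm
  rcases hm.eq_or_lt with rfl | hm
  · rw [coeff_sub, coeff_prod_X_sub_C, coeff_prod_X_sub_C, h, sub_self]
  · exact (degree_lt_iff_coeff_zero _ _).1 (degree_prod_sub_prod_lt a b) m hm

theorem strictMono_eq_of_prod_eq {n : ℕ} {a b : Fin n → ℝ} (ha : StrictMono a) (hb : StrictMono b)
    (h : ∏ i, (X - C (a i)) = ∏ i, (X - C (b i))) : a = b := by
  have aux : ∀ {a b : Fin n → ℝ}, ∏ i, (X - C (a i)) = ∏ i, (X - C (b i)) →
      Set.range a ⊆ Set.range b := by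
    rintro a b h _ ⟨i, rfl⟩
    have h1 := congrArg (eval (a i)) h
    simp only [eval_prod, eval_sub, eval_X, eval_C] at h1
    rw [Finset.prod_eq_zero (Finset.mem_univ i) (sub_self _), eq_comm, Finset.prod_eq_zero_iff] at h1
    obtain ⟨j, -, hj⟩ := h1
    exact ⟨j, (sub_eq_zero.1 hj).symm⟩
  exact (StrictMono.range_inj ha hb).1 ((aux h).antisymm (aux h.symm))

/-- Exactly the n - 1 - i factors with j > i are negative. -/
theorem sign_prod_erase_pos {n : ℕ} {y : Fin n → ℝ} (hy : StrictMono y) (i : Fin n) :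
    0 < (-1 : ℝ) ^ (n - 1 - (i : ℕ)) * ∏ j ∈ Finset.univ.erase i, (y i - y j) := by
  have : Finset.univ.erase i = Finset.Iio i ∪ Finset.Ioi i := by
    ext j; simp [lt_or_lt_iff_ne]
  rw [this, Finset.prod_union (Finset.disjoint_left.2 fun j h1 h2 => by simp at h1 h2; omega),
    mul_left_comm, ← Fin.card_Ioi, ← Finset.prod_const, ← Finset.prod_mul_distrib]
  refine mul_pos (Finset.prod_pos fun j hj => sub_pos.2 (hy (Finset.mem_Iio.1 hj)))
    (Finset.prod_pos fun j hj => ?_)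
  have := hy (Finset.mem_Ioi.1 hj)
  linarith

/-- A polynomial whose signs alternate along `Y` has roots interlacing `Y`. -/
theorem exists_interlacing_roots {m : ℕ} (P : ℝ[X]) {Y : Fin (m + 1) → ℝ} (hY : StrictMono Y)
    (hP : ∀ k : Fin (m + 1), 0 < (-1 : ℝ) ^ (m - (k : ℕ)) * P.eval (Y k)) :
    ∃ y : Fin m → ℝ, Interlace Y y ∧ ∀ i, P.eval (y i) = 0 := by
  have : ∀ i : Fin m, ∃ t, (Y i.castSucc < t ∧ t < Y i.succ) ∧ P.eval t = 0 := by
    intro i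
    have hlt : Y i.castSucc < Y i.succ := hY i.castSucc_lt_succ
    have h1 := hP i.castSucc
    have h2 := hP i.succ
    have he : m - (i.castSucc : ℕ) = (m - (i.succ : ℕ)) + 1 := by
      have := i.2
      simp only [Fin.val_castSucc, Fin.val_succ]; omega
    rw [he, pow_succ] at h1
    set s := (-1 : ℝ) ^ (m - (i.succ : ℕ))
    have hc : ContinuousOn (fun t => s * P.eval t) (Set.Icc (Y i.castSucc) (Y i.succ)) := by
      fun_prop
    obtain ⟨t, ht, h0⟩ := intermediate_value_Ioo hlt.le hc
      (show (0 : ℝ) ∈ Set.Ioo _ _ from ⟨by linarith, h2⟩)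
    have hs : s ≠ 0 := pow_ne_zero _ (by norm_num)
    exact ⟨t, ht, (mul_eq_zero.1 h0).resolve_left hs⟩
  choose y hy h0 using this
  exact ⟨y, hy, h0⟩

end Roots

theorem lintegral_pi_ofReal_prod {ι : Type*} [Fintype ι] (s : ι → Set ℝ)
    (hs : ∀ i, MeasurableSet (s i)) (f : ι → ℝ → ℝ) (hf : ∀ i, IntegrableOn (f i) (s i))
    (h0 : ∀ i, ∀ t ∈ s i, 0 ≤ f i t) :
    ∫⁻ w in Set.univ.pi s, ENNReal.ofReal (∏ i, f i (w i)) =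
      ENNReal.ofReal (∏ i, ∫ t in s i, f i t) := by
  have hr : (volume : Measure (ι → ℝ)).restrict (Set.univ.pi s) =
      Measure.pi fun i => volume.restrict (s i) := by
    rw [volume_pi, Measure.restrict_pi_pi]
  rw [← ofReal_integral_eq_lintegral_ofReal, hr, integral_fintype_prod_eq_prod]
  · rw [hr]; exact Integrable.fintype_prod_dep hf
  · refine (ae_restrict_iff' (MeasurableSet.univ_pi hs)).2 (Eventually.of_forall fun w hw => ?_)
    exact Finset.prod_nonneg fun i _ => h0 i _ (hw i trivial)

theorem integral_rpow_mul_exp_neg_mul {a r : ℝ} (ha : 0 < a) (hr : 0 < r) :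
    ∫ t in Set.Ioi 0, t ^ (a - 1) * Real.exp (-(r * t)) = r ^ (-a) * Real.Gamma a := by
  rw [Real.integral_rpow_mul_exp_neg_mul_Ioi ha hr, one_div, Real.inv_rpow hr.le,
    Real.rpow_neg hr.le]

theorem integrableOn_rpow_mul_exp_neg_mul {a r : ℝ} (ha : 0 < a) (hr : 0 < r) :
    IntegrableOn (fun t => t ^ (a - 1) * Real.exp (-(r * t))) (Set.Ioi 0) := by
  have h := integrableOn_rpow_mul_exp_neg_mul_rpow (p := 1) (s := a - 1) (b := r) (by linarith)
    one_pos hr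
  refine h.congr_fun (fun t _ => ?_) measurableSet_Ioi
  simp

/-! ### Dixon's integral, by the substitution of weights at fixed points. -/

/-- The weights at the points `x` of the polynomial with leading coefficient `v 0` and zeros
`v 1, …, v n`. -/
def residueMap {n : ℕ} (x : Fin (n + 1) → ℝ) (v : Fin (n + 1) → ℝ) (k : Fin (n + 1)) : ℝ :=
  v 0 * (∏ i : Fin n, (x k - v i.succ)) / ∏ j ∈ Finset.univ.erase k, (x k - x j)

def residueJacobian {n : ℕ} (x : Fin (n + 1) → ℝ) (v : Fin (n + 1) → ℝ) :
    Matrix (Fin (n + 1)) (Fin (n + 1)) ℝ :=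
  Matrix.of fun k => (Fin.cons ((∏ i : Fin n, (x k - v i.succ)) /
      ∏ j ∈ Finset.univ.erase k, (x k - x j))
    fun i => -(v 0 * (∏ l ∈ Finset.univ.erase i, (x k - v l.succ)) /
      ∏ j ∈ Finset.univ.erase k, (x k - x j)) : Fin (n + 1) → ℝ)

theorem hasFDerivAt_residueMap {n : ℕ} (x v : Fin (n + 1) → ℝ) :
    HasFDerivAt (residueMap x) (Matrix.toLin' (residueJacobian x v)).toContinuousLinearMap v := by
  rw [hasFDerivAt_pi']
  intro k
  have h0 : HasFDerivAt (fun v : Fin (n + 1) → ℝ => v 0)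
      (ContinuousLinearMap.proj (R := ℝ) (φ := fun _ : Fin (n + 1) => ℝ) 0) v := hasFDerivAt_apply 0 v
  have h1 : HasFDerivAt (fun v : Fin (n + 1) → ℝ => ∏ i : Fin n, (x k - v i.succ)) _ v :=
    HasFDerivAt.finsetProd (u := Finset.univ) fun i _ =>
      (hasFDerivAt_apply (𝕜 := ℝ) (F' := fun _ : Fin (n + 1) => ℝ) i.succ v).const_sub (x k)
  refine ((h0.mul h1).mul_const ((∏ j ∈ Finset.univ.erase k, (x k - x j))⁻¹)).congr_fderiv ?_
  ext h
  simp [Matrix.mulVec, dotProduct, residueJacobian, Fin.sum_univ_succ]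
  rw [Finset.mul_sum, Finset.mul_sum, ← Finset.sum_neg_distrib, ← Finset.sum_neg_distrib, add_comm]
  congr 1
  · ring
  · exact Finset.sum_congr rfl fun i _ => by ring

theorem prod_abs_prod_erase {n : ℕ} (x : Fin n → ℝ) :
    ∏ k, |∏ j ∈ Finset.univ.erase k, (x k - x j)| = vand x ^ 2 := by
  simp_rw [Finset.abs_prod]; exact prod_prod_erase_abs x

/-- Up to the row factors ∏ (x_k - y_i) / ∏ (x_k - x_j) and the column factors -v_0, this is the
bordered Cauchy matrix. -/
theorem abs_det_residueJacobian {n : ℕ} (x v : Fin (n + 1) → ℝ)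
    (h : Interlace x fun i => v i.succ) :
    |(residueJacobian x v).det| = |v 0| ^ n * vand (fun i => v i.succ) / vand x := by
  set y := fun i : Fin n => v i.succ with hy
  have hB := abs_det_bordered_cauchy x y h.strictMono_right.injective h.ne
  set B := (Matrix.of fun k => (Fin.cons 1 fun i => (x k - y i)⁻¹ : Fin (n + 1) → ℝ)) with hBd
  have hx := vand_pos h.strictMono_left.injective
  have e : residueJacobian x v = Matrix.of fun k j =>
      (fun k => (∏ i, (x k - y i)) / ∏ j ∈ Finset.univ.erase k, (x k - x j)) k *
      (Matrix.of fun k j => (Fin.cons 1 fun _ => -v 0 : Fin (n + 1) → ℝ) j * B k j) k j := by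
    ext k j
    refine Fin.cases ?_ (fun i => ?_) j
    · simp [residueJacobian, hBd, hy]
    · simp only [residueJacobian, hBd, Matrix.of_apply, Fin.cons_succ]
      rw [← Finset.mul_prod_erase _ (fun i => x k - y i) (Finset.mem_univ i)]
      have := sub_ne_zero.2 (h.ne k i)
      field_simp
      rw [hy]
  have hc : |∏ j, (Fin.cons 1 fun _ => -v 0 : Fin (n + 1) → ℝ) j| = |v 0| ^ n := by
    simp [Fin.prod_univ_succ]
  rw [e, Matrix.det_mul_column, Matrix.det_mul_row, abs_mul, abs_mul, hc, Finset.abs_prod]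
  simp only [abs_div, Finset.prod_div_distrib, prod_abs_prod_erase]
  simp_rw [Finset.abs_prod]
  rw [div_mul_eq_mul_div, div_eq_div_iff (by positivity) hx.ne']
  linear_combination (|v 0| ^ n * vand x) * hB

/-- Equally many of the y and of the other x lie above x_k, so the signs of numerator and
denominator agree. -/
theorem prod_sub_div_prod_erase_pos {n : ℕ} {x : Fin (n + 1) → ℝ} {y : Fin n → ℝ}
    (h : Interlace x y) (k : Fin (n + 1)) :
    0 < (∏ i, (x k - y i)) / ∏ j ∈ Finset.univ.erase k, (x k - x j) := by
  have h1 := sign_prod_erase_pos h.strictMono_left k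
  have h2 : 0 < (-1 : ℝ) ^ (n + 1 - 1 - (k : ℕ)) * ∏ i, (x k - y i) := by
    have hs : (Finset.univ.filter fun i : Fin n => ¬ i.castSucc < k).card = n + 1 - 1 - (k : ℕ) := by
      have : (Finset.univ.filter fun i : Fin n => ¬ i.castSucc < k).map (Fin.succEmb n) =
          Finset.Ioi k := by
        ext j
        simp only [Finset.mem_map, Finset.mem_filter, Finset.mem_univ, true_and, Finset.mem_Ioi,
          Fin.coe_succEmb]
        constructor
        · rintro ⟨i, hi, rfl⟩
          exact Fin.le_castSucc_iff.1 (not_lt.1 hi)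
        · intro hj
          obtain ⟨i, rfl⟩ := Fin.exists_succ_eq.2 (Fin.ne_zero_of_lt hj)
          exact ⟨i, not_lt.2 (Fin.le_castSucc_iff.2 hj), rfl⟩
      rw [← Fin.card_Ioi, ← this, Finset.card_map]
    rw [← Finset.prod_filter_mul_prod_filter_not Finset.univ (fun i : Fin n => i.castSucc < k),
      ← hs, mul_left_comm, ← Finset.prod_const, ← Finset.prod_mul_distrib]
    refine mul_pos (Finset.prod_pos fun i hi => ?_) (Finset.prod_pos fun i hi => ?_)
    · have := h.lt_of_lt (Finset.mem_filter.1 hi).2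
      linarith
    · have := h.lt_of_le (not_lt.1 (Finset.mem_filter.1 hi).2)
      linarith
  have := div_pos h2 h1
  rwa [mul_div_mul_left _ _ (pow_ne_zero _ (by norm_num))] at this

-- The leading coefficient in Lagrange interpolation. It makes the exponential weight in the w_k a
-- function of v_0 alone.
open Polynomial in
theorem sum_residueMap {n : ℕ} {x : Fin (n + 1) → ℝ} (hx : Function.Injective x)
    (v : Fin (n + 1) → ℝ) : ∑ k, residueMap x v k = v 0 := by
  have hm : (∏ i : Fin n, (X - C (v i.succ))).Monic :=
    monic_prod_of_monic _ _ fun i _ => monic_X_sub_C _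
  have h := Lagrange.leadingCoeff_eq_sum (s := Finset.univ) (v := x) hx.injOn
    (P := ∏ i : Fin n, (X - C (v i.succ)))
    (by rw [degree_prod_of_monic _ _ fun i _ => monic_X_sub_C _]; simp)
  rw [hm.leadingCoeff] at h
  simp only [eval_prod, eval_sub, eval_X, eval_C] at h
  simp only [residueMap, mul_div_assoc]
  rw [← Finset.mul_sum, ← h, mul_one]

def residueDomain {n : ℕ} (x : Fin (n + 1) → ℝ) : Set (Fin (n + 1) → ℝ) :=
  {v | 0 < v 0 ∧ Interlace x fun i => v i.succ}

theorem measurableSet_residueDomain {n : ℕ} (x : Fin (n + 1) → ℝ) :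
    MeasurableSet (residueDomain x) :=
  (measurableSet_lt (f := fun _ : Fin (n + 1) → ℝ => (0 : ℝ)) (g := fun v => v 0) (by fun_prop)
    (by fun_prop)).inter (measurableSet_interlace.preimage (f := fun v : Fin (n + 1) → ℝ => (x, fun i : Fin n => v i.succ))
      (by fun_prop))

/-- The sum of the weights recovers v_0; after division by it, two monic polynomials of degree n
agree at n + 1 points. -/
theorem injOn_residueMap {n : ℕ} (x : Fin (n + 1) → ℝ) :
    Set.InjOn (residueMap x) (residueDomain x) := by
  intro v hv v' hv' h
  have hx := hv.2.strictMono_left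
  have h0 : v 0 = v' 0 := by rw [← sum_residueMap hx.injective v, h, sum_residueMap hx.injective]
  have hy : (fun i : Fin n => v i.succ) = fun i => v' i.succ := by
    refine strictMono_eq_of_prod_eq hv.2.strictMono_right hv'.2.strictMono_right ?_
    refine Polynomial.eq_of_degree_sub_lt_of_eval_index_eq (v := x) Finset.univ hx.injective.injOn
      ((degree_prod_sub_prod_lt _ _).trans (by
        rw [Finset.card_univ, Fintype.card_fin]; exact_mod_cast Nat.lt_succ_self n))
      fun k _ => ?_
    have hk := congrFun h k
    simp only [residueMap] at hk
    rw [← h0, mul_div_assoc, mul_div_assoc] at hk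
    have hk := mul_left_cancel₀ hv.1.ne' hk
    have hne : ∏ j ∈ Finset.univ.erase k, (x k - x j) ≠ 0 := fun h0 => by
      have := prod_sub_div_prod_erase_pos hv.2 k
      simp [h0] at this
    simpa [Polynomial.eval_prod] using (div_left_inj' hne).1 hk
  funext j
  refine Fin.cases h0 (fun i => congrFun hy i) j

open Polynomial in
theorem image_residueMap {n : ℕ} {x : Fin (n + 1) → ℝ} (hx : StrictMono x) :
    residueMap x '' residueDomain x = Set.univ.pi fun _ => Set.Ioi 0 := by
  ext w
  simp only [Set.mem_image, Set.mem_univ_pi, Set.mem_Ioi]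
  constructor
  · rintro ⟨v, hv, rfl⟩ k
    rw [residueMap, mul_div_assoc]
    exact mul_pos hv.1 (prod_sub_div_prod_erase_pos hv.2 k)
  · intro hw
    -- The Lagrange interpolant with the prescribed weights. Positive weights make its signs
    -- alternate along x, so its n zeros interlace x; its leading coefficient is the sum of the
    -- weights.
    set P : ℝ[X] := ∑ k, C (w k) * ∏ j ∈ Finset.univ.erase k, (X - C (x j)) with hP
    have hPx : ∀ k, P.eval (x k) = w k * ∏ j ∈ Finset.univ.erase k, (x k - x j) := by
      intro k
      simp only [hP, eval_finsetSum, eval_mul, eval_C, eval_prod, eval_sub, eval_X]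
      refine Finset.sum_eq_single k (fun l _ hl => ?_) (by simp)
      rw [Finset.prod_eq_zero (Finset.mem_erase.2 ⟨hl.symm, Finset.mem_univ k⟩) (sub_self _),
        mul_zero]
    obtain ⟨y, hy, hy0⟩ := exists_interlacing_roots P hx fun k => by
      rw [hPx, mul_left_comm]
      exact mul_pos (hw k) (sign_prod_erase_pos hx k)
    have hW : 0 < ∑ k, w k := Finset.sum_pos (fun k _ => hw k) Finset.univ_nonempty
    have hPy : P = C (∑ k, w k) * ∏ i, (X - C (y i)) := by
      refine Polynomial.eq_of_degree_sub_lt_of_eval_index_eq (v := y) Finset.univ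
        hy.strictMono_right.injective.injOn ?_ fun i _ => ?_
      · rw [hP, map_sum, Finset.sum_mul, ← Finset.sum_sub_distrib]
        rw [Finset.card_univ, Fintype.card_fin, ← mem_degreeLT]
        refine Submodule.sum_mem _ fun k _ => ?_
        rw [← mul_sub, C_mul']
        refine Submodule.smul_mem _ _ ?_
        have e : ∏ j ∈ Finset.univ.erase k, (X - C (x j)) =
            ∏ i, (X - C (x (k.succAbove i))) := by
          rw [← Finset.compl_singleton, ← Fin.image_succAbove_univ,
            Finset.prod_image fun a _ b _ h => Fin.succAbove_right_injective h]
        rw [mem_degreeLT, e]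
        exact degree_prod_sub_prod_lt _ _
      · rw [hy0 i, eval_mul, eval_prod,
          Finset.prod_eq_zero (Finset.mem_univ i) (by simp), mul_zero]
    refine ⟨Fin.cons (∑ k, w k) y, ⟨by simpa using hW, by simpa using hy⟩, ?_⟩
    funext k
    have h1 := hPx k
    rw [hPy] at h1
    simp only [eval_mul, eval_C, eval_prod, eval_sub, eval_X] at h1
    simp only [residueMap, Fin.cons_zero, Fin.cons_succ]
    rw [h1, mul_div_cancel_right₀]
    intro h0
    have := sign_prod_erase_pos hx k
    simp [h0] at this

/-- The product of all mutual distances between `x` and `y`. -/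
def crossProd {m n : ℕ} (x : Fin m → ℝ) (y : Fin n → ℝ) : ℝ := ∏ k, ∏ i, |x k - y i|

theorem crossProd_nonneg {m n : ℕ} (x : Fin m → ℝ) (y : Fin n → ℝ) : 0 ≤ crossProd x y :=
  Finset.prod_nonneg fun _ _ => Finset.prod_nonneg fun _ _ => abs_nonneg _

theorem Interlace.crossProd_pos {n : ℕ} {x : Fin (n + 1) → ℝ} {y : Fin n → ℝ}
    (h : Interlace x y) : 0 < crossProd x y :=
  Finset.prod_pos fun k _ => Finset.prod_pos fun i _ => abs_pos.2 (sub_ne_zero.2 (h.ne k i))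

theorem continuous_crossProd {m n : ℕ} :
    Continuous fun p : (Fin m → ℝ) × (Fin n → ℝ) => crossProd p.1 p.2 := by
  unfold crossProd; fun_prop

theorem eq_ofReal_div_of_mul_eq {c d : ℝ} {T : ENNReal} (hc : 0 < c)
    (h : ENNReal.ofReal c * T = ENNReal.ofReal d) : T = ENNReal.ofReal (d / c) := by
  rw [ENNReal.ofReal_div_of_pos hc]
  exact (ENNReal.eq_div_iff (by simpa using hc) ENNReal.ofReal_ne_top).2 h

/-- Dixon's integral over the points `y` interlacing given points `x`. -/
theorem lintegral_interlace_right {n : ℕ} {γ : ℝ} (hγ : 0 < γ) {x : Fin (n + 1) → ℝ}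
    (hx : StrictMono x) :
    ∫⁻ y in {y | Interlace x y}, ENNReal.ofReal (vand y * crossProd x y ^ (γ - 1)) =
      ENNReal.ofReal (Real.Gamma γ ^ (n + 1) / Real.Gamma ((n + 1) * γ) *
        vand x ^ (2 * γ - 1)) := by
  have hV := vand_pos hx.injective
  have hG : 0 < Real.Gamma ((n + 1) * γ) := Real.Gamma_pos_of_pos (by positivity)
  -- A product of gamma densities in the weights. In the variables (v_0, y) the same integral splits
  -- into a gamma integral in v_0 of shape (n + 1)γ and the integral over y that is sought.
  have h1 : ∫⁻ w in Set.univ.pi fun _ : Fin (n + 1) => Set.Ioi (0 : ℝ),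
      ENNReal.ofReal (∏ k, (w k ^ (γ - 1) * Real.exp (-(1 * w k)))) =
        ENNReal.ofReal (Real.Gamma γ ^ (n + 1)) := by
    rw [lintegral_pi_ofReal_prod (fun _ => Set.Ioi 0) (fun _ => measurableSet_Ioi)
      (fun _ t => t ^ (γ - 1) * Real.exp (-(1 * t)))
      (fun _ => integrableOn_rpow_mul_exp_neg_mul hγ one_pos)
      fun _ t ht => mul_nonneg (Real.rpow_nonneg (le_of_lt ht) _) (Real.exp_nonneg _)]
    simp_rw [integral_rpow_mul_exp_neg_mul hγ one_pos]
    simp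
  rw [← image_residueMap hx, lintegral_image_eq_lintegral_abs_det_fderiv_mul volume
    (measurableSet_residueDomain x)
    (fun v _ => (hasFDerivAt_residueMap x v).hasFDerivWithinAt) (injOn_residueMap x)] at h1
  have h2 : ∀ v ∈ residueDomain x,
      ENNReal.ofReal |(Matrix.toLin' (residueJacobian x v)).toContinuousLinearMap.det| *
        ENNReal.ofReal (∏ k, (residueMap x v k ^ (γ - 1) * Real.exp (-(1 * residueMap x v k)))) =
      ENNReal.ofReal (vand x ^ (1 - 2 * γ)) *
        (ENNReal.ofReal (v 0 ^ ((n + 1) * γ - 1) * Real.exp (-(1 * v 0))) *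
        ENNReal.ofReal (vand (fun i => v i.succ) * crossProd x (fun i => v i.succ) ^ (γ - 1))) := by
    intro v hv
    have h0 : 0 < v 0 := hv.1
    set y := fun i : Fin n => v i.succ with hy
    have hXp : 0 < crossProd x y := hv.2.crossProd_pos
    have hVy : 0 ≤ vand y := vand_nonneg y
    have hv2 : Interlace x y := hv.2
    have hw : ∏ k, residueMap x v k = v 0 ^ (n + 1) * crossProd x y / vand x ^ 2 := by
      have hp : ∀ k, residueMap x v k = v 0 * ((∏ i, |x k - y i|) /
          |∏ j ∈ Finset.univ.erase k, (x k - x j)|) := by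
        intro k
        rw [← Finset.abs_prod, ← abs_div, abs_of_pos (prod_sub_div_prod_erase_pos hv.2 k),
          residueMap, mul_div_assoc]
      simp_rw [hp, Finset.prod_mul_distrib, Finset.prod_div_distrib, prod_abs_prod_erase]
      simp [crossProd, mul_div_assoc]
    have hpos : ∀ k, 0 < residueMap x v k := fun k => by
      have : residueMap x v ∈ Set.univ.pi fun _ : Fin (n + 1) => Set.Ioi (0 : ℝ) := by
        rw [← image_residueMap hx]; exact ⟨v, hv, rfl⟩
      exact this k trivial
    rw [ContinuousLinearMap.det, LinearMap.coe_toContinuousLinearMap, LinearMap.det_toLin',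
      abs_det_residueJacobian x v hv2, ← hy, Finset.prod_mul_distrib, ← Real.exp_sum,
      Finset.sum_neg_distrib, ← Finset.mul_sum, sum_residueMap hx.injective,
      Real.finsetProd_rpow _ _ fun k _ => (hpos k).le, hw,
      ← ENNReal.ofReal_mul (by positivity), ← ENNReal.ofReal_mul (by positivity),
      ← ENNReal.ofReal_mul (by positivity), abs_of_pos h0]
    congr 1
    rw [Real.div_rpow (by positivity) (by positivity), Real.mul_rpow (by positivity) hXp.le,
      ← Real.rpow_natCast, ← Real.rpow_natCast, ← Real.rpow_natCast, ← Real.rpow_mul h0.le,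
      ← Real.rpow_mul hV.le,
      show (n + 1) * γ - 1 = (n : ℝ) + ((n + 1 : ℕ) : ℝ) * (γ - 1) by push_cast; ring,
      Real.rpow_add h0, show 1 - 2 * γ = -1 - (2 : ℕ) * (γ - 1) by push_cast; ring,
      Real.rpow_sub hV, Real.rpow_neg_one]
    field_simp
  rw [setLIntegral_congr_fun (measurableSet_residueDomain x) h2,
    lintegral_const_mul' _ _ ENNReal.ofReal_ne_top] at h1
  have h3 : ∫⁻ v in residueDomain x,
      ENNReal.ofReal (v 0 ^ ((n + 1) * γ - 1) * Real.exp (-(1 * v 0))) *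
        ENNReal.ofReal (vand (fun i => v i.succ) * crossProd x (fun i => v i.succ) ^ (γ - 1)) =
      ENNReal.ofReal (Real.Gamma ((n + 1) * γ)) *
      ∫⁻ y in {y | Interlace x y}, ENNReal.ofReal (vand y * crossProd x y ^ (γ - 1)) := by
    have hmp := volume_preserving_piFinSuccAbove (fun _ : Fin (n + 1) => ℝ) 0
    have hpre : residueDomain x = MeasurableEquiv.piFinSuccAbove (fun _ : Fin (n + 1) => ℝ) 0 ⁻¹'
        (Set.Ioi 0 ×ˢ {y | Interlace x y}) := by
      ext v; exact Iff.rfl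
    rw [hpre]
    refine (hmp.setLIntegral_comp_preimage (f := fun p : ℝ × (Fin n → ℝ) =>
      ENNReal.ofReal (p.1 ^ ((n + 1) * γ - 1) * Real.exp (-(1 * p.1))) *
        ENNReal.ofReal (vand p.2 * crossProd x p.2 ^ (γ - 1)))
      (measurableSet_Ioi.prod (measurableSet_interlace.preimage (f := fun y => (x, y))
        (by fun_prop))) ?_).trans ?_
    · have h1 := (continuous_vand (n := n)).measurable
      have h2 : Measurable fun y : Fin n → ℝ => crossProd x y :=
        (continuous_crossProd.comp (Continuous.prodMk_right x)).measurable
      fun_prop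
    · rw [Measure.volume_eq_prod, ← Measure.prod_restrict, lintegral_prod_mul
        (f := fun t : ℝ => ENNReal.ofReal (t ^ ((n + 1) * γ - 1) * Real.exp (-(1 * t))))
        (g := fun y => ENNReal.ofReal (vand y * crossProd x y ^ (γ - 1))), ← ofReal_integral_eq_lintegral_ofReal, integral_rpow_mul_exp_neg_mul (by positivity) one_pos]
      · simp
      · exact integrableOn_rpow_mul_exp_neg_mul (by positivity) one_pos
      · exact (ae_restrict_iff' measurableSet_Ioi).2 (Eventually.of_forall fun t ht =>
          mul_nonneg (Real.rpow_nonneg (le_of_lt ht) _) (Real.exp_nonneg _))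
      · fun_prop
      · have h1 := (continuous_vand (n := n)).measurable
        have h2 : Measurable fun y : Fin n → ℝ => crossProd x y :=
          (continuous_crossProd.comp (Continuous.prodMk_right x)).measurable
        fun_prop
  rw [h3, ← mul_assoc, ← ENNReal.ofReal_mul (by positivity)] at h1
  have hc : 0 < vand x ^ (1 - 2 * γ) * Real.Gamma ((n + 1) * γ) := by positivity
  rw [eq_ofReal_div_of_mul_eq hc h1]
  congr 1
  rw [show 2 * γ - 1 = -(1 - 2 * γ) by ring, Real.rpow_neg hV.le]
  field_simp

/-! ### The companion integral over x for fixed y, by partial fractions. -/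

/-- The coefficients `a, c 1, …, c n` of `∏ (z - x k) / ∏ (z - y i) = z - a - ∑ c i / (z - y i)`. -/
def poleMap {n : ℕ} (y : Fin n → ℝ) (x : Fin (n + 1) → ℝ) : Fin (n + 1) → ℝ :=
  Fin.cons (∑ k, x k - ∑ i, y i)
    fun i => -(∏ k, (y i - x k)) / ∏ j ∈ Finset.univ.erase i, (y i - y j)

def poleJacobian {n : ℕ} (y : Fin n → ℝ) (x : Fin (n + 1) → ℝ) :
    Matrix (Fin (n + 1)) (Fin (n + 1)) ℝ :=
  Matrix.of (Fin.cons (fun _ => 1) fun i k =>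
    (∏ l ∈ Finset.univ.erase k, (y i - x l)) / ∏ j ∈ Finset.univ.erase i, (y i - y j))

theorem hasFDerivAt_poleMap {n : ℕ} (y : Fin n → ℝ) (x : Fin (n + 1) → ℝ) :
    HasFDerivAt (poleMap y) (Matrix.toLin' (poleJacobian y x)).toContinuousLinearMap x := by
  rw [hasFDerivAt_pi']
  intro k
  have hp : ∀ k, HasFDerivAt (fun x : Fin (n + 1) → ℝ => x k)
      (ContinuousLinearMap.proj (R := ℝ) (φ := fun _ : Fin (n + 1) => ℝ) k) x :=
    fun k => hasFDerivAt_apply k x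
  refine Fin.cases ?_ (fun i => ?_) k
  · simp only [poleMap, Fin.cons_zero]
    refine ((HasFDerivAt.fun_sum (u := Finset.univ) fun k _ => hp k).sub_const _).congr_fderiv ?_
    ext h
    simp [Matrix.mulVec, dotProduct, poleJacobian]
  · simp only [poleMap, Fin.cons_succ]
    refine ((HasFDerivAt.finsetProd (u := Finset.univ) fun k _ =>
      (hp k).const_sub (y i)).neg.mul_const
        (∏ j ∈ Finset.univ.erase i, (y i - y j))⁻¹).congr_fderiv ?_
    ext h
    simp [Matrix.mulVec, dotProduct, poleJacobian, Finset.mul_sum]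
    exact Finset.sum_congr rfl fun i _ => by ring

theorem poleMap_succ_pos {n : ℕ} {x : Fin (n + 1) → ℝ} {y : Fin n → ℝ} (h : Interlace x y)
    (i : Fin n) : 0 < poleMap y x i.succ := by
  have h1 := sign_prod_erase_pos h.strictMono_right i
  have h2 : 0 < (-1 : ℝ) ^ (n - 1 - (i : ℕ)) * -∏ k, (y i - x k) := by
    have hc : n - (i : ℕ) = n - 1 - (i : ℕ) + 1 := by have := i.2; omega
    have hs : (Finset.univ.filter fun k => ¬ k ≤ i.castSucc).card = n - (i : ℕ) := by
      have : (Finset.univ.filter fun k => ¬ k ≤ i.castSucc) = Finset.Ioi i.castSucc := by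
        ext; simp
      rw [this, Fin.card_Ioi]; simp
    rw [mul_neg, neg_eq_neg_one_mul, ← mul_assoc, mul_comm (-1 : ℝ), ← pow_succ, ← hc,
      ← Finset.prod_filter_mul_prod_filter_not Finset.univ (fun k => k ≤ i.castSucc),
      ← hs, mul_left_comm, ← Finset.prod_const, ← Finset.prod_mul_distrib]
    refine mul_pos (Finset.prod_pos fun k hk => ?_) (Finset.prod_pos fun k hk => ?_)
    · have := h.lt_of_le (Finset.mem_filter.1 hk).2
      linarith
    · have := h.lt_of_lt (not_le.1 (Finset.mem_filter.1 hk).2)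
      linarith
  have := div_pos h2 h1
  rwa [mul_div_mul_left _ _ (pow_ne_zero _ (by norm_num))] at this

theorem prod_poleMap {n : ℕ} {x : Fin (n + 1) → ℝ} {y : Fin n → ℝ} (h : Interlace x y) :
    ∏ i : Fin n, poleMap y x i.succ = crossProd x y / vand y ^ 2 := by
  have : ∀ i : Fin n, poleMap y x i.succ =
      (∏ k, |x k - y i|) / |∏ j ∈ Finset.univ.erase i, (y i - y j)| := fun i => by
    rw [← abs_of_pos (poleMap_succ_pos h i), poleMap, Fin.cons_succ, abs_div, abs_neg,
      Finset.abs_prod]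
    simp_rw [abs_sub_comm (y i) (x _)]
  simp_rw [this, Finset.prod_div_distrib, prod_abs_prod_erase]
  rw [Finset.prod_comm, crossProd]

/-- The transpose is the bordered Cauchy matrix with its columns multiplied by the c_i, whose
product is `prod_poleMap`. -/
theorem abs_det_poleJacobian {n : ℕ} {x : Fin (n + 1) → ℝ} {y : Fin n → ℝ} (h : Interlace x y) :
    |(poleJacobian y x).det| = vand x / vand y := by
  have hB := abs_det_bordered_cauchy x y h.strictMono_right.injective h.ne
  set B := (Matrix.of fun k => (Fin.cons 1 fun i => (x k - y i)⁻¹ : Fin (n + 1) → ℝ)) with hBd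
  have hy := vand_pos h.strictMono_right.injective
  have e : (poleJacobian y x).transpose = Matrix.of fun k j =>
      (Fin.cons 1 (fun i : Fin n => poleMap y x i.succ) : Fin (n + 1) → ℝ) j * B k j := by
    ext k j
    refine Fin.cases ?_ (fun i => ?_) j
    · simp [poleJacobian, hBd]
    · simp only [poleJacobian, hBd, Matrix.of_apply, Fin.cons_succ, Matrix.transpose_apply, poleMap]
      rw [← Finset.mul_prod_erase _ (fun k => y i - x k) (Finset.mem_univ k)]
      have h1 := sub_ne_zero.2 (h.ne k i)
      have h2 : y i - x k ≠ 0 := sub_ne_zero.2 (h.ne k i).symm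
      rw [← neg_sub (y i) (x k)]
      field_simp
  rw [← Matrix.det_transpose, e, Matrix.det_mul_row, Fin.prod_univ_succ]
  simp only [Fin.cons_zero, Fin.cons_succ, one_mul]
  rw [prod_poleMap h, abs_mul, abs_of_nonneg (div_nonneg (crossProd_nonneg _ _) (sq_nonneg _)),
    div_mul_eq_mul_div, div_eq_div_iff (by positivity) hy.ne']
  rw [crossProd]
  linear_combination vand y * hB

section

open Polynomial

theorem eval_prod_eq_neg_poleMap {n : ℕ} {y : Fin n → ℝ} (hy : StrictMono y)
    (x : Fin (n + 1) → ℝ) (i : Fin n) :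
    (∏ k, (X - C (x k))).eval (y i) =
      -(poleMap y x i.succ * ∏ j ∈ Finset.univ.erase i, (y i - y j)) := by
  have hne : ∏ j ∈ Finset.univ.erase i, (y i - y j) ≠ 0 := fun h0 => by
    have := sign_prod_erase_pos hy i
    simp [h0] at this
  simp only [poleMap, Fin.cons_succ, eval_prod, eval_sub, eval_X, eval_C]
  field_simp

/-- The polynomials ∏ (X - x_k) and (X - a) ∏ (X - y_i) share their two leading coefficients. The
next coefficient of their difference is -∑ c_i by Lagrange interpolation at y, and half the
difference of the sums of squares by Newton's identity. Thus the Gaussian weight in x decouples into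
a Gaussian in a and exponentials in the c_i. -/
theorem sum_sq_eq_poleMap {n : ℕ} {y : Fin n → ℝ} (hy : StrictMono y) (x : Fin (n + 1) → ℝ) :
    ∑ k, x k ^ 2 = poleMap y x 0 ^ 2 + ∑ i, y i ^ 2 + 2 * ∑ i : Fin n, poleMap y x i.succ := by
  rcases n with _ | n
  · simp [poleMap]
  set z : Fin (n + 2) → ℝ := Fin.cons (poleMap y x 0) y with hz
  have hsum : ∑ k, x k = ∑ k, z k := by
    rw [hz, Fin.sum_univ_succ (fun k => (Fin.cons (poleMap y x 0) y : Fin (n + 2) → ℝ) k)]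
    simp [poleMap]
  have hdeg := degree_prod_sub_prod_lt_of_sum_eq x z hsum
  have h := Lagrange.coeff_eq_sum (s := Finset.univ) (v := y) hy.injective.injOn
    (P := ∏ i, (X - C (x i)) - ∏ i, (X - C (z i))) (by simpa using hdeg)
  have hz0 : ∀ i, (∏ k, (X - C (z k))).eval (y i) = 0 := fun i => by
    rw [eval_prod]
    exact Finset.prod_eq_zero (Finset.mem_univ i.succ) (by simp [hz])
  rw [Finset.card_univ, Fintype.card_fin, Nat.add_sub_cancel, coeff_sub, coeff_prod_X_sub_C_two,
    coeff_prod_X_sub_C_two, hsum] at h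
  have h2 : ∀ i ∈ Finset.univ, (∏ i, (X - C (x i)) - ∏ i, (X - C (z i))).eval (y i) /
      ∏ j ∈ Finset.univ.erase i, (y i - y j) = -poleMap y x i.succ := fun i _ => by
    have hne : ∏ j ∈ Finset.univ.erase i, (y i - y j) ≠ 0 := fun h0 => by
      have := sign_prod_erase_pos hy i
      simp [h0] at this
    rw [eval_sub, hz0, eval_prod_eq_neg_poleMap hy, sub_zero]
    field_simp
  rw [Finset.sum_congr rfl h2, Finset.sum_neg_distrib] at h
  have h3 : ∑ k, z k ^ 2 = poleMap y x 0 ^ 2 + ∑ i, y i ^ 2 := by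
    rw [hz, Fin.sum_univ_succ (fun k => (Fin.cons (poleMap y x 0) y : Fin (n + 2) → ℝ) k ^ 2)]
    simp
  linarith

theorem injOn_poleMap {n : ℕ} {y : Fin n → ℝ} (hy : StrictMono y) :
    Set.InjOn (poleMap y) {x | Interlace x y} := by
  intro x hx x' hx' h
  refine strictMono_eq_of_prod_eq hx.strictMono_left hx'.strictMono_left ?_
  have h0 := congrFun h 0
  simp only [poleMap, Fin.cons_zero, sub_left_inj] at h0
  refine eq_of_degree_sub_lt_of_eval_index_eq (v := y) Finset.univ hy.injective.injOn
    (by simpa using degree_prod_sub_prod_lt_of_sum_eq x x' h0) fun i _ => ?_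
  rw [eval_prod_eq_neg_poleMap hy, eval_prod_eq_neg_poleMap hy, h]

theorem image_poleMap {n : ℕ} {y : Fin n → ℝ} (hy : StrictMono y) :
    poleMap y '' {x | Interlace x y} =
      Set.univ.pi (Fin.cons Set.univ fun _ => Set.Ioi 0 : Fin (n + 1) → Set ℝ) := by
  ext v
  have hpi : v ∈ Set.univ.pi (Fin.cons Set.univ fun _ => Set.Ioi 0 : Fin (n + 1) → Set ℝ) ↔
      ∀ i : Fin n, 0 < v i.succ := by
    simp only [Set.mem_univ_pi, Fin.forall_fin_succ, Fin.cons_zero, Fin.cons_succ, Set.mem_univ,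
      true_and, Set.mem_Ioi]
  rw [hpi]
  constructor
  · rintro ⟨x, hx, rfl⟩ i
    exact poleMap_succ_pos hx i
  intro hv
  set z : Fin (n + 1) → ℝ := Fin.cons (v 0) y with hz
  set S : ℝ[X] := ∑ i : Fin n, C (v i.succ) * ∏ j ∈ Finset.univ.erase i, (X - C (y j)) with hS
  have hSdeg : S.degree < (n : WithBot ℕ) := by
    rw [hS, ← mem_degreeLT]
    refine Submodule.sum_mem _ fun i _ => ?_
    rw [C_mul']
    refine Submodule.smul_mem _ _ ?_
    rw [mem_degreeLT, degree_prod_of_monic _ _ fun i _ => monic_X_sub_C _]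
    simp only [degree_X_sub_C, Finset.sum_const, Finset.card_erase_of_mem (Finset.mem_univ i),
      Finset.card_univ, Fintype.card_fin, nsmul_eq_mul, mul_one]
    have := i.2
    exact_mod_cast (by omega : n - 1 < n)
  set P : ℝ[X] := ∏ k, (X - C (z k)) - S with hP
  have hSy : ∀ i, S.eval (y i) = v i.succ * ∏ j ∈ Finset.univ.erase i, (y i - y j) := by
    intro k
    simp only [hS, eval_finsetSum, eval_mul, eval_C, eval_prod, eval_sub, eval_X]
    refine Finset.sum_eq_single k (fun l _ hl => ?_) (by simp)
    rw [Finset.prod_eq_zero (Finset.mem_erase.2 ⟨hl.symm, Finset.mem_univ k⟩) (sub_self _),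
      mul_zero]
  have hPy : ∀ i, P.eval (y i) = -(v i.succ * ∏ j ∈ Finset.univ.erase i, (y i - y j)) := by
    intro i
    rw [hP, eval_sub, hSy, eval_prod,
      Finset.prod_eq_zero (Finset.mem_univ i.succ) (by simp [hz]), zero_sub]
  have hPt : ∀ t, (∀ i, t ≠ y i) → P.eval t =
      (t - v 0 - ∑ i : Fin n, v i.succ / (t - y i)) * ∏ i, (t - y i) := by
    intro t ht
    simp only [hP, hS, eval_sub, eval_prod, eval_finsetSum, eval_mul, eval_C, eval_X]
    rw [Fin.prod_univ_succ]
    simp only [hz, Fin.cons_zero, Fin.cons_succ]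
    rw [sub_mul (t - v 0), Finset.sum_mul]
    congr 1
    refine Finset.sum_congr rfl fun i _ => ?_
    rw [← Finset.mul_prod_erase _ (fun i => t - y i) (Finset.mem_univ i)]
    have := sub_ne_zero.2 (ht i)
    field_simp
  -- Large enough that P has the signs of its leading term at ±T: every |T - y_i| and |T + y_i| is
  -- at least 1, so the polar part is at most ∑ c_i there. Adding ±T to the points y gives n + 2
  -- alternating signs, hence n + 1 zeros.
  set T : ℝ := 1 + |v 0| + ∑ i : Fin n, v i.succ + ∑ i, |y i| with hT
  have hvs : 0 ≤ ∑ i : Fin n, v i.succ := Finset.sum_nonneg fun i _ => (hv i).le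
  have hTy : ∀ i, |y i| + 1 ≤ T := fun i => by
    have := Finset.single_le_sum (fun j _ => abs_nonneg (y j)) (Finset.mem_univ i)
    have := abs_nonneg (v 0)
    linarith
  have hys : 0 ≤ ∑ i, |y i| := Finset.sum_nonneg fun i _ => abs_nonneg _
  have hlow : ∀ i, -T < y i := fun i => by linarith [hTy i, neg_abs_le (y i)]
  have hupp : ∀ i, y i < T := fun i => by linarith [hTy i, le_abs_self (y i)]
  have hT0 : 0 < T := by have := abs_nonneg (v 0); linarith
  have hPT : 0 < P.eval T := by
    rw [hPt T fun i => (hupp i).ne']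
    refine mul_pos ?_ (Finset.prod_pos fun i _ => sub_pos.2 (hupp i))
    have : ∑ i : Fin n, v i.succ / (T - y i) ≤ ∑ i : Fin n, v i.succ :=
      Finset.sum_le_sum fun i _ => div_le_self (hv i).le
        (by linarith [hTy i, le_abs_self (y i)])
    linarith [le_abs_self (v 0)]
  have hPT' : 0 < (-1 : ℝ) ^ (n + 1) * P.eval (-T) := by
    rw [hPt (-T) fun i => (hlow i).ne, pow_succ']
    have e : (∏ i, (-T - y i)) = (-1) ^ n * ∏ i, (T + y i) := by
      rw [← Fin.prod_const, ← Finset.prod_mul_distrib]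
      exact Finset.prod_congr rfl fun i _ => by ring
    have e2 : ((-1 : ℝ) ^ n) * (-1) ^ n = 1 := by rw [← mul_pow]; simp
    rw [e, show ∀ a b d : ℝ, -1 * a * (b * (a * d)) = (a * a) * (-b * d) from
      fun a b d => by ring, e2, one_mul]
    refine mul_pos ?_ (Finset.prod_pos fun i _ => by linarith [hlow i])
    have : -∑ i : Fin n, v i.succ ≤ ∑ i : Fin n, v i.succ / (-T - y i) := by
      rw [← Finset.sum_neg_distrib]
      refine Finset.sum_le_sum fun i _ => ?_
      rw [← neg_neg (-T - y i), div_neg]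
      exact neg_le_neg (div_le_self (hv i).le (by linarith [hTy i, neg_abs_le (y i)]))
    linarith [neg_abs_le (v 0)]
  set Y : Fin (n + 2) → ℝ := Fin.cons (-T) (Fin.snoc y T : Fin (n + 1) → ℝ) with hY
  have hYmono : StrictMono Y := by
    rw [Fin.strictMono_iff_lt_succ]
    intro i
    refine Fin.cases ?_ (fun i => ?_) i
    · simp only [hY, Fin.castSucc_zero, Fin.cons_zero, Fin.cons_succ]
      refine Fin.lastCases ?_ (fun j => ?_) (0 : Fin (n + 1))
      · simp; linarith
      · simpa using hlow j
    · rw [hY, Fin.castSucc_succ, Fin.cons_succ, Fin.cons_succ, Fin.snoc_castSucc]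
      by_cases hi : i.succ = Fin.last n
      · rw [hi, Fin.snoc_last]; exact hupp i
      · obtain ⟨j, hj⟩ := Fin.exists_castSucc_eq.2 hi
        rw [← hj, Fin.snoc_castSucc]
        refine hy ?_
        have := congrArg Fin.val hj
        simp at this
        exact Fin.lt_def.2 (by omega)
  obtain ⟨x, hxY, hx0⟩ := exists_interlacing_roots P hYmono fun k => by
    refine Fin.cases ?_ (fun k => ?_) k
    · simpa [hY] using hPT'
    · refine Fin.lastCases ?_ (fun i => ?_) k
      · simpa [hY] using hPT
      · simp only [hY, Fin.cons_succ, Fin.snoc_castSucc, hPy, Fin.val_succ, Fin.val_castSucc]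
        have h1 := sign_prod_erase_pos hy i
        have hc : n + 1 - ((i : ℕ) + 1) = n - 1 - (i : ℕ) + 1 := by have := i.2; omega
        rw [hc, pow_succ]
        have := mul_pos (hv i) h1
        linarith
  have hxy : Interlace x y := fun i => by
    have h1 := (hxY i.castSucc).2
    have h2 := (hxY i.succ).1
    rw [hY, Fin.cons_succ, Fin.snoc_castSucc] at h1
    rw [hY, Fin.castSucc_succ, Fin.cons_succ, Fin.snoc_castSucc] at h2
    exact ⟨h1, h2⟩
  have hPx : P = ∏ k, (X - C (x k)) := by
    refine eq_of_degree_sub_lt_of_eval_index_eq (v := x) Finset.univ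
      hxy.strictMono_left.injective.injOn ?_ fun k _ => ?_
    · rw [hP, sub_right_comm]
      refine (degree_sub_le _ _).trans_lt (max_lt ?_ ?_)
      · simpa using degree_prod_sub_prod_lt z x
      · refine hSdeg.trans ?_
        rw [Finset.card_univ, Fintype.card_fin]; exact_mod_cast Nat.lt_succ_self n
    · rw [hx0, eval_prod, Finset.prod_eq_zero (Finset.mem_univ k) (by simp)]
  refine ⟨x, hxy, ?_⟩
  funext j
  refine Fin.cases ?_ (fun i => ?_) j
  · have h1 := congrArg (fun p => p.coeff n) hPx
    simp only [hP, coeff_sub, coeff_prod_X_sub_C, hz, Fin.sum_univ_succ, Fin.cons_zero,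
      Fin.cons_succ] at h1
    rw [coeff_eq_zero_of_degree_lt hSdeg] at h1
    simp only [poleMap, Fin.cons_zero]
    rw [Fin.sum_univ_succ]
    linarith
  · have h1 := hPy i
    have hne : ∏ j ∈ Finset.univ.erase i, (y i - y j) ≠ 0 := fun h0 => by
      have := sign_prod_erase_pos hy i
      simp [h0] at this
    rw [hPx, eval_prod_eq_neg_poleMap hy, neg_inj] at h1
    exact mul_right_cancel₀ hne h1

end

/-- In the variables (a, c) the weight is a product of one Gaussian and n gamma densities of rate 2;
the map is onto ℝ × (0, ∞)ⁿ, so the integral factors. -/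
theorem lintegral_interlace_left {n : ℕ} {γ : ℝ} (hγ : 0 < γ) {y : Fin n → ℝ}
    (hy : StrictMono y) :
    ∫⁻ x in {x | Interlace x y},
        ENNReal.ofReal (vand x * crossProd x y ^ (γ - 1) * Real.exp (-∑ k, x k ^ 2)) =
      ENNReal.ofReal (√Real.pi * (2 ^ (-γ) * Real.Gamma γ) ^ n * Real.exp (-∑ i, y i ^ 2) *
        vand y ^ (2 * γ - 1)) := by
  have hV := vand_pos hy.injective
  have hms : MeasurableSet {x | Interlace x y} :=
    measurableSet_interlace.preimage (f := fun x : Fin (n + 1) → ℝ => (x, y)) (by fun_prop)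
  set f : Fin (n + 1) → ℝ → ℝ := Fin.cons (fun t => Real.exp (-1 * t ^ 2))
    fun _ t => t ^ (γ - 1) * Real.exp (-(2 * t)) with hf
  have h1 : ∫⁻ w in Set.univ.pi (Fin.cons Set.univ fun _ => Set.Ioi 0 : Fin (n + 1) → Set ℝ),
      ENNReal.ofReal (∏ k, f k (w k)) =
        ENNReal.ofReal (√Real.pi * (2 ^ (-γ) * Real.Gamma γ) ^ n) := by
    rw [lintegral_pi_ofReal_prod]
    · rw [Fin.prod_univ_succ]
      simp only [hf, Fin.cons_zero, Fin.cons_succ, integral_rpow_mul_exp_neg_mul hγ two_pos,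
        Measure.restrict_univ, integral_gaussian]
      simp
    · intro i
      refine Fin.cases ?_ (fun i => ?_) i
      · exact MeasurableSet.univ
      · exact measurableSet_Ioi
    · intro i
      refine Fin.cases ?_ (fun i => ?_) i
      · exact (integrable_exp_neg_mul_sq one_pos).integrableOn
      · exact integrableOn_rpow_mul_exp_neg_mul hγ two_pos
    · intro i
      refine Fin.cases ?_ (fun i => ?_) i
      · exact fun _ _ => Real.exp_nonneg _
      · exact fun t ht => mul_nonneg (Real.rpow_nonneg (le_of_lt ht) _) (Real.exp_nonneg _)
  rw [← image_poleMap hy, lintegral_image_eq_lintegral_abs_det_fderiv_mul volume hms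
    (fun v _ => (hasFDerivAt_poleMap y v).hasFDerivWithinAt) (injOn_poleMap hy)] at h1
  have h2 : ∀ x ∈ {x | Interlace x y},
      ENNReal.ofReal |(Matrix.toLin' (poleJacobian y x)).toContinuousLinearMap.det| *
        ENNReal.ofReal (∏ k, f k (poleMap y x k)) =
      ENNReal.ofReal (vand y ^ (1 - 2 * γ) * Real.exp (∑ i, y i ^ 2)) *
        ENNReal.ofReal (vand x * crossProd x y ^ (γ - 1) * Real.exp (-∑ k, x k ^ 2)) := by
    intro x hx
    have hXp : 0 < crossProd x y := Interlace.crossProd_pos hx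
    rw [ContinuousLinearMap.det, LinearMap.coe_toContinuousLinearMap, LinearMap.det_toLin',
      abs_det_poleJacobian hx, Fin.prod_univ_succ,
      ← ENNReal.ofReal_mul (div_nonneg (vand_nonneg _) hV.le), ← ENNReal.ofReal_mul (by positivity)]
    simp only [hf, Fin.cons_zero, Fin.cons_succ]
    congr 1
    rw [Finset.prod_mul_distrib, ← Real.exp_sum, Finset.sum_neg_distrib, ← Finset.mul_sum,
      Real.finsetProd_rpow _ _ fun k _ => (poleMap_succ_pos hx k).le, prod_poleMap hx,
      sum_sq_eq_poleMap hy x, Real.div_rpow hXp.le (by positivity),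
      ← Real.rpow_natCast (vand y), ← Real.rpow_mul hV.le, show 1 - 2 * γ = -1 - (2 : ℕ) * (γ - 1) by push_cast; ring,
      Real.rpow_sub hV, Real.rpow_neg_one,
      show -(poleMap y x 0 ^ 2 + ∑ i, y i ^ 2 + 2 * ∑ i : Fin n, poleMap y x i.succ) =
        -1 * poleMap y x 0 ^ 2 + -(2 * ∑ i : Fin n, poleMap y x i.succ) - ∑ i, y i ^ 2 by ring,
      Real.exp_sub, Real.exp_add]
    field_simp
  rw [setLIntegral_congr_fun hms h2, lintegral_const_mul' _ _ ENNReal.ofReal_ne_top] at h1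
  rw [eq_ofReal_div_of_mul_eq (by positivity) h1]
  congr 1
  rw [show 2 * γ - 1 = -(1 - 2 * γ) by ring, Real.rpow_neg hV.le, Real.exp_neg]
  field_simp

/-! ### The recursion for Γ_{n,β} and the resulting coefficients. -/

/-- The weight of the Gaussian `β`-ensemble (with exponent `2 γ`), integrated over ordered points. -/
def orderedGaussian (n : ℕ) (γ : ℝ) : ENNReal :=
  ∫⁻ x in {x : Fin n → ℝ | StrictMono x},
    ENNReal.ofReal (vand x ^ (2 * γ) * Real.exp (-∑ k, x k ^ 2))

theorem measurableSet_strictMono {n : ℕ} : MeasurableSet {x : Fin n → ℝ | StrictMono x} := by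
  have : {x : Fin n → ℝ | StrictMono x} = ⋂ i, ⋂ j, {x | i < j → x i < x j} := by
    ext; simp [StrictMono]
  rw [this]
  refine MeasurableSet.iInter fun i => MeasurableSet.iInter fun j => ?_
  by_cases h : i < j
  · simpa [h] using measurableSet_lt (measurable_pi_apply i) (measurable_pi_apply j)
  · simp [h]

/-- Tonelli's theorem for the weight `H` on interlacing pairs: integrating out y raises the power of
the Vandermonde product of x to 2γ, integrating out x does the same for y, and the two results are
constants times the ensembles of n + 1 and n points. -/
theorem orderedGaussian_succ (n : ℕ) {γ : ℝ} (hγ : 0 < γ) :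
    orderedGaussian (n + 1) γ =
      ENNReal.ofReal (√Real.pi * 2 ^ (-(γ * n)) * Real.Gamma ((n + 1) * γ) / Real.Gamma γ) *
        orderedGaussian n γ := by
  have hG : 0 < Real.Gamma γ := Real.Gamma_pos_of_pos hγ
  have hG' : 0 < Real.Gamma ((n + 1) * γ) := Real.Gamma_pos_of_pos (by positivity)
  set H : (Fin (n + 1) → ℝ) → (Fin n → ℝ) → ENNReal := fun x y =>
    {p : (Fin (n + 1) → ℝ) × (Fin n → ℝ) | Interlace p.1 p.2}.indicator (fun p =>
      ENNReal.ofReal (vand p.1 * vand p.2 * crossProd p.1 p.2 ^ (γ - 1) *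
        Real.exp (-∑ k, p.1 k ^ 2))) (x, y) with hH
  have hHm : Measurable (Function.uncurry H) := by
    refine Measurable.indicator ?_ measurableSet_interlace
    have h1 := (continuous_vand (n := n)).measurable
    have h2 := (continuous_vand (n := n + 1)).measurable
    have h3 := (continuous_crossProd (m := n + 1) (n := n)).measurable
    fun_prop
  have hx : ∀ x, ENNReal.ofReal (Real.Gamma ((n + 1) * γ) / Real.Gamma γ ^ (n + 1)) *
      ∫⁻ y, H x y = {x : Fin (n + 1) → ℝ | StrictMono x}.indicator
        (fun x => ENNReal.ofReal (vand x ^ (2 * γ) * Real.exp (-∑ k, x k ^ 2))) x := by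
    intro x
    have hms : MeasurableSet {y | Interlace x y} :=
      measurableSet_interlace.preimage (f := fun y : Fin n → ℝ => (x, y)) (by fun_prop)
    by_cases hxm : StrictMono x
    · have hV := vand_pos hxm.injective
      rw [Set.indicator_of_mem (by exact hxm)]
      have : ∀ y, H x y = {y | Interlace x y}.indicator (fun y =>
          ENNReal.ofReal (vand x * Real.exp (-∑ k, x k ^ 2)) *
            ENNReal.ofReal (vand y * crossProd x y ^ (γ - 1))) y := by
        intro y
        by_cases hy : Interlace x y
        · simp only [hH]
          rw [Set.indicator_of_mem (by exact hy), Set.indicator_of_mem (by exact hy),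
            ← ENNReal.ofReal_mul (by positivity)]
          congr 1; ring
        · simp only [hH]
          rw [Set.indicator_of_notMem (by exact hy), Set.indicator_of_notMem (by exact hy)]
      simp_rw [this]
      rw [lintegral_indicator hms, lintegral_const_mul' _ _ ENNReal.ofReal_ne_top,
        lintegral_interlace_right hγ hxm, ← ENNReal.ofReal_mul (by positivity),
        ← ENNReal.ofReal_mul (by positivity)]
      congr 1
      rw [Real.rpow_sub_one hV.ne']
      field_simp
    · rw [Set.indicator_of_notMem (by exact hxm)]
      have : ∀ y, H x y = 0 := fun y => by
        simp only [hH]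
        rw [Set.indicator_of_notMem fun h => hxm (Interlace.strictMono_left h)]
      simp [this]
  have hy : ∀ y, ∫⁻ x, H x y = ENNReal.ofReal (√Real.pi * (2 ^ (-γ) * Real.Gamma γ) ^ n) *
      {y : Fin n → ℝ | StrictMono y}.indicator
        (fun y => ENNReal.ofReal (vand y ^ (2 * γ) * Real.exp (-∑ k, y k ^ 2))) y := by
    intro y
    have hms : MeasurableSet {x | Interlace x y} :=
      measurableSet_interlace.preimage (f := fun x : Fin (n + 1) → ℝ => (x, y)) (by fun_prop)
    by_cases hym : StrictMono y
    · have hV := vand_pos hym.injective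
      rw [Set.indicator_of_mem (by exact hym)]
      have : ∀ x, H x y = {x | Interlace x y}.indicator (fun x =>
          ENNReal.ofReal (vand y) *
            ENNReal.ofReal (vand x * crossProd x y ^ (γ - 1) * Real.exp (-∑ k, x k ^ 2))) x := by
        intro x
        by_cases hx : Interlace x y
        · simp only [hH]
          rw [Set.indicator_of_mem (by exact hx), Set.indicator_of_mem (by exact hx),
            ← ENNReal.ofReal_mul (by positivity)]
          congr 1; ring
        · simp only [hH]
          rw [Set.indicator_of_notMem (by exact hx), Set.indicator_of_notMem (by exact hx)]
      simp_rw [this]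
      rw [lintegral_indicator hms, lintegral_const_mul' _ _ ENNReal.ofReal_ne_top,
        lintegral_interlace_left hγ hym, ← ENNReal.ofReal_mul (by positivity),
        ← ENNReal.ofReal_mul (by positivity)]
      congr 1
      rw [Real.rpow_sub_one hV.ne']
      field_simp
    · rw [Set.indicator_of_notMem (by exact hym)]
      have : ∀ x, H x y = 0 := fun x => by
        simp only [hH]
        rw [Set.indicator_of_notMem fun h => hym (Interlace.strictMono_right h)]
      simp [this]
  have hswap := lintegral_lintegral_swap (μ := volume) (ν := volume) (f := H) hHm.aemeasurable
  rw [orderedGaussian, ← lintegral_indicator measurableSet_strictMono]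
  simp_rw [← hx]
  rw [lintegral_const_mul' _ _ ENNReal.ofReal_ne_top, hswap]
  simp_rw [hy]
  rw [lintegral_const_mul' _ _ ENNReal.ofReal_ne_top, lintegral_indicator measurableSet_strictMono,
    ← orderedGaussian, ← mul_assoc, ← ENNReal.ofReal_mul (by positivity)]
  congr 2
  rw [mul_pow, ← Real.rpow_natCast (2 ^ (-γ)), ← Real.rpow_mul two_pos.le, neg_mul]
  field_simp
  ring

theorem piCongrLeft_symm_eq_comp {n : ℕ} (σ : Equiv.Perm (Fin n)) :
    ⇑(MeasurableEquiv.piCongrLeft (fun _ : Fin n => ℝ) σ.symm) = fun x => x ∘ σ := by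
  funext x i
  have := MeasurableEquiv.piCongrLeft_apply_apply σ.symm (β := fun _ => ℝ) x (σ i)
  rwa [Equiv.symm_apply_apply] at this

theorem measurePreserving_comp_perm {n : ℕ} (σ : Equiv.Perm (Fin n)) :
    MeasurePreserving (fun x : Fin n → ℝ => x ∘ σ) := by
  rw [← piCongrLeft_symm_eq_comp]
  exact volume_measurePreserving_piCongrLeft (fun _ : Fin n => ℝ) σ.symm

theorem measurableEmbedding_comp_perm {n : ℕ} (σ : Equiv.Perm (Fin n)) :
    MeasurableEmbedding (fun x : Fin n → ℝ => x ∘ σ) := by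
  rw [← piCongrLeft_symm_eq_comp]
  exact MeasurableEquiv.measurableEmbedding _

theorem ae_injective {n : ℕ} : ∀ᵐ x : Fin n → ℝ, Function.Injective x := by
  have : ∀ᵐ x : Fin n → ℝ, ∀ i j, i ≠ j → x i ≠ x j := by
    rw [ae_all_iff]; intro i
    rw [ae_all_iff]; intro j
    by_cases hij : i = j
    · simp [hij]
    let l : (Fin n → ℝ) →ₗ[ℝ] ℝ := LinearMap.proj (R := ℝ) (φ := fun _ : Fin n => ℝ) i -
      LinearMap.proj (R := ℝ) (φ := fun _ : Fin n => ℝ) j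
    have h := Measure.addHaar_submodule volume (LinearMap.ker l) fun h => by
        rw [LinearMap.ker_eq_top] at h
        have h1 : (Pi.single i 1 : Fin n → ℝ) i - (Pi.single i 1 : Fin n → ℝ) j = 0 :=
          LinearMap.congr_fun h (Pi.single i 1)
        rw [Pi.single_eq_same, Pi.single_eq_of_ne (Ne.symm hij)] at h1
        norm_num at h1
    refine measure_mono_null (fun x hx => ?_) h
    simpa [l, hij, sub_eq_zero] using hx
  filter_upwards [this] with x hx i j h
  by_contra hne; exact hx i j hne h

/-- Up to a null set the space is the disjoint union of the n! chambers of ordered coordinates,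
which permutations exchange. -/
theorem lintegral_eq_factorial_mul_strictMono {n : ℕ} (F : (Fin n → ℝ) → ENNReal)
    (hF : ∀ (σ : Equiv.Perm (Fin n)) x, F (x ∘ σ) = F x) :
    ∫⁻ x, F x = n.factorial * ∫⁻ x in {x | StrictMono x}, F x := by
  set S : Equiv.Perm (Fin n) → Set (Fin n → ℝ) := fun σ => {x | StrictMono (x ∘ σ)} with hS
  have hmp := measurePreserving_comp_perm (n := n)
  have hSm : ∀ σ, MeasurableSet (S σ) := fun σ =>
    measurableSet_strictMono.preimage (hmp σ).measurable
  have hdisj : Pairwise (Function.onFun Disjoint S) := by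
    intro σ τ hst
    refine Set.disjoint_left.2 fun x h1 h2 => hst ?_
    have hinj : Function.Injective x := by
      have h1 : StrictMono (x ∘ σ) := h1
      simpa using h1.injective.comp σ.symm.injective |>.comp (f := id) Function.injective_id
    have := Tuple.unique_monotone (StrictMono.monotone h1) (StrictMono.monotone h2)
    ext i
    exact congrArg _ (hinj (congrFun this i))
  have hcov : (⋃ σ, S σ) =ᵐ[volume] Set.univ := by
    rw [eventuallyEq_univ]
    filter_upwards [ae_injective] with x hx
    refine Set.mem_iUnion.2 ⟨Tuple.sort x, ?_⟩
    refine (Tuple.monotone_sort x).strictMono_of_injective ?_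
    exact hx.comp (Tuple.sort x).injective
  rw [← setLIntegral_univ, ← setLIntegral_congr hcov, lintegral_iUnion hSm hdisj, tsum_fintype]
  have : ∀ σ, ∫⁻ x in S σ, F x = ∫⁻ x in {x | StrictMono x}, F x := fun σ => by
    have h := (hmp σ).setLIntegral_comp_preimage_emb (measurableEmbedding_comp_perm σ) F {x | StrictMono x}
    rw [← h]
    exact setLIntegral_congr_fun (hSm σ) fun x _ => (hF σ x).symm
  simp [this, Fintype.card_perm]

theorem pairProduct_eq_vand_rpow (β : ℕ) {n : ℕ} (u : Fin n → ℝ) :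
    pairProduct β u = vand u ^ (4 / (β : ℝ)) := by
  rw [vand, ← Real.finsetProd_rpow _ _ fun _ _ => Finset.prod_nonneg fun _ _ => abs_nonneg _]
  refine Finset.prod_congr rfl fun j _ => ?_
  rw [← Real.finsetProd_rpow _ _ fun _ _ => abs_nonneg _]
  rfl

/-- The square is a product over all ordered pairs, which is visibly symmetric. -/
theorem vand_comp_perm {n : ℕ} (σ : Equiv.Perm (Fin n)) (x : Fin n → ℝ) :
    vand (x ∘ σ) = vand x := by
  have h : ∀ x : Fin n → ℝ, vand x = √(∏ i, ∏ j, if i = j then 1 else |x i - x j|) := fun x => by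
    rw [← Real.sqrt_sq (vand_nonneg x), ← prod_prod_erase_abs]
    congr 1
    refine Finset.prod_congr rfl fun i _ => ?_
    rw [← Finset.mul_prod_erase _ _ (Finset.mem_univ i), if_pos rfl, one_mul]
    exact Finset.prod_congr rfl fun j hj => (if_neg (Finset.ne_of_mem_erase hj).symm).symm
  rw [h, h]
  congr 1
  rw [← Equiv.prod_comp σ fun i => ∏ j, if i = j then (1 : ℝ) else |x i - x j|]
  refine Finset.prod_congr rfl fun i _ => ?_
  rw [← Equiv.prod_comp σ fun j => if σ i = j then (1 : ℝ) else |x (σ i) - x j|]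
  simp

theorem gammaIntegral_eq (n β : ℕ) :
    gammaIntegral n β = n.factorial * (orderedGaussian n (2 / β)).toReal := by
  have hc : Continuous (vand (n := n)) := continuous_vand
  have h1 : ∀ u : Fin n → ℝ, (∏ i, Real.exp (-(u i) ^ 2)) * pairProduct β u =
      vand u ^ (2 * (2 / (β : ℝ))) * Real.exp (-∑ k, u k ^ 2) := fun u => by
    rw [pairProduct_eq_vand_rpow, ← Real.exp_sum, Finset.sum_neg_distrib, mul_comm]
    congr 2; ring
  rw [gammaIntegral]
  simp_rw [h1]
  rw [integral_eq_lintegral_of_nonneg_ae, lintegral_eq_factorial_mul_strictMono, ← orderedGaussian]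
  · simp
  · intro σ x
    rw [vand_comp_perm]
    congr 4
    exact Equiv.sum_comp σ fun i => x i ^ 2
  · exact Eventually.of_forall fun x => mul_nonneg (Real.rpow_nonneg (vand_nonneg _) _)
      (Real.exp_nonneg _)
  · have := hc.measurable
    exact Measurable.aestronglyMeasurable (by fun_prop)

theorem gammaIntegral_zero (β : ℕ) : gammaIntegral 0 β = 1 := by
  simp [gammaIntegral, pairProduct, integral_unique, measureReal_def, volume_pi]

/-- The recursion behind Mehta's integral. -/
theorem gammaIntegral_succ (n : ℕ) {β : ℕ} (hβ : 0 < β) :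
    gammaIntegral (n + 1) β =
      (n + 1) * (√Real.pi * 2 ^ (-(2 / (β : ℝ) * n)) * Real.Gamma ((n + 1) * (2 / β)) /
        Real.Gamma (2 / β)) * gammaIntegral n β := by
  have hγ : (0 : ℝ) < 2 / β := by positivity
  have hG : 0 < Real.Gamma (2 / (β : ℝ)) := Real.Gamma_pos_of_pos hγ
  have hG' : 0 < Real.Gamma ((n + 1) * (2 / (β : ℝ))) := Real.Gamma_pos_of_pos (by positivity)
  rw [gammaIntegral_eq, gammaIntegral_eq, orderedGaussian_succ n hγ, ENNReal.toReal_mul,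
    ENNReal.toReal_ofReal (by positivity), Nat.factorial_succ]
  push_cast
  ring

theorem gammaIntegral_pos (n : ℕ) {β : ℕ} (hβ : 0 < β) : 0 < gammaIntegral n β := by
  induction n with
  | zero => simp [gammaIntegral_zero]
  | succ n ih =>
    have hγ : (0 : ℝ) < 2 / β := by positivity
    have hG : 0 < Real.Gamma (2 / (β : ℝ)) := Real.Gamma_pos_of_pos hγ
    have hG' : 0 < Real.Gamma ((n + 1) * (2 / (β : ℝ))) := Real.Gamma_pos_of_pos (by positivity)
    rw [gammaIntegral_succ n hβ]
    positivity

/-- Passing from k to k + 1 uses the recursion once upwards from b + k and once downwards from b -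
k. The factors b + k + 1 and b - k are absorbed by the ratio of binomial coefficients, and what is
left is one ratio of gamma functions and a power of 2. -/
theorem choose_mul_gammaIntegral_mul (b k : ℕ) (hk : k ≤ b) (hb : 0 < b) :
    ((2 * b).choose (b + k) : ℝ) * (gammaIntegral (b + k) (2 * b) * gammaIntegral (b - k) (2 * b)) =
      (2 * b).choose b * gammaIntegral b (2 * b) ^ 2 * 2 ^ (-(k ^ 2 / b : ℝ)) *
        ∏ j ∈ Finset.range k, Real.Gamma (1 + (j + 1) / b) / Real.Gamma (1 - j / b) := by
  have hb' : (0 : ℝ) < b := by exact_mod_cast hb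
  induction k with
  | zero => simp [sq]
  | succ k ih =>
    have ih := ih (by omega)
    have hkb : (k : ℝ) < b := by exact_mod_cast hk
    have hγ : (2 : ℝ) / ((2 * b : ℕ) : ℝ) = 1 / b := by push_cast; field_simp
    have h1 := gammaIntegral_succ (b + k) (β := 2 * b) (by omega)
    have h2 := gammaIntegral_succ (b - (k + 1)) (β := 2 * b) (by omega)
    rw [show b - (k + 1) + 1 = b - k by omega] at h2
    have hc : ((2 * b).choose (b + k + 1) : ℝ) * (b + k + 1) = (2 * b).choose (b + k) * (b - k) := by
      have := Nat.choose_succ_right_eq (2 * b) (b + k)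
      rw [show 2 * b - (b + k) = b - k by omega] at this
      have h := congrArg (Nat.cast (R := ℝ)) this
      rw [Nat.cast_mul, Nat.cast_mul, Nat.cast_sub (by omega)] at h
      push_cast at h
      linarith
    rw [hγ] at h1 h2
    have e1 : (((b + k : ℕ) : ℝ) + 1) * (1 / b) = 1 + (k + 1) / b := by
      push_cast; field_simp; ring
    have e2 : (((b - (k + 1) : ℕ) : ℝ) + 1) * (1 / b) = 1 - k / b := by
      rw [Nat.cast_sub hk]; push_cast; field_simp; ring
    rw [e1] at h1
    rw [e2] at h2
    rw [Nat.cast_sub hk] at h2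
    push_cast at h1 h2
    have hG0 : 0 < Real.Gamma (1 / (b : ℝ)) := Real.Gamma_pos_of_pos (by positivity)
    have hG2 : 0 < Real.Gamma (1 - k / (b : ℝ)) := Real.Gamma_pos_of_pos (by
      rw [sub_pos, div_lt_one hb']; exact hkb)
    have hp : ∀ t : ℝ, (2 : ℝ) ^ (-(1 / b * t) : ℝ) = (2 ^ (1 / b * t : ℝ))⁻¹ := fun t =>
      Real.rpow_neg two_pos.le _
    -- The exponents b + k and b - k - 1 of the two recursions differ by 2k + 1 = (k + 1)² - k²,
    -- which produces the square in the power of 2.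
    have e3 : (2 : ℝ) ^ (1 / b * (b + k : ℝ) : ℝ) =
        2 ^ ((k ^ 2 + 2 * k + 1) / b : ℝ) / 2 ^ (k ^ 2 / b : ℝ) *
          2 ^ (1 / b * (b - (k + 1)) : ℝ) := by
      rw [← Real.rpow_sub two_pos, ← Real.rpow_add two_pos]
      congr 1; field_simp; ring
    rw [Finset.prod_range_succ, ← mul_assoc ((2 * b).choose b * gammaIntegral b (2 * b) ^ 2 *
      2 ^ (-(((k + 1 : ℕ) : ℝ) ^ 2 / b) : ℝ))]
    rw [Real.rpow_neg two_pos.le] at ih ⊢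
    rw [← add_assoc, h1, hp, e3]
    rw [h2, hp] at ih
    have e4 : ((k + 1 : ℕ) : ℝ) ^ 2 / b = (k ^ 2 + 2 * k + 1) / b := by push_cast; ring
    rw [e4]
    set X := (2 : ℝ) ^ (1 / b * (b - (k + 1)) : ℝ)
    have hX : 0 < X := by positivity
    set Y := (2 : ℝ) ^ ((k ^ 2 + 2 * k + 1) / b : ℝ)
    have hY : 0 < Y := by positivity
    set Z := (2 : ℝ) ^ (k ^ 2 / b : ℝ)
    have hZ : 0 < Z := by positivity
    set G := gammaIntegral (b - (k + 1)) (2 * b)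
    set Pr := ∏ j ∈ Finset.range k, Real.Gamma (1 + (j + 1) / b) / Real.Gamma (1 - j / (b : ℝ))
    set D := ((2 * b).choose b : ℝ) * gammaIntegral b (2 * b) ^ 2
    set A := gammaIntegral (b + k) (2 * b)
    generalize Real.Gamma (1 - k / (b : ℝ)) = g2 at *
    generalize Real.Gamma (1 + (k + 1) / (b : ℝ)) = g1 at *
    generalize Real.Gamma (1 / (b : ℝ)) = g0 at *
    have hbk : (b : ℝ) - k ≠ 0 := by linarith
    have hbk' : (b : ℝ) + k + 1 ≠ 0 := by positivity
    have e5 : ((2 * b).choose (b + k + 1) : ℝ) = (2 * b).choose (b + k) * (b - k) / (b + k + 1) := by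
      field_simp; linarith
    rw [e5]
    field_simp at ih ⊢
    linear_combination g1 * ih

theorem prod_Icc_gamma_eq (β k : ℕ) :
    (∏ j ∈ Finset.Icc 1 k, Real.Gamma (1 + 2 * (j : ℝ) / β) /
        Real.Gamma (1 + 2 * ((j : ℝ) - k) / β)) =
      ∏ j ∈ Finset.range k, Real.Gamma (1 + 2 * ((j : ℝ) + 1) / β) /
        Real.Gamma (1 - 2 * (j : ℝ) / β) := by
  rw [← Finset.Ico_succ_right_eq_Icc, Finset.prod_Ico_eq_prod_range]
  simp only [Order.succ_eq_add_one, Nat.add_sub_cancel]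
  rw [Finset.prod_div_distrib, Finset.prod_div_distrib]
  congr 1
  · exact Finset.prod_congr rfl fun j _ => by push_cast; ring_nf
  · rw [← Finset.prod_range_reflect]
    refine Finset.prod_congr rfl fun j hj => ?_
    have hj := Finset.mem_range.1 hj
    congr 1
    rw [Nat.sub_sub, Nat.cast_add, Nat.cast_sub (by omega)]
    push_cast; ring

/-! ### Coordinatewise substitution and holomorphic parameter integrals. -/

theorem setIntegral_pi_image {ι : Type*} [Fintype ι] {s : ι → Set ℝ}
    (hs : ∀ i, MeasurableSet (s i)) {φ φ' : ι → ℝ → ℝ}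
    (hφ : ∀ i, ∀ t ∈ s i, HasDerivWithinAt (φ i) (φ' i t) (s i) t)
    (hinj : ∀ i, Set.InjOn (φ i) (s i)) (F : (ι → ℝ) → ℂ) :
    ∫ x in Set.univ.pi fun i => φ i '' s i, F x =
      ∫ t in Set.univ.pi s, (∏ i, |φ' i (t i)| : ℝ) • F fun i => φ i (t i) := by
  have him : (Set.univ.pi fun i => φ i '' s i) = Pi.map φ '' Set.univ.pi s :=
    (Set.piMap_image_univ_pi _ _).symm
  rw [him, integral_image_eq_integral_abs_det_fderiv_smul volume (MeasurableSet.univ_pi hs)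
    (f' := fun t => ContinuousLinearMap.pi fun i =>
      (ContinuousLinearMap.toSpanSingleton ℝ (φ' i (t i))).comp (ContinuousLinearMap.proj i))]
  · refine setIntegral_congr_fun (MeasurableSet.univ_pi hs) fun t _ => ?_
    simp only [ContinuousLinearMap.det_pi, ContinuousLinearMap.det_toSpanSingleton,
      Finset.abs_prod]
    rfl
  · intro t ht
    rw [hasFDerivWithinAt_pi]
    intro i
    exact (hφ i (t i) (ht i trivial)).hasFDerivWithinAt.comp t
      (ContinuousLinearMap.proj (R := ℝ) (φ := fun _ : ι => ℝ) i).hasFDerivWithinAt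
      fun x hx => hx i trivial
  · intro x hx y hy h
    funext i
    exact hinj i (hx i trivial) (hy i trivial) (congrFun h i)

/-- Holomorphy of an integral depending on a complex parameter. -/
theorem differentiableOn_integral {α : Type*} [MeasurableSpace α] {μ : Measure α} {U : Set ℂ}
    (hU : IsOpen U) {F : ℂ → α → ℂ} (hm : ∀ s ∈ U, AEStronglyMeasurable (F s) μ)
    (hd : ∀ᵐ a ∂μ, DifferentiableOn ℂ (fun s => F s a) U)
    (hb : ∀ s₀ ∈ U, ∃ bound : α → ℝ, Integrable bound μ ∧
      ∃ r > 0, ∀ᵐ a ∂μ, ∀ s ∈ Metric.ball s₀ r, ‖F s a‖ ≤ bound a) :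
    DifferentiableOn ℂ (fun s => ∫ a, F s a ∂μ) U := by
  intro s₀ hs₀
  obtain ⟨bound, hbi, r₁, hr₁, hbd⟩ := hb s₀ hs₀
  obtain ⟨r₂, hr₂, hball⟩ := Metric.isOpen_iff.1 hU s₀ hs₀
  set r := min r₁ r₂ with hr
  have hr0 : 0 < r := lt_min hr₁ hr₂
  have hint : Integrable (F s₀) μ := hbi.mono' (hm s₀ hs₀)
    (hbd.mono fun a ha => ha s₀ (Metric.mem_ball_self hr₁))
  refine (hasDerivAt_integral_of_dominated_loc_of_deriv_le
    (F' := fun s a => deriv (fun s => F s a) s) (bound := fun a => bound a / (r / 4))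
    (Metric.ball_mem_nhds s₀ (by positivity : 0 < r / 2))
    ((hU.eventually_mem hs₀).mono hm) hint ?_ ?_ (hbi.div_const _)
    ?_).2.differentiableAt.differentiableWithinAt
  -- The derivative is measurable in a as a limit of difference quotients along a sequence.
  · have hlim : ∀ᵐ a ∂μ, Tendsto (fun n : ℕ => ((r / 2 / (n + 1) : ℝ) : ℂ)⁻¹ *
        (F (s₀ + ((r / 2 / (n + 1) : ℝ) : ℂ)) a - F s₀ a)) atTop
        (𝓝 (deriv (fun s => F s a) s₀)) := by
      filter_upwards [hd] with a ha
      have h1 := ((ha s₀ hs₀).differentiableAt (hU.mem_nhds hs₀)).hasDerivAt.tendsto_slope_zero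
      have h2 : Tendsto (fun n : ℕ => ((r / 2 / (n + 1) : ℝ) : ℂ)) atTop (𝓝[≠] 0) := by
        rw [tendsto_nhdsWithin_iff]
        constructor
        · have : Tendsto (fun n : ℕ => r / 2 / ((n : ℝ) + 1)) atTop (𝓝 0) :=
            tendsto_const_nhds.div_atTop (tendsto_natCast_atTop_atTop.atTop_add tendsto_const_nhds)
          have := (continuous_ofReal.tendsto 0).comp this
          rwa [ofReal_zero] at this
        · refine Eventually.of_forall fun n => ?_
          have : r / 2 / ((n : ℝ) + 1) ≠ 0 := by positivity
          simpa using ofReal_ne_zero.2 this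
      simpa [Function.comp_def, smul_eq_mul] using h1.comp h2
    refine aestronglyMeasurable_of_tendsto_ae atTop (fun n => ?_) hlim
    refine ((hm _ (hball ?_)).sub (hm s₀ hs₀)).const_mul _
    rw [Metric.mem_ball, dist_self_add_left, norm_real, Real.norm_of_nonneg (by positivity)]
    calc r / 2 / ((n : ℝ) + 1) ≤ r / 2 := div_le_self (by positivity) (by linarith [n.cast_nonneg (α := ℝ)])
      _ < r₂ := by linarith [min_le_right r₁ r₂]
  · filter_upwards [hd, hbd] with a ha hba s hs
    -- Cauchy's estimate on a circle of radius r/4 bounds the derivative throughout the ball of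
    -- radius r/2 by bound/(r/4).
    have hsub : Metric.closedBall s (r / 4) ⊆ Metric.ball s₀ r := by
      refine Metric.closedBall_subset_ball' ?_
      rw [Metric.mem_ball] at hs
      linarith
    refine norm_deriv_le_of_forall_mem_sphere_norm_le (by positivity) ?_ fun z hz =>
      hba z (Metric.ball_subset_ball (min_le_left _ _) (hsub (Metric.sphere_subset_closedBall hz)))
    refine (ha.mono ?_).diffContOnCl
    rw [closure_ball _ (by positivity)]
    exact hsub.trans ((Metric.ball_subset_ball (min_le_right _ _)).trans hball)
  · filter_upwards [hd] with a ha s hs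
    have hsU : s ∈ U := hball (Metric.ball_subset_ball (by
      linarith [min_le_right r₁ r₂]) hs)
    exact ((ha s hsU).differentiableAt (hU.mem_nhds hsU)).hasDerivAt

/-! ### Contours in the coordinate z = -i ln u and their deformation. -/

/-- The strip which the exponential map `z ↦ e^{iz}` sends to the cut plane. -/
def strip : Set ℂ := {z | 0 < z.re ∧ z.re < 2 * Real.pi}

theorem isOpen_strip : IsOpen strip :=
  (isOpen_lt continuous_const continuous_re).inter (isOpen_lt continuous_re continuous_const)

/-- The parameter interval of the contours. -/
abbrev arc : Set ℝ := Set.Ioo 0 (2 * Real.pi)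

/-- The distance `2 sin (|t - t'| / 2)` on the circle, continued to the contour `z`. -/
def pairDist (z : ℝ → ℂ) (t t' : ℝ) : ℂ := (Real.sign (t' - t) : ℂ) * (2 * sin ((z t' - z t) / 2))

/-- The interaction factor of the contour `z`, where `p` is the exponent. -/
def interaction (p : ℝ) (z : ℝ → ℂ) {n : ℕ} (t : Fin n → ℝ) : ℂ :=
  ∏ j, ∏ k ∈ Finset.Ioi j, pairDist z (t j) (t k) ^ (p : ℂ)

/-- Here `z'` stands for the derivative of `z`, while the Jacobian du/dz of u = e^{iz} is meant to
be part of `A`. -/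
def contourIntegral (n : ℕ) (p : ℝ) (A : ℂ → ℂ) (z z' : ℝ → ℂ) : ℂ :=
  ∫ t in Set.univ.pi fun _ : Fin n => arc, (∏ j, A (z (t j)) * z' (t j)) * interaction p z t

theorem re_sin_pos {w : ℂ} (h0 : 0 < w.re) (h1 : w.re < Real.pi) : 0 < (sin w).re := by
  rw [← re_add_im w, sin_add_mul_I]
  rw [← ofReal_sin, ← ofReal_cos, ← ofReal_cosh, ← ofReal_sinh]
  simp only [add_re, mul_re, ofReal_re, ofReal_im, I_re, I_im, mul_zero, sub_zero, mul_one,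
    add_zero, mul_im, zero_mul]
  exact mul_pos (Real.sin_pos_of_pos_of_lt_pi h0 h1) (Real.cosh_pos _)

theorem norm_sin_le (w : ℂ) : ‖sin w‖ ≤ Real.exp |w.im| := by
  rw [sin]
  have h1 : ‖exp (-w * I)‖ ≤ Real.exp |w.im| := by
    rw [norm_exp]; refine Real.exp_le_exp.2 ?_
    simpa using le_abs_self w.im
  have h2 : ‖exp (w * I)‖ ≤ Real.exp |w.im| := by
    rw [norm_exp]; refine Real.exp_le_exp.2 ?_
    simpa using neg_le_abs w.im
  rw [norm_div, norm_mul, norm_I, mul_one, Complex.norm_ofNat]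
  have := norm_sub_le (exp (-w * I)) (exp (w * I))
  linarith

theorem norm_sign_le (x : ℝ) : ‖(Real.sign x : ℂ)‖ ≤ 1 := by
  rcases Real.sign_apply_eq x with h | h | h <;> simp [h]

theorem norm_pairDist_le (z : ℝ → ℂ) (t t' : ℝ) :
    ‖pairDist z t t'‖ ≤ 2 * Real.exp ((|(z t).im| + |(z t').im|) / 2) := by
  rw [pairDist, norm_mul, norm_mul, Complex.norm_ofNat]
  have h := norm_sin_le ((z t' - z t) / 2)
  have h2 : |((z t' - z t) / 2).im| ≤ (|(z t).im| + |(z t').im|) / 2 := by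
    have : ((z t' - z t) / 2).im = ((z t').im - (z t).im) / 2 := by simp
    rw [this, abs_div, abs_two]
    have := abs_sub (z t').im (z t).im
    linarith
  calc _ ≤ 1 * (2 * ‖sin ((z t' - z t) / 2)‖) := by gcongr; exact norm_sign_le _
    _ ≤ _ := by rw [one_mul]; gcongr; exact h.trans (Real.exp_le_exp.2 h2)

theorem norm_interaction_le {p : ℝ} (hp : 0 < p) {z : ℝ → ℂ} {M : ℝ} {n : ℕ} {t : Fin n → ℝ}
    (hM : ∀ j, |(z (t j)).im| ≤ M) :
    ‖interaction p z t‖ ≤ ∏ j : Fin n, ∏ _k ∈ Finset.Ioi j, (2 * Real.exp M) ^ p := by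
  simp only [interaction, norm_prod]
  gcongr with j _ k _
  rw [norm_cpow_real]
  refine Real.rpow_le_rpow (norm_nonneg _) ((norm_pairDist_le z _ _).trans ?_) hp.le
  gcongr
  linarith [hM j, hM k]

theorem measurable_interaction (p : ℝ) {z : ℝ → ℂ} (hz : Measurable z) {n : ℕ} :
    Measurable (interaction p z (n := n)) := by
  have hs : Measurable Real.sign := by
    unfold Real.sign
    exact Measurable.ite measurableSet_Iio measurable_const
      (Measurable.ite measurableSet_Ioi measurable_const measurable_const)
  unfold interaction pairDist
  fun_prop

theorem pairDist_comm (z : ℝ → ℂ) (t t' : ℝ) : pairDist z t t' = pairDist z t' t := by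
  rw [pairDist, pairDist, ← neg_sub t' t, Real.sign_neg, ← neg_sub (z t') (z t), neg_div, sin_neg]
  push_cast; ring

theorem pairDist_of_lt (z : ℝ → ℂ) {t t' : ℝ} (h : t < t') :
    pairDist z t t' = 2 * sin ((z t' - z t) / 2) := by
  rw [pairDist, Real.sign_of_pos (sub_pos.2 h)]; simp

/-- Half the difference of two points on the path, in increasing order, has real part in (0, π),
where the sine has positive real part. No branch of the power is crossed during the deformation. -/
theorem pairDist_mem_slitPlane {z : ℝ → ℂ}
    (hz : ∀ t ∈ arc, z t ∈ strip) (hmono : ∀ t ∈ arc, ∀ t' ∈ arc, t < t' → (z t).re < (z t').re)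
    {t t' : ℝ} (ht : t ∈ arc) (ht' : t' ∈ arc) (hne : t ≠ t') :
    pairDist z t t' ∈ slitPlane := by
  wlog h : t < t' generalizing t t'
  · rw [pairDist_comm]
    exact this ht' ht hne.symm (lt_of_le_of_ne (not_lt.1 h) hne.symm)
  rw [pairDist_of_lt z h]
  refine Or.inl ?_
  have h1 := hmono t ht t' ht' h
  have h2 := (hz t ht).1
  have h3 := (hz t' ht').2
  have := re_sin_pos (w := (z t' - z t) / 2) (by simp; linarith) (by simp; linarith)
  simpa using this

/-- `σ` is the imaginary part, with derivative `σ'` bounded by `L`, of a contour in the strip from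
`0` to `2 π` that is parametrised by its real part. -/
structure IsHeight (σ σ' : ℝ → ℝ) (L : ℝ) : Prop where
  meas : Measurable σ
  meas' : Measurable σ'
  zero : σ 0 = 0
  two_pi : σ (2 * Real.pi) = 0
  cont : ContinuousOn σ (Set.Icc 0 (2 * Real.pi))
  deriv : ∀ t ∈ arc, HasDerivAt σ (σ' t) t
  bound : ∀ t ∈ arc, |σ' t| ≤ L

/-- The contour `t ↦ t + i s σ(t)`. -/
def heightPath (σ : ℝ → ℝ) (s : ℂ) (t : ℝ) : ℂ := t + I * s * σ t

theorem heightPath_re (σ : ℝ → ℝ) (s : ℂ) (t : ℝ) : (heightPath σ s t).re = t - s.im * σ t := by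
  simp [heightPath, sub_eq_add_neg]

theorem heightPath_im (σ : ℝ → ℝ) (s : ℂ) (t : ℝ) : (heightPath σ s t).im = s.re * σ t := by
  simp [heightPath]

theorem heightPath_zero_right (σ : ℝ → ℝ) (t : ℝ) : heightPath σ 0 t = t := by simp [heightPath]

namespace IsHeight

variable {σ σ' : ℝ → ℝ} {L : ℝ}

theorem nonneg (h : IsHeight σ σ' L) : 0 ≤ L :=
  (abs_nonneg _).trans (h.bound Real.pi ⟨Real.pi_pos, by linarith [Real.pi_pos]⟩)

theorem lipschitz (h : IsHeight σ σ' L) {t t' : ℝ} (ht : t ∈ Set.Icc 0 (2 * Real.pi))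
    (ht' : t' ∈ Set.Icc 0 (2 * Real.pi)) : |σ t' - σ t| ≤ L * |t' - t| := by
  wlog hlt : t < t' generalizing t t'
  · rcases (not_lt.1 hlt).eq_or_lt with rfl | hlt
    · simp
    · rw [abs_sub_comm, abs_sub_comm t' t]; exact this ht' ht hlt
  obtain ⟨c, hc, hs⟩ := exists_hasDerivAt_eq_slope σ σ' hlt
    (h.cont.mono (Set.Icc_subset_Icc ht.1 ht'.2))
    fun x hx => h.deriv x ⟨ht.1.trans_lt hx.1, hx.2.trans_le ht'.2⟩
  have hb := h.bound c ⟨ht.1.trans_lt hc.1, hc.2.trans_le ht'.2⟩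
  have h0 : 0 < t' - t := sub_pos.2 hlt
  rwa [hs, abs_div, div_le_iff₀ (abs_pos.2 h0.ne')] at hb

theorem abs_le (h : IsHeight σ σ' L) {t : ℝ} (ht : t ∈ Set.Icc 0 (2 * Real.pi)) :
    |σ t| ≤ L * t ∧ |σ t| ≤ L * (2 * Real.pi - t) := by
  have hp := Real.pi_pos
  have h1 := h.lipschitz (t := 0) ⟨le_rfl, by positivity⟩ ht
  have h2 := h.lipschitz (t' := 2 * Real.pi) ht ⟨by positivity, le_rfl⟩
  rw [h.zero, sub_zero, sub_zero, abs_of_nonneg ht.1] at h1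
  rw [h.two_pi, zero_sub, abs_neg, abs_of_nonneg (sub_nonneg.2 ht.2)] at h2
  exact ⟨h1, h2⟩

theorem heightPath_mem_strip (h : IsHeight σ σ' L) {s : ℂ} (hs : |s.im| * L < 1) {t : ℝ}
    (ht : t ∈ arc) : heightPath σ s t ∈ strip := by
  obtain ⟨h1, h2⟩ := h.abs_le (Set.Ioo_subset_Icc_self ht)
  have h3 : |s.im * σ t| ≤ |s.im| * L * t := by
    rw [abs_mul, mul_assoc]; exact mul_le_mul_of_nonneg_left h1 (abs_nonneg _)
  have h4 : |s.im * σ t| ≤ |s.im| * L * (2 * Real.pi - t) := by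
    rw [abs_mul, mul_assoc]; exact mul_le_mul_of_nonneg_left h2 (abs_nonneg _)
  have h5 : |s.im| * L * t < 1 * t := mul_lt_mul_of_pos_right hs ht.1
  have h6 : |s.im| * L * (2 * Real.pi - t) < 1 * (2 * Real.pi - t) :=
    mul_lt_mul_of_pos_right hs (sub_pos.2 ht.2)
  constructor
  · rw [heightPath_re]; linarith [le_abs_self (s.im * σ t)]
  · rw [heightPath_re]; linarith [neg_abs_le (s.im * σ t)]

/-- The shift Im(s) σ has Lipschitz constant |Im s| L < 1, so it cannot reverse the order of the
real parts; this fixes the range of admissible s. -/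
theorem heightPath_re_lt (h : IsHeight σ σ' L) {s : ℂ} (hs : |s.im| * L < 1) {t t' : ℝ}
    (ht : t ∈ Set.Icc 0 (2 * Real.pi)) (ht' : t' ∈ Set.Icc 0 (2 * Real.pi)) (hlt : t < t') :
    (heightPath σ s t).re < (heightPath σ s t').re := by
  have h0 : 0 < t' - t := sub_pos.2 hlt
  have h1 := h.lipschitz ht ht'
  rw [abs_of_pos h0] at h1
  have h3 : |s.im * (σ t' - σ t)| ≤ |s.im| * L * (t' - t) := by
    rw [abs_mul, mul_assoc]; exact mul_le_mul_of_nonneg_left h1 (abs_nonneg _)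
  have h5 : |s.im| * L * (t' - t) < 1 * (t' - t) := mul_lt_mul_of_pos_right hs h0
  rw [heightPath_re, heightPath_re]
  have := le_abs_self (s.im * (σ t' - σ t))
  linarith [mul_sub s.im (σ t') (σ t)]

theorem abs_heightPath_im_le (h : IsHeight σ σ' L) (s : ℂ) {t : ℝ} (ht : t ∈ arc) :
    |(heightPath σ s t).im| ≤ ‖s‖ * (L * (2 * Real.pi)) := by
  rw [heightPath_im, abs_mul]
  refine mul_le_mul (abs_re_le_norm s) ?_ (abs_nonneg _) (norm_nonneg _)
  exact (h.abs_le (Set.Ioo_subset_Icc_self ht)).1.trans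
    (mul_le_mul_of_nonneg_left ht.2.le h.nonneg)

theorem measurable_heightPath (h : IsHeight σ σ' L) (s : ℂ) : Measurable (heightPath σ s) := by
  have := h.meas
  unfold heightPath
  fun_prop

/-- A function on the strip that is bounded near the ends of the contours is bounded on them. -/
theorem exists_bound (h : IsHeight σ σ' L) {A : ℂ → ℂ} (hA : ContinuousOn A strip)
    (h0 : A =O[𝓝[strip] 0] fun _ => (1 : ℝ))
    (h1 : A =O[𝓝[strip] ((2 * Real.pi : ℝ) : ℂ)] fun _ => (1 : ℝ)) {s₀ : ℂ} (hs₀ : |s₀.im| * L < 1) :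
    ∃ C, ∀ᶠ s in 𝓝 s₀, ∀ t ∈ arc, ‖A (heightPath σ s t)‖ ≤ C := by
  have hU : ∀ᶠ s in 𝓝 s₀, |s.im| * L < 1 :=
    (isOpen_lt (by fun_prop) continuous_const : IsOpen {s : ℂ | |s.im| * L < 1}).mem_nhds hs₀
  -- At the two end points local boundedness is the hypothesis, at inner points it is continuity.
  -- Compactness of the closed parameter interval then gives one bound that holds for all s near s₀.
  have hLB : ∀ t ∈ Set.Icc 0 (2 * Real.pi),
      A =O[𝓝[strip] (heightPath σ s₀ t)] fun _ => (1 : ℝ) := by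
    intro t ht
    rcases ht.1.eq_or_lt with rfl | ht0
    · simpa [heightPath, h.zero] using h0
    rcases ht.2.eq_or_lt with rfl | ht1
    · simpa [heightPath, h.two_pi] using h1
    · have := hA _ (h.heightPath_mem_strip hs₀ ⟨ht0, ht1⟩)
      exact this.isBigO_one ℝ
  have key : ∃ C, ∀ᶠ s in 𝓝 s₀, ∀ t ∈ Set.Icc 0 (2 * Real.pi) ∩ arc,
      ‖A (heightPath σ s t)‖ ≤ C := by
    refine isCompact_Icc.induction_on
      (p := fun K => ∃ C, ∀ᶠ s in 𝓝 s₀, ∀ t ∈ K ∩ arc, ‖A (heightPath σ s t)‖ ≤ C)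
      ⟨0, by simp⟩ ?_ ?_ ?_
    · rintro K K' hK ⟨C, hC⟩
      exact ⟨C, hC.mono fun s hs t ht => hs t ⟨hK ht.1, ht.2⟩⟩
    · rintro K K' ⟨C, hC⟩ ⟨C', hC'⟩
      refine ⟨max C C', ?_⟩
      filter_upwards [hC, hC'] with s hs hs' t ht
      rcases ht.1 with h | h
      · exact (hs t ⟨h, ht.2⟩).trans (le_max_left _ _)
      · exact (hs' t ⟨h, ht.2⟩).trans (le_max_right _ _)
    · intro t₀ ht₀
      obtain ⟨C, hC⟩ := (hLB t₀ ht₀).bound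
      have hcont : Tendsto (fun q : ℂ × ℝ => heightPath σ q.1 q.2)
          (𝓝 s₀ ×ˢ 𝓝[Set.Icc 0 (2 * Real.pi)] t₀) (𝓝 (heightPath σ s₀ t₀)) := by
        have hσ : Tendsto σ (𝓝[Set.Icc 0 (2 * Real.pi)] t₀) (𝓝 (σ t₀)) := h.cont t₀ ht₀
        have hid : Tendsto (fun t : ℝ => t) (𝓝[Set.Icc 0 (2 * Real.pi)] t₀) (𝓝 t₀) :=
          tendsto_id.mono_left nhdsWithin_le_nhds
        exact ((continuous_ofReal.tendsto _).comp (hid.comp tendsto_snd)).add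
          ((tendsto_const_nhds.mul tendsto_fst).mul
            ((continuous_ofReal.tendsto _).comp (hσ.comp tendsto_snd)))
      have hev := hcont.eventually (eventually_nhdsWithin_iff.1 hC)
      obtain ⟨p, hp, q, hq, hpq⟩ := eventually_prod_iff.1 hev
      refine ⟨{t | q t}, hq, C, ?_⟩
      filter_upwards [hp, hU] with s hs hsU t ht
      have := hpq hs ht.1 (h.heightPath_mem_strip hsU ht.2)
      simpa using this
  obtain ⟨C, hC⟩ := key
  exact ⟨C, hC.mono fun s hs t ht => hs t ⟨Set.Ioo_subset_Icc_self ht, ht⟩⟩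

/-- For s = -iτ the path is the real function t + τ σ(t), an increasing bijection of (0, 2π). The
statement is the change of variables by it; the signs in `pairDist` are preserved by monotonicity.
-/
theorem contourIntegral_heightPath_of_imag (h : IsHeight σ σ' L) (n : ℕ) (p : ℝ) (A : ℂ → ℂ)
    {τ : ℝ} (hτ : |τ| * L < 1) :
    contourIntegral n p A (heightPath σ (-(τ * I))) (fun t => 1 + I * (-(τ * I)) * σ' t) =
      contourIntegral n p A (heightPath σ 0) (fun t => 1 + I * 0 * σ' t) := by
  set m : ℝ → ℝ := fun t => t + τ * σ t with hm
  have hre : ∀ t, heightPath σ (-(τ * I)) t = (m t : ℂ) := fun t => by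
    simp only [heightPath, hm]; push_cast; linear_combination (-(τ : ℂ) * σ t) * I_sq
  have hs : |(-(τ * I) : ℂ).im| * L < 1 := by simpa using hτ
  have hmono : StrictMonoOn m (Set.Icc 0 (2 * Real.pi)) := fun t ht t' ht' hlt => by
    have := h.heightPath_re_lt hs ht ht' hlt
    rwa [hre, hre, ofReal_re, ofReal_re] at this
  have hm0 : m 0 = 0 := by simp [hm, h.zero]
  have hm1 : m (2 * Real.pi) = 2 * Real.pi := by simp [hm, h.two_pi]
  have himg : m '' arc = arc := by
    have hc : ContinuousOn m (Set.Icc 0 (2 * Real.pi)) :=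
      continuousOn_id.add (continuousOn_const.mul h.cont)
    refine Set.Subset.antisymm ?_ ?_
    · rintro _ ⟨t, ht, rfl⟩
      have := h.heightPath_mem_strip hs ht
      rw [hre] at this
      simpa [strip] using this
    · have := intermediate_value_Ioo (f := m) (by positivity) hc
      rwa [hm0, hm1] at this
  have hpos : ∀ t ∈ arc, 0 < 1 + τ * σ' t := fun t ht => by
    have h1 : |τ * σ' t| ≤ |τ| * L := by
      rw [abs_mul]; exact mul_le_mul_of_nonneg_left (h.bound t ht) (abs_nonneg _)
    linarith [neg_abs_le (τ * σ' t)]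
  have hcv := setIntegral_pi_image (ι := Fin n) (s := fun _ => arc) (fun _ => measurableSet_Ioo)
    (φ := fun _ => m) (φ' := fun _ t => 1 + τ * σ' t)
    (fun _ t ht => ((hasDerivAt_id t).add ((h.deriv t ht).const_mul τ)).hasDerivWithinAt)
    (fun _ => (hmono.mono Set.Ioo_subset_Icc_self).injOn)
    (fun t => (∏ j, A (heightPath σ 0 (t j)) * (1 + I * 0 * σ' (t j))) *
      interaction p (heightPath σ 0) t)
  rw [himg] at hcv
  rw [contourIntegral, contourIntegral, hcv]
  refine setIntegral_congr_fun (MeasurableSet.univ_pi fun _ => measurableSet_Ioo) fun t ht => ?_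
  have ht : ∀ j, t j ∈ arc := fun j => ht j trivial
  have hi : interaction p (heightPath σ (-(τ * I))) t =
      interaction p (heightPath σ 0) fun j => m (t j) := by
    refine Finset.prod_congr rfl fun j _ => Finset.prod_congr rfl fun k _ => ?_
    congr 1
    simp only [pairDist, hre, heightPath_zero_right]
    congr 2
    rcases lt_trichotomy (t j) (t k) with hlt | heq | hlt
    · rw [Real.sign_of_pos (sub_pos.2 hlt), Real.sign_of_pos (sub_pos.2 (hmono
        (Set.Ioo_subset_Icc_self (ht j)) (Set.Ioo_subset_Icc_self (ht k)) hlt))]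
    · simp [heq]
    · rw [Real.sign_of_neg (sub_neg.2 hlt), Real.sign_of_neg (sub_neg.2 (hmono
        (Set.Ioo_subset_Icc_self (ht k)) (Set.Ioo_subset_Icc_self (ht j)) hlt))]
  simp only [hi]
  rw [real_smul, ofReal_prod, ← mul_assoc, ← Finset.prod_mul_distrib]
  congr 1
  refine Finset.prod_congr rfl fun j _ => ?_
  rw [hre, heightPath_zero_right, abs_of_pos (hpos _ (ht j))]
  push_cast
  linear_combination (-(τ : ℂ) * σ' (t j) * A (m (t j))) * I_sq

/-- Deformation of the contours. -/
theorem contourIntegral_eq (h : IsHeight σ σ' L) (n : ℕ) {p : ℝ} (hp : 0 < p) {A : ℂ → ℂ}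
    (hAm : Measurable A) (hA : DifferentiableOn ℂ A strip)
    (h0 : A =O[𝓝[strip] 0] fun _ => (1 : ℝ))
    (h1 : A =O[𝓝[strip] ((2 * Real.pi : ℝ) : ℂ)] fun _ => (1 : ℝ)) :
    contourIntegral n p A (fun t => t) (fun _ => 1) =
      contourIntegral n p A (heightPath σ 1) (fun t => 1 + I * σ' t) := by
  -- A convex, hence connected, strip around the real axis, which contains s = 1 and a segment of
  -- the imaginary axis.
  set U : Set ℂ := {s | |s.im| * L < 1} with hU
  have hUo : IsOpen U := isOpen_lt (by fun_prop) continuous_const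
  have hd : DifferentiableOn ℂ (fun s => contourIntegral n p A (heightPath σ s)
      (fun t => 1 + I * s * σ' t)) U := by
    unfold contourIntegral
    refine differentiableOn_integral hUo (fun s hs => ?_) ?_ fun s₀ hs₀ => ?_
    · have hm := h.measurable_heightPath s
      have hi := measurable_interaction p hm (n := n)
      have := h.meas'
      exact Measurable.aestronglyMeasurable (by fun_prop)
    -- For coinciding coordinates a pair factor vanishes and leaves the slit plane, so holomorphy in
    -- s is claimed only off this null set.
    · filter_upwards [ae_restrict_of_ae ae_injective,
        ae_restrict_mem (MeasurableSet.univ_pi fun _ => measurableSet_Ioo)] with t htinj ht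
      have ht : ∀ j, t j ∈ arc := fun j => ht j trivial
      have hhp : ∀ j, DifferentiableOn ℂ (fun s => heightPath σ s (t j)) U := fun j => by
        unfold heightPath; fun_prop
      refine DifferentiableOn.mul (DifferentiableOn.fun_finsetProd fun j _ => ?_)
        (DifferentiableOn.fun_finsetProd fun j _ => DifferentiableOn.fun_finsetProd fun k hk => ?_)
      · refine DifferentiableOn.mul (hA.comp (hhp j) fun s hs =>
          h.heightPath_mem_strip hs (ht j)) (by fun_prop)
      · refine DifferentiableOn.cpow_const ?_ fun s hs => ?_
        · have := hhp j
          have := hhp k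
          unfold pairDist
          fun_prop
        · exact pairDist_mem_slitPlane (fun t ht => h.heightPath_mem_strip hs ht)
            (fun t ht t' ht' => h.heightPath_re_lt hs (Set.Ioo_subset_Icc_self ht)
              (Set.Ioo_subset_Icc_self ht')) (ht j) (ht k)
            fun he => (Finset.mem_Ioi.1 hk).ne (htinj he)
    · obtain ⟨C, hC⟩ := h.exists_bound hA.continuousOn h0 h1 hs₀
      obtain ⟨r, hr, hball⟩ := Metric.eventually_nhds_iff_ball.1 hC
      refine ⟨fun _ => (∏ _j : Fin n, C * (1 + (‖s₀‖ + 1) * L)) *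
        ∏ j : Fin n, ∏ _k ∈ Finset.Ioi j, (2 * Real.exp ((‖s₀‖ + 1) * (L * (2 * Real.pi)))) ^ p,
        ?_, min r 1, lt_min hr one_pos, ?_⟩
      · refine integrableOn_const ?_
        rw [volume_pi, Measure.pi_pi]
        simp [ENNReal.mul_eq_top]
      · filter_upwards [ae_restrict_mem (MeasurableSet.univ_pi fun _ => measurableSet_Ioo)]
          with t ht s hs
        have ht : ∀ j, t j ∈ arc := fun j => ht j trivial
        have hL := h.nonneg
        have hsn : ‖s‖ ≤ ‖s₀‖ + 1 := by
          have h1 : dist s s₀ < 1 := (Metric.mem_ball.1 hs).trans_le (min_le_right _ _)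
          rw [dist_eq_norm] at h1
          have := norm_sub_norm_le s s₀
          linarith
        rw [norm_mul, norm_prod]
        refine mul_le_mul ?_ (norm_interaction_le hp fun j =>
          (h.abs_heightPath_im_le s (ht j)).trans (by gcongr)) (norm_nonneg _) ?_
        · refine Finset.prod_le_prod (fun _ _ => norm_nonneg _) fun j _ => ?_
          rw [norm_mul]
          have hAC := hball s (Metric.ball_subset_ball (min_le_left _ _) hs) (t j) (ht j)
          refine mul_le_mul hAC ?_ (norm_nonneg _) ((norm_nonneg _).trans hAC)
          refine (norm_add_le _ _).trans ?_
          rw [norm_one, norm_mul, norm_mul, norm_I, one_mul, norm_real, Real.norm_eq_abs]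
          gcongr
          exact h.bound _ (ht j)
        · refine Finset.prod_nonneg fun j _ => ?_
          have hAC := hball s (Metric.ball_subset_ball (min_le_left _ _) hs) (t j) (ht j)
          exact mul_nonneg ((norm_nonneg _).trans hAC) (by positivity)
  have hpre : IsPreconnected U := by
    refine Convex.isPreconnected fun a ha b hb x y hx hy hxy => ?_
    simp only [hU, Set.mem_ofPred_eq] at ha hb ⊢
    have h1 : |(x • a + y • b).im| ≤ x * |a.im| + y * |b.im| := by
      have : (x • a + y • b).im = x * a.im + y * b.im := by simp
      rw [this]
      refine (abs_add_le _ _).trans ?_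
      rw [abs_mul, abs_mul, abs_of_nonneg hx, abs_of_nonneg hy]
    have hL := h.nonneg
    calc |(x • a + y • b).im| * L ≤ (x * |a.im| + y * |b.im|) * L := by gcongr
      _ = x * (|a.im| * L) + y * (|b.im| * L) := by ring
      _ ≤ x * max (|a.im| * L) (|b.im| * L) + y * max (|a.im| * L) (|b.im| * L) := by
        gcongr
        · exact le_max_left _ _
        · exact le_max_right _ _
      _ = max (|a.im| * L) (|b.im| * L) := by rw [← add_mul, hxy, one_mul]
      _ < 1 := max_lt ha hb
  have h0U : (0 : ℂ) ∈ U := by simp [hU]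
  have h1U : (1 : ℂ) ∈ U := by simp [hU]
  -- On the imaginary axis the integral equals its value at s = 0, and these points accumulate at 0,
  -- as the identity theorem requires.
  have hfreq : ∃ᶠ s in 𝓝[≠] (0 : ℂ), contourIntegral n p A (heightPath σ s)
      (fun t => 1 + I * s * σ' t) = contourIntegral n p A (heightPath σ 0)
      (fun t => 1 + I * 0 * σ' t) := by
    have htend : Tendsto (fun τ : ℝ => -((τ : ℂ) * I)) (𝓝[≠] 0) (𝓝[≠] 0) := by
      refine tendsto_nhdsWithin_iff.2 ⟨?_, ?_⟩
      · have : Tendsto (fun τ : ℝ => -((τ : ℂ) * I)) (𝓝 0) (𝓝 (-(((0 : ℝ) : ℂ) * I))) :=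
          Continuous.tendsto (by fun_prop) 0
        simp only [ofReal_zero, zero_mul, neg_zero] at this
        exact this.mono_left nhdsWithin_le_nhds
      · filter_upwards [self_mem_nhdsWithin] with τ hτ
        simpa using hτ
    refine htend.frequently (Eventually.frequently ?_)
    have : ∀ᶠ τ : ℝ in 𝓝 0, |τ| * L < 1 :=
      (isOpen_lt (by fun_prop) continuous_const : IsOpen {τ : ℝ | |τ| * L < 1}).mem_nhds (by simp)
    filter_upwards [nhdsWithin_le_nhds this] with τ hτ
    exact h.contourIntegral_heightPath_of_imag n p A hτ
  have := (hd.analyticOnNhd hUo).eqOn_of_preconnected_of_frequently_eq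
    (g := fun _ => contourIntegral n p A (heightPath σ 0) (fun t => 1 + I * 0 * σ' t))
    analyticOnNhd_const hpre h0U hfreq h1U
  simp only [mul_one] at this
  rw [this]
  congr 1
  · funext t; simp [heightPath]
  · simp

end IsHeight

/-! ### Laplace's method with a homogeneous weight. -/

section Laplace

variable {n : ℕ}

theorem norm_sq_le_sum_sq (x : Fin n → ℝ) : ‖x‖ ^ 2 ≤ ∑ i, x i ^ 2 := by
  have h0 : 0 ≤ ∑ i, x i ^ 2 := Finset.sum_nonneg fun i _ => sq_nonneg _
  have : ‖x‖ ≤ √(∑ i, x i ^ 2) := by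
    refine (pi_norm_le_iff_of_nonneg (Real.sqrt_nonneg _)).2 fun i => ?_
    rw [Real.norm_eq_abs]
    exact Real.abs_le_sqrt (Finset.single_le_sum (f := fun i => x i ^ 2)
      (fun j _ => sq_nonneg _) (Finset.mem_univ i))
  calc ‖x‖ ^ 2 ≤ √(∑ i, x i ^ 2) ^ 2 := by gcongr
    _ = _ := Real.sq_sqrt h0

theorem integrable_exp_neg_mul_sum_sq {a : ℝ} (ha : 0 < a) :
    Integrable fun x : Fin n → ℝ => Real.exp (-a * ∑ i, x i ^ 2) := by
  have := Integrable.fintype_prod (ι := Fin n) (μ := fun _ => volume)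
    fun _ => integrable_exp_neg_mul_sq ha
  refine this.congr (Eventually.of_forall fun x => ?_)
  simp only
  rw [← Real.exp_sum, Finset.mul_sum]

/-- Half of the Gaussian absorbs the polynomial growth; the other half is integrable. -/
theorem integrable_exp_mul_of_le {a e C : ℝ} (ha : 0 < a) (he : 0 ≤ e) {U : (Fin n → ℝ) → ℝ}
    (hm : Measurable U) (hU : ∀ x, |U x| ≤ C * ‖x‖ ^ e) :
    Integrable fun x : Fin n → ℝ => Real.exp (-a * ∑ i, x i ^ 2) * U x := by
  obtain ⟨B, hB⟩ : ∃ B, ∀ y : ℝ, 0 ≤ y → y ^ e * Real.exp (-(a / 2) * y ^ 2) ≤ B := by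
    obtain ⟨m, hm⟩ := exists_nat_ge e
    refine ⟨1 + m.factorial / (a / 2) ^ m, fun y hy => ?_⟩
    have h1 : y ^ e ≤ 1 + (y ^ 2) ^ m := by
      rcases le_total y 1 with h | h
      · have := Real.rpow_le_one hy h he
        have : 0 ≤ (y ^ 2) ^ m := by positivity
        linarith
      · have h2 := Real.rpow_le_rpow_of_exponent_le h hm
        rw [Real.rpow_natCast] at h2
        have h3 : y ^ m ≤ (y ^ 2) ^ m := pow_le_pow_left₀ hy (by nlinarith) m
        linarith
    have h2 := Real.pow_div_factorial_le_exp (x := a / 2 * y ^ 2) (by positivity) m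
    rw [mul_pow, div_le_iff₀ (by positivity)] at h2
    have h3 : Real.exp (-(a / 2) * y ^ 2) ≤ 1 := Real.exp_le_one_iff.2 (by nlinarith [sq_nonneg y])
    calc _ ≤ (1 + (y ^ 2) ^ m) * Real.exp (-(a / 2) * y ^ 2) := by gcongr
      _ = Real.exp (-(a / 2) * y ^ 2) +
          ((a / 2) ^ m * (y ^ 2) ^ m) * Real.exp (-(a / 2) * y ^ 2) / (a / 2) ^ m := by
        field_simp
      _ ≤ 1 + (Real.exp (a / 2 * y ^ 2) * m.factorial) * Real.exp (-(a / 2) * y ^ 2) /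
          (a / 2) ^ m := by gcongr
      _ = _ := by
        rw [mul_right_comm, ← Real.exp_add]
        simp
  refine ((integrable_exp_neg_mul_sum_sq (n := n) (half_pos ha)).const_mul (|C| * B)).mono'
    (Measurable.aestronglyMeasurable (by fun_prop)) (Eventually.of_forall fun x => ?_)
  rw [norm_mul, Real.norm_eq_abs, Real.norm_eq_abs, Real.abs_exp]
  have h1 := hB ‖x‖ (norm_nonneg _)
  have h2 : Real.exp (-(a / 2) * ∑ i, x i ^ 2) ≤ Real.exp (-(a / 2) * ‖x‖ ^ 2) :=
    Real.exp_le_exp.2 (by nlinarith [norm_sq_le_sum_sq x])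
  have h3 : Real.exp (-a * ∑ i, x i ^ 2) =
      Real.exp (-(a / 2) * ∑ i, x i ^ 2) * Real.exp (-(a / 2) * ∑ i, x i ^ 2) := by
    rw [← Real.exp_add]; ring_nf
  calc _ ≤ Real.exp (-(a / 2) * ∑ i, x i ^ 2) * Real.exp (-(a / 2) * ‖x‖ ^ 2) *
        (|C| * ‖x‖ ^ e) := by
        rw [h3]
        gcongr
        exact (hU x).trans (by gcongr; exact le_abs_self C)
    _ = |C| * (‖x‖ ^ e * Real.exp (-(a / 2) * ‖x‖ ^ 2)) * Real.exp (-(a / 2) * ∑ i, x i ^ 2) := by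
        ring
    _ ≤ _ := by gcongr

theorem integral_exp_mul_homogeneous {e : ℝ} {U : (Fin n → ℝ) → ℝ}
    (hU : ∀ c : ℝ, 0 < c → ∀ x, U (c • x) = c ^ e * U x) (a : ℝ) {N : ℝ} (hN : 0 < N) :
    ∫ x : Fin n → ℝ, Real.exp (-(a * N) * ∑ i, x i ^ 2) * U x =
      N ^ (-((n + e) / 2)) * ∫ x : Fin n → ℝ, Real.exp (-a * ∑ i, x i ^ 2) * U x := by
  have hs : 0 < √N := Real.sqrt_pos.2 hN
  have h := Measure.integral_comp_smul volume
    (fun x : Fin n → ℝ => Real.exp (-a * ∑ i, x i ^ 2) * U x) (√N)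
  have h2 : ∀ x : Fin n → ℝ, Real.exp (-a * ∑ i, (√N • x) i ^ 2) * U (√N • x) =
      √N ^ e * (Real.exp (-(a * N) * ∑ i, x i ^ 2) * U x) := fun x => by
    rw [hU _ hs, ← mul_assoc, mul_comm (Real.exp _), mul_assoc]
    congr 3
    simp only [Pi.smul_apply, smul_eq_mul, mul_pow, Real.sq_sqrt hN.le]
    rw [← Finset.mul_sum]; ring
  simp_rw [h2] at h
  rw [integral_const_mul, Module.finrank_fin_fun, abs_of_pos (by positivity), smul_eq_mul] at h
  have h3 : N ^ (-((n + e) / 2)) = (√N ^ n)⁻¹ / √N ^ e := by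
    rw [← Real.rpow_natCast, Real.sqrt_eq_rpow, ← Real.rpow_mul hN.le, ← Real.rpow_mul hN.le,
      ← Real.rpow_neg hN.le, ← Real.rpow_sub hN]
    congr 1; ring
  rw [h3, div_mul_eq_mul_div, ← h]
  field_simp

theorem norm_exp_sub_one_le_mul_exp (z : ℂ) : ‖exp z - 1‖ ≤ ‖z‖ * Real.exp ‖z‖ := by
  simpa using norm_exp_sub_sum_le_norm_mul_exp z 1

theorem norm_exp_sub_one_sub_id_le_mul_exp (z : ℂ) :
    ‖exp z - 1 - z‖ ≤ ‖z‖ ^ 2 * Real.exp ‖z‖ := by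
  have := norm_exp_sub_sum_le_norm_mul_exp z 2
  rwa [Finset.sum_range_succ, Finset.sum_range_one, pow_zero, pow_one, Nat.factorial_zero,
    Nat.factorial_one, Nat.cast_one, div_one, div_one, ← sub_sub] at this

/-- The even part of `e^{N h} q` near a zero of third order of `h`. -/
theorem norm_even_part_sub_le {N X C : ℝ} (hN : 0 ≤ N) (hX : 0 ≤ X) (hC : 0 ≤ C)
    {h h' q q' q₀ : ℂ} (h3 : ‖h‖ ≤ C * X ^ 3) (h3' : ‖h'‖ ≤ C * X ^ 3)
    (h2 : ‖h‖ ≤ X ^ 2 / 2) (h2' : ‖h'‖ ≤ X ^ 2 / 2) (h4 : ‖h + h'‖ ≤ C * X ^ 4)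
    (hq : ‖q - q₀‖ ≤ C * X) (hq' : ‖q' - q₀‖ ≤ C * X) (hqq : ‖q + q' - 2 * q₀‖ ≤ C * X ^ 2) :
    ‖(exp (N * h) * q + exp (N * h') * q') / 2 - q₀‖ ≤
      (C * X ^ 2 + (C ^ 2 + ‖q₀‖ * C) * (N * X ^ 4) + ‖q₀‖ * C ^ 2 * (N ^ 2 * X ^ 6)) *
        Real.exp (N * X ^ 2 / 2) := by
  set E := Real.exp (N * X ^ 2 / 2) with hE
  have hE1 : 1 ≤ E := Real.one_le_exp (by positivity)
  have hn : ∀ w : ℂ, ‖(N : ℂ) * w‖ = N * ‖w‖ := fun w => by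
    rw [norm_mul, norm_real, Real.norm_of_nonneg hN]
  have hexp : ∀ w : ℂ, ‖w‖ ≤ X ^ 2 / 2 → Real.exp ‖(N : ℂ) * w‖ ≤ E := fun w hw => by
    rw [hn]
    exact Real.exp_le_exp.2 (by nlinarith)
  have e1 : ∀ w : ℂ, ‖w‖ ≤ C * X ^ 3 → ‖w‖ ≤ X ^ 2 / 2 →
      ‖exp (N * w) - 1‖ ≤ N * (C * X ^ 3) * E := fun w hw hw2 => by
    refine (norm_exp_sub_one_le_mul_exp _).trans ?_
    have := hexp w hw2
    rw [hn] at *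
    gcongr
  have e2 : ∀ w : ℂ, ‖w‖ ≤ C * X ^ 3 → ‖w‖ ≤ X ^ 2 / 2 →
      ‖exp (N * w) - 1 - N * w‖ ≤ (N * (C * X ^ 3)) ^ 2 * E := fun w hw hw2 => by
    refine (norm_exp_sub_one_sub_id_le_mul_exp _).trans ?_
    have := hexp w hw2
    rw [hn] at *
    gcongr
  -- Three kinds of terms remain: products of two first order variations, the even part of q, and q₀
  -- times the even part of e^{Nh}. In the last one the linear term is N(h + h'), which is of fourth
  -- order by evenness.
  have key : (exp (N * h) * q + exp (N * h') * q') / 2 - q₀ =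
      ((exp (N * h) - 1) * (q - q₀) + (exp (N * h') - 1) * (q' - q₀)) / 2 +
      (q + q' - 2 * q₀) / 2 + q₀ * ((exp (N * h) - 1 - N * h) + (exp (N * h') - 1 - N * h') +
        N * (h + h')) / 2 := by ring
  rw [key]
  have b1 : ‖((exp (N * h) - 1) * (q - q₀) + (exp (N * h') - 1) * (q' - q₀)) / 2‖ ≤
      C ^ 2 * (N * X ^ 4) * E := by
    rw [norm_div, Complex.norm_ofNat]
    have a1 := norm_add_le ((exp (N * h) - 1) * (q - q₀)) ((exp (N * h') - 1) * (q' - q₀))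
    rw [norm_mul, norm_mul] at a1
    have a2 : ‖exp (N * h) - 1‖ * ‖q - q₀‖ ≤ N * (C * X ^ 3) * E * (C * X) := by
      gcongr; exact e1 h h3 h2
    have a3 : ‖exp (N * h') - 1‖ * ‖q' - q₀‖ ≤ N * (C * X ^ 3) * E * (C * X) := by
      gcongr; exact e1 h' h3' h2'
    linarith
  have b2 : ‖(q + q' - 2 * q₀) / 2‖ ≤ C * X ^ 2 * E := by
    rw [norm_div, Complex.norm_ofNat]
    have : C * X ^ 2 * 1 ≤ C * X ^ 2 * E := by gcongr
    have : 0 ≤ C * X ^ 2 := by positivity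
    linarith
  have b3 : ‖q₀ * ((exp (N * h) - 1 - N * h) + (exp (N * h') - 1 - N * h') +
        N * (h + h')) / 2‖ ≤ (‖q₀‖ * C * (N * X ^ 4) + ‖q₀‖ * C ^ 2 * (N ^ 2 * X ^ 6)) * E := by
    rw [norm_div, Complex.norm_ofNat, norm_mul]
    have a1 := norm_add₃_le (a := exp (N * h) - 1 - N * h) (b := exp (N * h') - 1 - N * h')
      (c := N * (h + h'))
    rw [hn] at a1
    have a2 := e2 h h3 h2
    have a3 := e2 h' h3' h2'
    have a4 : N * ‖h + h'‖ ≤ N * (C * X ^ 4) * E := by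
      calc N * ‖h + h'‖ ≤ N * (C * X ^ 4) * 1 := by rw [mul_one]; gcongr
        _ ≤ _ := by gcongr
    have a5 : ‖(exp (N * h) - 1 - N * h) + (exp (N * h') - 1 - N * h') + N * (h + h')‖ ≤
        2 * ((N * (C * X ^ 3)) ^ 2 * E) + N * (C * X ^ 4) * E := by linarith
    have a6 : 0 ≤ N * (C * X ^ 4) * E := by positivity
    calc _ ≤ ‖q₀‖ * (2 * ((N * (C * X ^ 3)) ^ 2 * E) + 2 * (N * (C * X ^ 4) * E)) / 2 := by
          gcongr; linarith
      _ = _ := by ring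
  calc _ ≤ _ := norm_add₃_le
    _ ≤ _ := add_le_add_three b1 b2 b3
    _ = _ := by ring

/-- Laplace's method at a nondegenerate saddle point, with an error of relative order `1 / N`. -/
theorem exists_laplace_bound {d : ℝ} (hd : 0 ≤ d) {V : (Fin n → ℝ) → ℝ} (hVm : Measurable V)
    (hV0 : ∀ x, 0 ≤ V x) (hVneg : ∀ x, V (-x) = V x)
    (hVh : ∀ c : ℝ, 0 < c → ∀ x, V (c • x) = c ^ d * V x)
    {B : ℝ} (hVB : ∀ x, V x ≤ B * ‖x‖ ^ d)
    {S : Set (Fin n → ℝ)} (hS : MeasurableSet S) (hSneg : ∀ x ∈ S, -x ∈ S)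
    {r : ℝ} (hr : 0 < r) (hSr : Metric.ball 0 r ⊆ S)
    {h q : (Fin n → ℝ) → ℂ} (hh : ContinuousOn h S) (hq : ContinuousOn q S) {q₀ : ℂ} {C : ℝ}
    (hC : 0 ≤ C)
    (h3 : ∀ x ∈ S, ‖h x‖ ≤ C * ‖x‖ ^ 3) (h2 : ∀ x ∈ S, ‖h x‖ ≤ ‖x‖ ^ 2 / 2)
    (h4 : ∀ x ∈ S, ‖h x + h (-x)‖ ≤ C * ‖x‖ ^ 4)
    (hq1 : ∀ x ∈ S, ‖q x - q₀‖ ≤ C * ‖x‖) (hq2 : ∀ x ∈ S, ‖q x + q (-x) - 2 * q₀‖ ≤ C * ‖x‖ ^ 2) :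
    ∃ K, ∀ N : ℕ, 0 < N →
      ‖(∫ x in S, ((Real.exp (-N * ∑ i, x i ^ 2) * V x : ℝ) : ℂ) * (exp (N * h x) * q x)) -
        q₀ * ((N : ℝ) ^ (-((n + d) / 2)) * ∫ x, Real.exp (-∑ i, x i ^ 2) * V x : ℝ)‖ ≤
      K * (N : ℝ) ^ (-((n + d) / 2)) / N := by
  -- The weight times ‖x‖^k. Its Gaussian integral scales with an extra factor N^{-k/2}, so ‖x‖²,
  -- N‖x‖⁴ and N²‖x‖⁶ all contribute at relative order 1/N.
  set U : ℕ → (Fin n → ℝ) → ℝ := fun k x => V x * ‖x‖ ^ k with hU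
  have hUm : ∀ k, Measurable (U k) := fun k => by simp only [hU]; fun_prop
  have hUh : ∀ (k : ℕ) (c : ℝ), 0 < c → ∀ x, U k (c • x) = c ^ (d + k) * U k x := by
    intro k c hc x
    simp only [hU]
    rw [hVh c hc, norm_smul, Real.norm_of_nonneg hc.le, Real.rpow_add hc, Real.rpow_natCast]
    ring
  have hUB : ∀ k x, |U k x| ≤ B * ‖x‖ ^ (d + k) := by
    intro k x
    have : ‖x‖ ^ (d + k) = ‖x‖ ^ d * ‖x‖ ^ k := by
      rw [Real.rpow_add_of_nonneg (norm_nonneg _) hd (Nat.cast_nonneg k), Real.rpow_natCast]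
    rw [abs_of_nonneg (mul_nonneg (hV0 x) (by positivity)), this, ← mul_assoc]
    exact mul_le_mul_of_nonneg_right (hVB x) (by positivity)
  have hUi : ∀ (k : ℕ) {a : ℝ}, 0 < a →
      Integrable fun x : Fin n → ℝ => Real.exp (-a * ∑ i, x i ^ 2) * U k x := fun k a ha =>
    integrable_exp_mul_of_le ha (by positivity) (hUm k) (hUB k)
  set M : ℕ → ℝ := fun k => ∫ x : Fin n → ℝ, Real.exp (-(1 / 2) * ∑ i, x i ^ 2) * U k x with hM
  -- The summand ‖q₀‖/r² pays for the leading term outside S, where ‖x‖ ≥ r and therefore 1 ≤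
  -- ‖x‖²/r².
  set k1 := C + ‖q₀‖ / r ^ 2 with hk1
  set k2 := C ^ 2 + ‖q₀‖ * C with hk2
  set k3 := ‖q₀‖ * C ^ 2 with hk3
  refine ⟨k1 * M 2 + k2 * M 4 + k3 * M 6, fun N hN0 => ?_⟩
  have hN : (0 : ℝ) < N := by exact_mod_cast hN0
  set w : (Fin n → ℝ) → ℝ := fun x => Real.exp (-N * ∑ i, x i ^ 2) * V x with hw
  have hwm : Measurable w := by simp only [hw]; fun_prop
  have hw0 : ∀ x, 0 ≤ w x := fun x => mul_nonneg (Real.exp_nonneg _) (hV0 x)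
  have hwneg : ∀ x, w (-x) = w x := fun x => by simp [hw, hVneg]
  set Q : (Fin n → ℝ) → ℂ := fun x => exp (N * h x) * q x with hQ
  have hwi : Integrable w := by
    have := hUi 0 hN
    simpa [hU, hw] using this
  have hwint : ∫ x, w x = (N : ℝ) ^ (-((n + d) / 2)) * ∫ x, Real.exp (-∑ i, x i ^ 2) * V x := by
    have := integral_exp_mul_homogeneous hVh 1 hN
    simpa [hw] using this
  have hQb : ∀ x ∈ S, ‖Q x‖ ≤ Real.exp (N / 2 * ‖x‖ ^ 2) * (‖q₀‖ + C * ‖x‖) := by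
    intro x hx
    rw [norm_mul]
    gcongr
    · rw [norm_exp]
      refine Real.exp_le_exp.2 ((re_le_norm _).trans ?_)
      rw [norm_mul, norm_natCast]
      have := h2 x hx
      nlinarith
    · have := norm_sub_norm_le (q x) q₀
      linarith [hq1 x hx]
  have hsplit : ∀ x : Fin n → ℝ, Real.exp (-N * ∑ i, x i ^ 2) * Real.exp (N / 2 * ‖x‖ ^ 2) ≤
      Real.exp (-(N / 2) * ∑ i, x i ^ 2) := fun x => by
    rw [← Real.exp_add]
    refine Real.exp_le_exp.2 ?_
    nlinarith [norm_sq_le_sum_sq x]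
  have hQi : IntegrableOn (fun x => (w x : ℂ) * Q x) S := by
    have hi : Integrable fun x : Fin n → ℝ =>
        ‖q₀‖ * (Real.exp (-(N / 2) * ∑ i, x i ^ 2) * U 0 x) +
          C * (Real.exp (-(N / 2) * ∑ i, x i ^ 2) * U 1 x) :=
      ((hUi 0 (by positivity)).const_mul _).add ((hUi 1 (by positivity)).const_mul _)
    refine hi.integrableOn.mono' ?_ ((ae_restrict_iff' hS).2 (Eventually.of_forall fun x hx => ?_))
    · refine (measurable_ofReal.comp hwm).aestronglyMeasurable.mul ?_
      exact ContinuousOn.aestronglyMeasurable (by fun_prop) hS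
    · rw [norm_mul, norm_real, Real.norm_of_nonneg (hw0 x)]
      calc w x * ‖Q x‖ ≤ w x * (Real.exp (N / 2 * ‖x‖ ^ 2) * (‖q₀‖ + C * ‖x‖)) :=
            mul_le_mul_of_nonneg_left (hQb x hx) (hw0 x)
        _ = (Real.exp (-N * ∑ i, x i ^ 2) * Real.exp (N / 2 * ‖x‖ ^ 2)) *
            (V x * (‖q₀‖ + C * ‖x‖)) := by simp only [hw]; ring
        _ ≤ Real.exp (-(N / 2) * ∑ i, x i ^ 2) * (V x * (‖q₀‖ + C * ‖x‖)) :=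
            mul_le_mul_of_nonneg_right (hsplit x) (mul_nonneg (hV0 x) (by positivity))
        _ = _ := by simp only [hU]; ring
  have hpre : Neg.neg ⁻¹' S = S := by
    ext x
    exact ⟨fun hx => by simpa using hSneg _ hx, fun hx => hSneg x hx⟩
  have hmp : MeasurePreserving (Neg.neg : (Fin n → ℝ) → (Fin n → ℝ)) :=
    Measure.measurePreserving_neg volume
  have hemb : MeasurableEmbedding (Neg.neg : (Fin n → ℝ) → (Fin n → ℝ)) :=
    (MeasurableEquiv.neg _).measurableEmbedding
  -- Weight and domain are even, so Q may be replaced by its even part.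
  have hrefl : ∫ x in S, (w x : ℂ) * Q (-x) = ∫ x in S, (w x : ℂ) * Q x := by
    have := hmp.setIntegral_preimage_emb hemb (fun x => (w x : ℂ) * Q x) S
    rw [hpre] at this
    simpa only [hwneg] using this
  have hQi' : IntegrableOn (fun x => (w x : ℂ) * Q (-x)) S := by
    have := (hmp.integrableOn_comp_preimage hemb (f := fun x => (w x : ℂ) * Q x) (s := S)).2 hQi
    rw [hpre] at this
    simpa only [Function.comp_def, hwneg] using this
  have hwc : Integrable fun x => (w x : ℂ) := hwi.ofReal
  have hmain : (∫ x in S, (w x : ℂ) * Q x) - q₀ * ((∫ x, w x : ℝ) : ℂ) =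
      ∫ x, (S.indicator (fun x => (w x : ℂ) * ((Q x + Q (-x)) / 2 - q₀)) x -
        Sᶜ.indicator (fun x => (w x : ℂ) * q₀) x) := by
    have i1 : IntegrableOn (fun x => (w x : ℂ) * ((Q x + Q (-x)) / 2 - q₀)) S := by
      have := ((hQi.add hQi').div_const 2).sub ((hwc.mul_const q₀).integrableOn (s := S))
      refine this.congr (Eventually.of_forall fun x => ?_)
      simp only [Pi.add_apply, Pi.sub_apply]
      ring
    rw [integral_sub (i1.integrable_indicator hS)
      ((hwc.mul_const q₀).integrableOn.integrable_indicator hS.compl),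
      integral_indicator hS, integral_indicator hS.compl]
    have e1 : ∫ x in S, (w x : ℂ) * ((Q x + Q (-x)) / 2 - q₀) =
        (∫ x in S, (w x : ℂ) * Q x) - ∫ x in S, (w x : ℂ) * q₀ := by
      have : ∀ x, (w x : ℂ) * ((Q x + Q (-x)) / 2 - q₀) =
          ((w x : ℂ) * Q x / 2 + (w x : ℂ) * Q (-x) / 2) - (w x : ℂ) * q₀ := fun x => by ring
      simp_rw [this]
      have iA : IntegrableOn (fun x => (w x : ℂ) * Q x / 2 + (w x : ℂ) * Q (-x) / 2) S :=
        (hQi.div_const 2).add (hQi'.div_const 2)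
      rw [integral_sub iA (hwc.mul_const q₀).integrableOn,
        integral_add (hQi.div_const 2) (hQi'.div_const 2), integral_div, integral_div, hrefl]
      ring
    rw [e1, sub_sub, integral_add_compl hS (hwc.mul_const q₀), integral_mul_const,
      integral_complex_ofReal, mul_comm q₀]
  rw [← hwint, hmain]
  -- The bound ‖h‖ ≤ ‖x‖²/2 costs half of the Gaussian; the dominating function is written with the
  -- remaining half.
  set G : (Fin n → ℝ) → ℝ := fun x => k1 * (Real.exp (-(1 / 2 * N) * ∑ i, x i ^ 2) * U 2 x) +
    k2 * N * (Real.exp (-(1 / 2 * N) * ∑ i, x i ^ 2) * U 4 x) +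
    k3 * N ^ 2 * (Real.exp (-(1 / 2 * N) * ∑ i, x i ^ 2) * U 6 x) with hG
  have hUi2 : ∀ k, Integrable fun x : Fin n → ℝ =>
      Real.exp (-(1 / 2 * N) * ∑ i, x i ^ 2) * U k x := fun k => hUi k (by positivity)
  have hGi : Integrable G :=
    (((hUi2 2).const_mul _).add ((hUi2 4).const_mul _)).add ((hUi2 6).const_mul _)
  have hGint : ∫ x, G x = (k1 * M 2 + k2 * M 4 + k3 * M 6) * (N : ℝ) ^ (-((n + d) / 2)) / N := by
    simp only [hG]
    have iG : Integrable fun x : Fin n → ℝ =>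
        k1 * (Real.exp (-(1 / 2 * N) * ∑ i, x i ^ 2) * U 2 x) +
          k2 * N * (Real.exp (-(1 / 2 * N) * ∑ i, x i ^ 2) * U 4 x) :=
      ((hUi2 2).const_mul _).add ((hUi2 4).const_mul _)
    rw [integral_add iG ((hUi2 6).const_mul _),
      integral_add ((hUi2 2).const_mul _) ((hUi2 4).const_mul _)]
    simp only [integral_const_mul]
    rw [integral_exp_mul_homogeneous (hUh 2) _ hN, integral_exp_mul_homogeneous (hUh 4) _ hN,
      integral_exp_mul_homogeneous (hUh 6) _ hN]
    have hpow : ∀ k m : ℕ, k = 2 * m → (N : ℝ) ^ (-((n + (d + (k : ℕ))) / 2)) =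
        (N : ℝ) ^ (-((n + d) / 2)) / (N : ℝ) ^ m := fun k m hkm => by
      subst hkm
      rw [← Real.rpow_natCast (N : ℝ) m, ← Real.rpow_sub hN]
      congr 1; push_cast; ring
    rw [hpow 2 1 rfl, hpow 4 2 rfl, hpow 6 3 rfl]
    simp only [hM]
    field_simp
  rw [← hGint]
  refine norm_integral_le_of_norm_le hGi (Eventually.of_forall fun x => ?_)
  have hSx : 0 ≤ V x := hV0 x
  by_cases hx : x ∈ S
  · rw [Set.indicator_of_mem hx, Set.indicator_of_notMem (by simpa using hx), sub_zero, norm_mul,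
      norm_real, Real.norm_of_nonneg (hw0 x)]
    have hx' := hSneg x hx
    have := norm_even_part_sub_le (N := N) (X := ‖x‖) (C := C) hN.le (norm_nonneg x) hC
      (h3 x hx) (by simpa using h3 _ hx') (h2 x hx) (by simpa using h2 _ hx') (h4 x hx)
      (hq1 x hx) (by simpa using hq1 _ hx') (hq2 x hx)
    rw [ofReal_natCast] at this
    calc w x * ‖(Q x + Q (-x)) / 2 - q₀‖ ≤ w x * ((C * ‖x‖ ^ 2 + k2 * (N * ‖x‖ ^ 4) +
          k3 * (N ^ 2 * ‖x‖ ^ 6)) * Real.exp (N * ‖x‖ ^ 2 / 2)) :=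
          mul_le_mul_of_nonneg_left this (hw0 x)
      _ = (Real.exp (-N * ∑ i, x i ^ 2) * Real.exp (N / 2 * ‖x‖ ^ 2)) *
          (V x * (C * ‖x‖ ^ 2 + k2 * (N * ‖x‖ ^ 4) + k3 * (N ^ 2 * ‖x‖ ^ 6))) := by
          simp only [hw]
          rw [show (N : ℝ) * ‖x‖ ^ 2 / 2 = N / 2 * ‖x‖ ^ 2 by ring]; ring
      _ ≤ Real.exp (-(N / 2) * ∑ i, x i ^ 2) *
          (V x * (k1 * ‖x‖ ^ 2 + k2 * (N * ‖x‖ ^ 4) + k3 * (N ^ 2 * ‖x‖ ^ 6))) := by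
          refine mul_le_mul (hsplit x) ?_ (by positivity) (Real.exp_nonneg _)
          gcongr
          rw [hk1]; linarith [show 0 ≤ ‖q₀‖ / r ^ 2 by positivity]
      _ = G x := by
          simp only [hG, hU]
          rw [show -((N : ℝ) / 2) = -(1 / 2 * N) by ring]; ring
  · rw [Set.indicator_of_notMem hx, Set.indicator_of_mem (by simpa using hx), zero_sub, norm_neg,
      norm_mul, norm_real, Real.norm_of_nonneg (hw0 x)]
    have hrx : r ≤ ‖x‖ := by
      by_contra hlt
      exact hx (hSr (by simpa using hlt))
    have h1 : ‖q₀‖ ≤ k1 * ‖x‖ ^ 2 := by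
      have : ‖q₀‖ = ‖q₀‖ / r ^ 2 * r ^ 2 := by field_simp
      rw [this]
      gcongr
      rw [hk1]; linarith
    have h2 : Real.exp (-N * ∑ i, x i ^ 2) ≤ Real.exp (-(1 / 2 * N) * ∑ i, x i ^ 2) :=
      Real.exp_le_exp.2 (by
        nlinarith [show 0 ≤ ∑ i, x i ^ 2 from Finset.sum_nonneg fun i _ => sq_nonneg _])
    calc w x * ‖q₀‖ ≤ (Real.exp (-(1 / 2 * N) * ∑ i, x i ^ 2) * V x) * (k1 * ‖x‖ ^ 2) := by
          simp only [hw]; gcongr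
      _ = k1 * (Real.exp (-(1 / 2 * N) * ∑ i, x i ^ 2) * U 2 x) := by simp only [hU]; ring
      _ ≤ G x := by
          simp only [hG, hU]
          have : 0 ≤ k2 * N * (Real.exp (-(1 / 2 * N) * ∑ i, x i ^ 2) * (V x * ‖x‖ ^ 4)) := by
            positivity
          have : 0 ≤ k3 * N ^ 2 * (Real.exp (-(1 / 2 * N) * ∑ i, x i ^ 2) * (V x * ‖x‖ ^ 6)) := by
            positivity
          linarith

end Laplace

/-! ### Local analysis at a saddle point. -/

section Saddle

/-- The Taylor expansion to third order at a critical point. -/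
theorem exists_taylor_bound {P : ℂ → ℂ} {z₀ : ℂ} (hP : AnalyticAt ℂ P z₀) (h1 : deriv P z₀ = 0) :
    ∃ K r : ℝ, ∃ p₃ : ℂ, 0 ≤ K ∧ 0 < r ∧ ∀ w : ℂ, ‖w‖ < r →
      ‖P (z₀ + w) - P z₀ - iteratedDeriv 2 P z₀ / 2 * w ^ 2 - p₃ * w ^ 3‖ ≤ K * ‖w‖ ^ 4 := by
  have h := hP.hasFPowerSeriesAt.isBigO_sub_partialSum_pow 4
  obtain ⟨K, hK⟩ := h.bound
  obtain ⟨r, hr, hball⟩ := Metric.eventually_nhds_iff_ball.1 hK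
  refine ⟨max K 0, r, iteratedDeriv 3 P z₀ / 6, le_max_right _ _, hr, fun w hw => ?_⟩
  have := hball w (by simpa using hw)
  rw [norm_pow, norm_norm] at this
  calc _ = ‖P (z₀ + w) - (FormalMultilinearSeries.ofScalars ℂ
        fun n => iteratedDeriv n P z₀ / n.factorial).partialSum 4 w‖ := by
        congr 1
        simp [FormalMultilinearSeries.partialSum, Finset.sum_range_succ, h1, Nat.factorial]
        ring
    _ ≤ _ := this
    _ ≤ _ := by gcongr; exact le_max_left _ _

/-- Near a critical point the real part decreases quadratically in a cone around the direction of
steepest descent. -/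
theorem exists_cone {P : ℂ → ℂ} {z₀ κ : ℂ} {a : ℝ} (hP : AnalyticAt ℂ P z₀) (h1 : deriv P z₀ = 0)
    (ha : 0 < a) (h2 : iteratedDeriv 2 P z₀ / 2 * κ ^ 2 = -a) :
    ∃ ε > 0, ∃ r > 0, ∃ c > 0, ∀ x y : ℝ, |x| < r → |y| ≤ ε * |x| →
      (P (z₀ + κ * x + I * y)).re ≤ (P z₀).re - c * x ^ 2 := by
  obtain ⟨K, r, p₃, hK, hr, hT⟩ := exists_taylor_bound hP h1
  set p₂ := iteratedDeriv 2 P z₀ / 2 with hp₂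
  -- Of the decrease a x², the width ε spends at most a quarter on the terms containing y, and the
  -- radius r' at most a quarter on the cubic and quartic terms, which leaves a/2.
  set D := ‖p₂‖ * (2 * ‖κ‖ + 1) + 1 with hD
  have hD0 : 0 < D := by positivity
  set ε := min 1 (a / (4 * D)) with hε
  have hε0 : 0 < ε := lt_min one_pos (by positivity)
  set T := (‖p₃‖ + K) * (‖κ‖ + 1) ^ 3 * (1 + ‖κ‖ + 1) + 1 with hTdef
  have hT0 : 0 < T := by positivity
  set r' := min 1 (min (r / (‖κ‖ + 1)) (a / (4 * T))) with hr'
  have hr'0 : 0 < r' := lt_min one_pos (lt_min (by positivity) (by positivity))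
  refine ⟨ε, hε0, r', hr'0, a / 2, by positivity, fun x y hx hy => ?_⟩
  set w : ℂ := κ * x + I * y with hw
  have hε1 : ε ≤ 1 := min_le_left _ _
  have hwn : ‖w‖ ≤ (‖κ‖ + 1) * |x| := by
    refine (norm_add_le _ _).trans ?_
    rw [norm_mul, norm_mul, norm_real, norm_real, norm_I, Real.norm_eq_abs, Real.norm_eq_abs]
    nlinarith [abs_nonneg x]
  have hx1 : |x| ≤ 1 := (hx.trans_le (min_le_left _ _)).le
  have hwr : ‖w‖ < r := by
    have : |x| < r / (‖κ‖ + 1) := hx.trans_le ((min_le_right _ _).trans (min_le_left _ _))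
    rw [lt_div_iff₀ (by positivity)] at this
    linarith
  have hxT : |x| * T ≤ a / 4 := by
    have : |x| < a / (4 * T) := hx.trans_le ((min_le_right _ _).trans (min_le_right _ _))
    rw [lt_div_iff₀ (by positivity)] at this
    linarith
  have hεD : ε * D ≤ a / 4 := by
    have : ε ≤ a / (4 * D) := min_le_right _ _
    rw [le_div_iff₀ (by positivity)] at this
    linarith
  have hmain := hT w hwr
  rw [show z₀ + κ * x + I * y = z₀ + w by rw [hw]; ring]
  have hsq : p₂ * w ^ 2 = -a * x ^ 2 + p₂ * (2 * I * κ * x * y - y ^ 2) := by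
    have : p₂ * w ^ 2 = p₂ * κ ^ 2 * x ^ 2 + p₂ * (2 * I * κ * x * y + (I * I) * y ^ 2) := by
      rw [hw]; ring
    rw [this, h2, I_mul_I]; ring
  have e : P (z₀ + w) = P z₀ + -a * x ^ 2 + (p₂ * (2 * I * κ * x * y - y ^ 2) + p₃ * w ^ 3 +
      (P (z₀ + w) - P z₀ - p₂ * w ^ 2 - p₃ * w ^ 3)) := by rw [hsq]; ring
  have b1 : ‖p₂ * (2 * I * κ * x * y - y ^ 2)‖ ≤ a / 4 * x ^ 2 := by
    rw [norm_mul]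
    have : ‖2 * I * κ * x * y - (y : ℂ) ^ 2‖ ≤ 2 * ‖κ‖ * |x| * |y| + |y| ^ 2 := by
      refine (norm_sub_le _ _).trans ?_
      simp
    have h3 : 2 * ‖κ‖ * |x| * |y| + |y| ^ 2 ≤ ε * (2 * ‖κ‖ + 1) * |x| ^ 2 := by
      have : |y| ^ 2 ≤ (ε * |x|) * |x| := by
        rw [sq]
        exact mul_le_mul hy (hy.trans (by nlinarith [abs_nonneg x])) (abs_nonneg _) (by positivity)
      have : 2 * ‖κ‖ * |x| * |y| ≤ 2 * ‖κ‖ * |x| * (ε * |x|) := by gcongr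
      nlinarith
    calc _ ≤ ‖p₂‖ * (ε * (2 * ‖κ‖ + 1) * |x| ^ 2) := by gcongr; exact this.trans h3
      _ = ε * (D - 1) * x ^ 2 := by rw [hD, sq_abs]; ring
      _ ≤ _ := by gcongr; nlinarith
  have b2 : ‖p₃ * w ^ 3 + (P (z₀ + w) - P z₀ - p₂ * w ^ 2 - p₃ * w ^ 3)‖ ≤ a / 4 * x ^ 2 := by
    refine (norm_add_le _ _).trans ?_
    rw [norm_mul, norm_pow]
    have h3 : ‖w‖ ^ 3 ≤ ((‖κ‖ + 1) * |x|) ^ 3 := by gcongr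
    have h4 : ‖w‖ ≤ 1 + ‖κ‖ + 1 := hwn.trans (by nlinarith [norm_nonneg κ])
    calc _ ≤ ‖p₃‖ * ‖w‖ ^ 3 + K * ‖w‖ ^ 4 := by gcongr
      _ = (‖p₃‖ + K * ‖w‖) * ‖w‖ ^ 3 := by ring
      _ ≤ ((‖p₃‖ + K) * (1 + ‖κ‖ + 1)) * ((‖κ‖ + 1) * |x|) ^ 3 := by
        gcongr
        nlinarith [norm_nonneg p₃, norm_nonneg κ]
      _ = (T - 1) * |x| * |x| ^ 2 := by rw [hTdef]; ring
      _ ≤ _ := by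
        rw [sq_abs]
        gcongr
        nlinarith [abs_nonneg x]
  have b3 := re_le_norm (p₂ * (2 * I * κ * x * y - y ^ 2))
  have b4 := re_le_norm (p₃ * w ^ 3 + (P (z₀ + w) - P z₀ - p₂ * w ^ 2 - p₃ * w ^ 3))
  have e' := congrArg re e
  rw [add_assoc (p₂ * _), add_re, add_re, add_re (p₂ * _)] at e'
  have e3 : (-(a : ℂ) * (x : ℂ) ^ 2).re = -a * x ^ 2 := by
    rw [← ofReal_pow, ← ofReal_neg, ← ofReal_mul, ofReal_re]
  rw [e', e3]
  linarith

theorem hasDerivAt_exp_I_mul (z : ℂ) : HasDerivAt (fun z => exp (I * z)) (exp (I * z) * I) z := by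
  simpa using ((hasDerivAt_id z).const_mul I).cexp

variable {f : ℂ → ℂ} {z₀ : ℂ}

theorem analyticAt_comp_exp (hf : AnalyticAt ℂ f (exp (I * z₀))) :
    AnalyticAt ℂ (fun z => f (exp (I * z))) z₀ :=
  hf.comp (f := fun z => exp (I * z)) (by fun_prop)

theorem deriv_comp_exp (hf : AnalyticAt ℂ f (exp (I * z₀))) :
    deriv (fun z => f (exp (I * z))) =ᶠ[𝓝 z₀] fun z => deriv f (exp (I * z)) * (exp (I * z) * I) := by
  have hc : ContinuousAt (fun z => exp (I * z)) z₀ := by fun_prop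
  filter_upwards [hc.eventually hf.eventually_analyticAt] with z hz
  exact (hz.differentiableAt.hasDerivAt.comp z (hasDerivAt_exp_I_mul z)).deriv

/-- At a critical point the second term of the chain rule, which contains the first derivative,
vanishes. -/
theorem iteratedDeriv_two_comp_exp (hf : AnalyticAt ℂ f (exp (I * z₀)))
    (h1 : deriv f (exp (I * z₀)) = 0) :
    iteratedDeriv 2 (fun z => f (exp (I * z))) z₀ =
      iteratedDeriv 2 f (exp (I * z₀)) * (exp (I * z₀) * I) ^ 2 := by
  rw [iteratedDeriv_succ, iteratedDeriv_one, (deriv_comp_exp hf).deriv_eq, iteratedDeriv_succ,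
    iteratedDeriv_one]
  have hd := (hf.deriv.differentiableAt.hasDerivAt.comp z₀ (hasDerivAt_exp_I_mul z₀)).mul
    ((hasDerivAt_exp_I_mul z₀).mul_const I)
  refine hd.deriv.trans ?_
  simp only [Function.comp_apply, h1, zero_mul, add_zero]
  ring

end Saddle

/-! ### Straightening a C¹ contour at the saddle points. -/

section Straighten

/-- A contour can be replaced by its tangent near a point, without changing it elsewhere. -/
theorem exists_isHeight_straight {σ σ' : ℝ → ℝ} {L : ℝ} (h : IsHeight σ σ' L) {ψ : ℝ}
    (hψ : ψ ∈ arc) {ε η₀ : ℝ} (hε : 0 < ε) (hη₀ : 0 < η₀) :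
    ∃ τ τ' : ℝ → ℝ, ∃ L' η : ℝ, IsHeight τ τ' L' ∧ 0 < η ∧
      (∀ t, |t - ψ| ≤ η → τ t = σ ψ + σ' ψ * (t - ψ) ∧ τ' t = σ' ψ) ∧
      (∀ t, η₀ ≤ |t - ψ| → τ t = σ t ∧ τ' t = σ' t) ∧
      ∀ t, |t - ψ| < η₀ → τ t ≠ σ t → |τ t - (σ ψ + σ' ψ * (t - ψ))| ≤ ε * |t - ψ| := by
  have hd := (h.deriv ψ hψ).isLittleO.bound hε
  obtain ⟨r, hr, hball⟩ := Metric.eventually_nhds_iff_ball.1 hd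
  obtain ⟨r', hr', hball'⟩ := Metric.isOpen_iff.1 isOpen_Ioo ψ hψ
  set ρ := min (min r r') η₀ with hρ
  have hρ0 : 0 < ρ := lt_min (lt_min hr hr') hη₀
  -- Interpolates between the tangent line near ψ and the contour itself farther out, inside the
  -- neighbourhood where differentiability at ψ bounds their distance by ε |t - ψ|.
  let χ : ContDiffBump ψ := ⟨ρ / 3, ρ / 2, by positivity, by linarith⟩
  have hχd : ContDiff ℝ 1 χ := χ.contDiff
  have hχ1 : ∀ t, |t - ψ| ≤ ρ / 3 → χ t = 1 := fun t ht =>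
    χ.one_of_mem_closedBall (by rwa [Metric.mem_closedBall, Real.dist_eq])
  have hχ0 : ∀ t, ρ / 2 ≤ |t - ψ| → χ t = 0 := fun t ht =>
    χ.zero_of_le_dist (by rwa [Real.dist_eq])
  have hχabs : ∀ t, |1 - χ t| ≤ 1 := fun t => by
    rw [abs_le]; constructor <;> linarith [χ.nonneg (x := t), χ.le_one (x := t)]
  have hdc : Continuous (deriv χ) := hχd.continuous_deriv le_rfl
  have hd1 : ∀ t, |t - ψ| < ρ / 3 → deriv χ t = 0 := fun t ht => by
    have : (χ : ℝ → ℝ) =ᶠ[𝓝 t] fun _ => 1 := by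
      filter_upwards [(isOpen_lt (by fun_prop) continuous_const :
        IsOpen {t : ℝ | |t - ψ| < ρ / 3}).mem_nhds ht] with s hs
      exact hχ1 s (le_of_lt hs)
    rw [this.deriv_eq, deriv_const]
  have hd0 : ∀ t, ρ / 2 < |t - ψ| → deriv χ t = 0 := fun t ht => by
    have : (χ : ℝ → ℝ) =ᶠ[𝓝 t] fun _ => 0 := by
      filter_upwards [(isOpen_lt continuous_const (by fun_prop) :
        IsOpen {t : ℝ | ρ / 2 < |t - ψ|}).mem_nhds ht] with s hs
      exact hχ0 s (le_of_lt hs)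
    rw [this.deriv_eq, deriv_const]
  obtain ⟨B, hB⟩ := isCompact_Icc.exists_bound_of_continuousOn
    (hdc.continuousOn (s := Set.Icc 0 (2 * Real.pi)))
  set l : ℝ → ℝ := fun t => σ ψ + σ' ψ * (t - ψ) with hl
  have hlc : Continuous l := by simp only [hl]; fun_prop
  obtain ⟨B', hB'⟩ := isCompact_Icc.exists_bound_of_continuousOn
    (hlc.continuousOn.sub h.cont)
  have hmem : ∀ t, |t - ψ| < ρ → t ∈ arc := fun t ht =>
    hball' (by rw [Metric.mem_ball, Real.dist_eq]
               exact ht.trans_le ((min_le_left _ _).trans (min_le_right _ _)))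
  have hends : ∀ t, t ∉ arc → χ t = 0 := fun t ht => by
    refine hχ0 t ?_
    by_contra hlt
    exact ht (hmem t (by linarith))
  refine ⟨fun t => σ t + χ t * (l t - σ t),
    fun t => σ' t + (deriv χ t * (l t - σ t) + χ t * (σ' ψ - σ' t)),
    L + (|B| * |B'| + 1 * (|σ' ψ| + L)), ρ / 4, ⟨?_, ?_, ?_, ?_, ?_, ?_, ?_⟩, by positivity, ?_, ?_,
    ?_⟩
  · have := h.meas
    have := χ.continuous.measurable
    have := hlc.measurable
    fun_prop
  · have := h.meas
    have := h.meas'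
    have := χ.continuous.measurable
    have := hlc.measurable
    have := hdc.measurable
    fun_prop
  · simp [h.zero, hends 0 (by simp)]
  · simp [h.two_pi, hends (2 * Real.pi) (by simp)]
  · exact h.cont.add (χ.continuous.continuousOn.mul (hlc.continuousOn.sub h.cont))
  · intro t ht
    have hdl : HasDerivAt l (σ' ψ) t := by
      simpa [hl] using (((hasDerivAt_id t).sub_const ψ).const_mul (σ' ψ)).const_add (σ ψ)
    exact (h.deriv t ht).add ((hχd.differentiable one_ne_zero t).hasDerivAt.mul
      (hdl.sub (h.deriv t ht)))
  · intro t ht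
    have b1 : |deriv χ t * (l t - σ t)| ≤ |B| * |B'| := by
      rw [abs_mul]
      exact mul_le_mul ((hB t (Set.Ioo_subset_Icc_self ht)).trans (le_abs_self _))
        ((hB' t (Set.Ioo_subset_Icc_self ht)).trans (le_abs_self _)) (abs_nonneg _) (abs_nonneg _)
    have b2 : |χ t * (σ' ψ - σ' t)| ≤ 1 * (|σ' ψ| + L) := by
      rw [abs_mul, abs_of_nonneg χ.nonneg]
      exact mul_le_mul χ.le_one ((abs_sub _ _).trans (by linarith [h.bound t ht])) (abs_nonneg _)
        zero_le_one
    exact (abs_add_le _ _).trans (add_le_add (h.bound t ht) ((abs_add_le _ _).trans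
      (add_le_add b1 b2)))
  · intro t ht
    have : χ t = 1 := hχ1 t (by linarith)
    have : deriv χ t = 0 := hd1 t (by linarith)
    simp [*]
  · intro t ht
    have h2 : ρ ≤ η₀ := min_le_right _ _
    have : χ t = 0 := hχ0 t (by linarith)
    have : deriv χ t = 0 := hd0 t (by linarith)
    simp [*]
  · intro t _ hne
    have hlt : |t - ψ| < ρ / 2 := by
      by_contra hge
      simp [hχ0 t (not_lt.1 hge)] at hne
    have := hball t (by
      rw [Metric.mem_ball, Real.dist_eq]
      have : ρ ≤ r := (min_le_left _ _).trans (min_le_left _ _)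
      linarith)
    simp only [Real.norm_eq_abs, smul_eq_mul] at this
    -- The distance of the new contour from the tangent line is (1 - χ) times that of the old one.
    have e : σ t + χ t * (l t - σ t) - (σ ψ + σ' ψ * (t - ψ)) =
        (1 - χ t) * (σ t - σ ψ - (t - ψ) * σ' ψ) := by simp only [hl]; ring
    rw [e, abs_mul]
    calc _ ≤ 1 * (ε * |t - ψ|) := by
          gcongr
          exact hχabs t
      _ = _ := one_mul _

/-- `W` is below `H` along the contour, away from the two points `ψ₁` and `ψ₂`. -/
def Descends (W : ℂ → ℝ) (H : ℝ) (σ : ℝ → ℝ) (ψ₁ ψ₂ : ℝ) : Prop :=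
  ∀ η > 0, ∃ δ > 0, ∀ t ∈ arc, η ≤ |t - ψ₁| → η ≤ |t - ψ₂| → W (heightPath σ 1 t) ≤ H - δ

theorem Descends.symm {W : ℂ → ℝ} {H : ℝ} {σ : ℝ → ℝ} {ψ₁ ψ₂ : ℝ} (h : Descends W H σ ψ₁ ψ₂) :
    Descends W H σ ψ₂ ψ₁ := fun η hη =>
  let ⟨δ, hδ, hh⟩ := h η hη
  ⟨δ, hδ, fun t ht h1 h2 => hh t ht h2 h1⟩

/-- Wherever the contour is altered, the new one lies in the cone around the tangent on which W ≤ H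
- c x²; elsewhere the descent is inherited. The neighbourhood of the other saddle point is left
untouched, so that the construction can be applied to both in turn. -/
theorem Descends.exists_straight {W : ℂ → ℝ} {H : ℝ} {σ σ' : ℝ → ℝ} {L : ℝ} {ψ ψ₂ : ℝ}
    (hD : Descends W H σ ψ ψ₂) (h : IsHeight σ σ' L) (hψ : ψ ∈ arc) (hne : ψ ≠ ψ₂)
    (hcone : ∃ ε > 0, ∃ r > 0, ∃ c > 0, ∀ x y : ℝ, |x| < r → |y| ≤ ε * |x| →
      W (heightPath σ 1 ψ + (1 + I * σ' ψ) * x + I * y) ≤ H - c * x ^ 2) :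
    ∃ τ τ' : ℝ → ℝ, ∃ L' η : ℝ, IsHeight τ τ' L' ∧ 0 < η ∧
      (∀ t, |t - ψ| ≤ η → τ t = σ ψ + σ' ψ * (t - ψ) ∧ τ' t = σ' ψ) ∧
      (∀ t, |t - ψ₂| ≤ |ψ - ψ₂| / 2 → τ t = σ t ∧ τ' t = σ' t) ∧ Descends W H τ ψ ψ₂ := by
  obtain ⟨ε, hε, r, hr, c, hc, hW⟩ := hcone
  have hne' : 0 < |ψ - ψ₂| := abs_pos.2 (sub_ne_zero.2 hne)
  obtain ⟨τ, τ', L', η, hτ, hη, h1, h2, h3⟩ :=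
    exists_isHeight_straight h hψ hε (lt_min hr (half_pos hne'))
  refine ⟨τ, τ', L', η, hτ, hη, h1, fun t ht => h2 t ?_, fun η' hη' => ?_⟩
  · refine (min_le_right _ _).trans ?_
    have := abs_sub_le ψ t ψ₂
    rw [abs_sub_comm ψ t] at this
    linarith
  · obtain ⟨δ, hδ, hh⟩ := hD η' hη'
    refine ⟨min δ (c * η' ^ 2), lt_min hδ (by positivity), fun t ht ht1 ht2 => ?_⟩
    by_cases hts : τ t = σ t
    · have := hh t ht ht1 ht2
      rw [heightPath, ← hts, ← heightPath] at this
      linarith [min_le_left δ (c * η' ^ 2)]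
    · have hlt : |t - ψ| < min r (|ψ - ψ₂| / 2) := by
        by_contra hge
        exact hts (h2 t (not_lt.1 hge)).1
      have := hW (t - ψ) (τ t - (σ ψ + σ' ψ * (t - ψ))) (hlt.trans_le (min_le_left _ _))
        (h3 t hlt hts)
      have e : heightPath σ 1 ψ + (1 + I * σ' ψ) * (t - ψ : ℝ) +
          I * (τ t - (σ ψ + σ' ψ * (t - ψ)) : ℝ) = heightPath τ 1 t := by
        simp only [heightPath]; push_cast; ring
      rw [e] at this
      have h4 : η' ^ 2 ≤ (t - ψ) ^ 2 := by
        rw [← sq_abs (t - ψ)]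
        gcongr
      nlinarith [min_le_right δ (c * η' ^ 2)]

end Straighten

/-! ### Two clusters of variables and the factorised Gaussian weight. -/

section Cluster

/-- The label of a variable: `true` for the first `m` variables. -/
def lab (m : ℕ) {l : ℕ} (j : Fin l) : Bool := decide (j.1 < m)

@[simp] theorem lab_castAdd (m n : ℕ) (j : Fin m) : lab m (Fin.castAdd n j) = true := by
  simp [lab]

@[simp] theorem lab_natAdd (m n : ℕ) (j : Fin n) : lab m (Fin.natAdd m j) = false := by
  simp [lab]

theorem lab_of_lt {m l : ℕ} {j k : Fin l} (hjk : j < k) (hne : lab m j ≠ lab m k) :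
    lab m j = true ∧ lab m k = false := by
  simp only [lab, ne_eq, decide_eq_decide, decide_eq_true_eq, decide_eq_false_iff_not] at *
  have : j.1 < k.1 := hjk
  omega

theorem prod_pairs_eq {M : Type*} [CommMonoid M] {l : ℕ} (F : Fin l → Fin l → M) :
    ∏ j, ∏ k ∈ Finset.Ioi j, F j k = ∏ j, ∏ k, if j < k then F j k else 1 := by
  refine Finset.prod_congr rfl fun j _ => ?_
  rw [← Finset.prod_filter]
  congr 1
  ext k; simp

theorem prod_pairs_append {M : Type*} [CommMonoid M] {m n : ℕ}
    (F : Fin (m + n) → Fin (m + n) → M) :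
    ∏ j, ∏ k ∈ Finset.Ioi j, F j k =
      (∏ j : Fin m, ∏ k ∈ Finset.Ioi j, F (Fin.castAdd n j) (Fin.castAdd n k)) *
      (∏ j : Fin m, ∏ k : Fin n, F (Fin.castAdd n j) (Fin.natAdd m k)) *
      ∏ j : Fin n, ∏ k ∈ Finset.Ioi j, F (Fin.natAdd m j) (Fin.natAdd m k) := by
  rw [prod_pairs_eq, prod_pairs_eq, prod_pairs_eq, Fin.prod_univ_add]
  simp only [Fin.prod_univ_add, Finset.prod_mul_distrib]
  have h1 : ∀ (j : Fin m) (k : Fin n), Fin.castAdd n j < Fin.natAdd m k := fun j k => by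
    simp only [Fin.lt_def, Fin.val_castAdd, Fin.val_natAdd]; omega
  have h2 : ∀ (j : Fin n) (k : Fin m), ¬ Fin.natAdd m j < Fin.castAdd n k := fun j k => by
    simp only [Fin.lt_def, Fin.val_castAdd, Fin.val_natAdd]; omega
  have h3 : ∀ (j k : Fin m), Fin.castAdd n j < Fin.castAdd n k ↔ j < k := fun j k => by
    simp only [Fin.lt_def, Fin.val_castAdd]
  have h4 : ∀ (j k : Fin n), Fin.natAdd m j < Fin.natAdd m k ↔ j < k := fun j k => by
    simp only [Fin.lt_def, Fin.val_natAdd]; omega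
  simp [h1, h2, h3, h4]

theorem prod_pairs_const {M : Type*} [CommMonoid M] (l : ℕ) (c : M) :
    ∏ j : Fin l, ∏ _k ∈ Finset.Ioi j, c = c ^ l.choose 2 := by
  simp only [Finset.prod_const, Fin.card_Ioi, Finset.prod_pow_eq_pow_sum]
  congr 1
  rw [Fin.sum_univ_eq_sum_range (fun i => l - 1 - i), Finset.sum_range_reflect (fun i => i),
    Finset.sum_range_id, Nat.choose_two_right]

theorem prod_pairs_lab {M : Type*} [CommMonoid M] (m n : ℕ) (a b c : M) :
    ∏ j : Fin (m + n), ∏ k ∈ Finset.Ioi j, (if lab m j = lab m k then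
      (if lab m j = true then a else b) else c) =
      a ^ m.choose 2 * c ^ (m * n) * b ^ n.choose 2 := by
  rw [prod_pairs_append]
  simp only [lab_castAdd, lab_natAdd, if_true, prod_pairs_const]
  simp [pow_mul, mul_comm m n]

/-- The product of the `|x_j - x_k|^p` over the pairs of variables with the same label. -/
def clusterProduct (p : ℝ) (m n : ℕ) (x : Fin (m + n) → ℝ) : ℝ :=
  ∏ j, ∏ k ∈ Finset.Ioi j, if lab m j = lab m k then |x k - x j| ^ p else 1

/-- The degree of `clusterProduct`. -/
def clusterDegree (p : ℝ) (m n : ℕ) : ℝ := p * (m.choose 2 + n.choose 2 : ℕ)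

variable {p : ℝ} {m n : ℕ}

theorem clusterProduct_nonneg (x : Fin (m + n) → ℝ) : 0 ≤ clusterProduct p m n x := by
  refine Finset.prod_nonneg fun j _ => Finset.prod_nonneg fun k _ => ?_
  split_ifs <;> positivity

theorem clusterProduct_neg (x : Fin (m + n) → ℝ) :
    clusterProduct p m n (-x) = clusterProduct p m n x := by
  simp only [clusterProduct, Pi.neg_apply]
  congr! 4 with j _ k _
  rw [neg_sub_neg, abs_sub_comm]

theorem measurable_clusterProduct : Measurable (clusterProduct p m n) := by
  unfold clusterProduct
  refine Finset.measurable_fun_prod _ fun j _ => Finset.measurable_fun_prod _ fun k _ => ?_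
  split_ifs
  · have : Measurable (abs : ℝ → ℝ) := continuous_abs.measurable
    fun_prop
  · fun_prop

theorem prod_pairs_rpow {c : ℝ} (hc : 0 ≤ c) :
    ∏ j : Fin (m + n), ∏ k ∈ Finset.Ioi j, (if lab m j = lab m k then c ^ p else 1) =
      c ^ clusterDegree p m n := by
  have := prod_pairs_lab m n (c ^ p) (c ^ p) 1
  simp only [ite_self] at this
  rw [this, one_pow, mul_one, ← pow_add, clusterDegree, Real.rpow_mul_natCast hc]

theorem clusterProduct_smul {c : ℝ} (hc : 0 < c) (x : Fin (m + n) → ℝ) :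
    clusterProduct p m n (c • x) = c ^ clusterDegree p m n * clusterProduct p m n x := by
  rw [← prod_pairs_rpow hc.le, clusterProduct, clusterProduct, ← Finset.prod_mul_distrib]
  refine Finset.prod_congr rfl fun j _ => ?_
  rw [← Finset.prod_mul_distrib]
  refine Finset.prod_congr rfl fun k _ => ?_
  split_ifs
  · rw [Pi.smul_apply, Pi.smul_apply, ← smul_sub, smul_eq_mul, abs_mul, abs_of_pos hc,
      Real.mul_rpow hc.le (abs_nonneg _)]
  · rw [one_mul]

theorem clusterDegree_nonneg (hp : 0 ≤ p) : 0 ≤ clusterDegree p m n := by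
  unfold clusterDegree; positivity

theorem clusterProduct_le (hp : 0 ≤ p) (x : Fin (m + n) → ℝ) :
    clusterProduct p m n x ≤ 2 ^ clusterDegree p m n * ‖x‖ ^ clusterDegree p m n := by
  rw [← Real.mul_rpow zero_le_two (norm_nonneg _), ← prod_pairs_rpow (by positivity)]
  refine Finset.prod_le_prod (fun j _ => Finset.prod_nonneg fun k _ => ?_) fun j _ =>
    Finset.prod_le_prod (fun k _ => ?_) fun k _ => ?_
  · split_ifs <;> positivity
  · split_ifs <;> positivity
  · split_ifs
    · refine Real.rpow_le_rpow (abs_nonneg _) ((abs_sub _ _).trans ?_) hp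
      have h1 := norm_le_pi_norm x k
      have h2 := norm_le_pi_norm x j
      rw [Real.norm_eq_abs] at h1 h2
      linarith
    · rfl

theorem integral_fin_add_mul (F : (Fin m → ℝ) → ℝ) (G : (Fin n → ℝ) → ℝ) :
    ∫ x : Fin (m + n) → ℝ, F (fun j => x (Fin.castAdd n j)) * G (fun j => x (Fin.natAdd m j)) =
      (∫ x, F x) * ∫ x, G x := by
  rw [← integral_prod_mul (μ := volume) (ν := volume) F G]
  have h1 := volume_measurePreserving_piCongrLeft (fun _ : Fin m ⊕ Fin n => ℝ)
    (finSumFinEquiv (m := m) (n := n)).symm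
  have h2 := volume_measurePreserving_sumPiEquivProdPi (fun _ : Fin m ⊕ Fin n => ℝ)
  have h3 := h2.comp h1
  rw [← Measure.volume_eq_prod, ← h3.integral_comp
    ((MeasurableEquiv.measurableEmbedding _).comp (MeasurableEquiv.measurableEmbedding _))]
  refine integral_congr_ae (Eventually.of_forall fun x => ?_)
  have e : ∀ a, MeasurableEquiv.piCongrLeft (fun _ : Fin m ⊕ Fin n => ℝ) finSumFinEquiv.symm x a =
      x (finSumFinEquiv a) := fun a => by
    have := Equiv.piCongrLeft_apply_apply (fun _ : Fin m ⊕ Fin n => ℝ) finSumFinEquiv.symm x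
      (finSumFinEquiv a)
    rw [Equiv.symm_apply_apply] at this
    exact this
  have e1 : (fun j => x (Fin.castAdd n j)) = ((MeasurableEquiv.sumPiEquivProdPi fun _ => ℝ)
      (MeasurableEquiv.piCongrLeft (fun _ : Fin m ⊕ Fin n => ℝ) finSumFinEquiv.symm x)).1 :=
    funext fun j => (e (Sum.inl j)).symm
  have e2 : (fun j => x (Fin.natAdd m j)) = ((MeasurableEquiv.sumPiEquivProdPi fun _ => ℝ)
      (MeasurableEquiv.piCongrLeft (fun _ : Fin m ⊕ Fin n => ℝ) finSumFinEquiv.symm x)).2 :=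
    funext fun j => (e (Sum.inr j)).symm
  simp only [Function.comp_apply, ← e1, ← e2]

/-- No pair with different labels enters the weight, so the integral is a product over the two
clusters. -/
theorem integral_clusterProduct {β : ℕ} :
    ∫ x : Fin (m + n) → ℝ, Real.exp (-∑ i, x i ^ 2) * clusterProduct (4 / β) m n x =
      gammaIntegral m β * gammaIntegral n β := by
  rw [gammaIntegral, gammaIntegral, ← integral_fin_add_mul]
  refine integral_congr_ae (Eventually.of_forall fun x => ?_)
  simp only [clusterProduct, prod_pairs_append, lab_castAdd, lab_natAdd, if_true, pairProduct,
    ← Real.exp_sum, Fin.sum_univ_add, Real.norm_eq_abs]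
  simp only [Bool.true_eq_false, if_false, Finset.prod_const_one, mul_one, neg_add, Real.exp_add,
    Finset.sum_neg_distrib, abs_sub_comm]
  ring

end Cluster

/-! ### The amplitude and the phase in local coordinates. -/

section Amplitude

/-- The linear Taylor term is odd and cancels in q(x) + q(-x). -/
theorem exists_analytic_bounds {F : Type*} [NormedAddCommGroup F] [NormedSpace ℝ F] {q : F → ℂ}
    (hq : AnalyticAt ℝ q 0) :
    ∃ C r : ℝ, 0 ≤ C ∧ 0 < r ∧ ContinuousOn q (Metric.ball 0 r) ∧
      (∀ x ∈ Metric.ball 0 r, ‖q x - q 0‖ ≤ C * ‖x‖) ∧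
      ∀ x ∈ Metric.ball 0 r, ‖q x + q (-x) - 2 * q 0‖ ≤ C * ‖x‖ ^ 2 := by
  obtain ⟨p, hp⟩ := hq
  have h1 := (hp.isBigO_sub_partialSum_pow 1).bound
  have h2 := (hp.isBigO_sub_partialSum_pow 2).bound
  obtain ⟨C₁, hC₁⟩ := h1
  obtain ⟨C₂, hC₂⟩ := h2
  obtain ⟨r, hr, hball⟩ := Metric.eventually_nhds_iff_ball.1
    ((hC₁.and hC₂).and (AnalyticAt.eventually_analyticAt ⟨p, hp⟩))
  have hp0 : ∀ v : Fin 0 → F, p 0 v = q 0 := hp.coeff_zero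
  refine ⟨max 0 (max C₁ (2 * C₂)), r, le_max_left _ _, hr, fun x hx =>
    (hball x hx).2.continuousAt.continuousWithinAt, fun x hx => ?_, fun x hx => ?_⟩
  · have := (hball x hx).1.1
    simp only [FormalMultilinearSeries.partialSum, Finset.sum_range_one, hp0, zero_add, pow_one,
      norm_norm] at this
    refine this.trans ?_
    gcongr
    exact (le_max_left _ _).trans (le_max_right _ _)
  · have a1 := (hball x hx).1.2
    have a2 := (hball (-x) (by simpa using hx)).1.2
    have e1 : p 1 (fun _ => -x) = -p 1 (fun _ => x) := by
      have := (p 1).map_update_neg (fun _ => x) 0 x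
      simp only [Function.update_eq_const_of_subsingleton] at this
      exact this
    simp only [FormalMultilinearSeries.partialSum, Finset.sum_range_succ, Finset.sum_range_zero, hp0,
      zero_add, norm_pow, norm_norm, norm_neg, e1] at a1 a2
    have e2 : q x + q (-x) - 2 * q 0 = (q x - (q 0 + p 1 fun _ => x)) +
        (q (-x) - (q 0 + -p 1 fun _ => x)) := by ring
    rw [e2]
    refine (norm_add_le _ _).trans ?_
    calc _ ≤ 2 * C₂ * ‖x‖ ^ 2 := by linarith
      _ ≤ _ := by gcongr; exact (le_max_right _ _).trans (le_max_right _ _)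

/-- The entire function `sin w / w`. -/
def csinc (w : ℂ) : ℂ := dslope sin 0 w

theorem csinc_zero : csinc 0 = 1 := by simp [csinc]

theorem mul_csinc (w : ℂ) : w * csinc w = sin w := by
  simpa [csinc] using sub_smul_dslope sin 0 w

theorem differentiable_csinc : Differentiable ℂ csinc := by
  have := (Complex.differentiableOn_dslope (f := sin) (c := 0) univ_mem).2
    differentiable_sin.differentiableOn
  exact differentiableOn_univ.1 this

theorem analyticAt_csinc (w : ℂ) : AnalyticAt ℂ csinc w := differentiable_csinc.analyticAt w

/-- A positive factor does not change the principal argument. The factor 0, which occurs for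
coinciding points, is the reason for requiring p > 0. -/
theorem ofReal_mul_cpow {r p : ℝ} (hr : 0 ≤ r) (hp : 0 < p) (w : ℂ) :
    ((r : ℂ) * w) ^ (p : ℂ) = (r ^ p : ℝ) * w ^ (p : ℂ) := by
  have hp' : (p : ℂ) ≠ 0 := by exact_mod_cast hp.ne'
  rcases hr.eq_or_lt with rfl | hr'
  · simp [hp', Real.zero_rpow hp.ne']
  by_cases hw : w = 0
  · simp [hw, hp']
  have hr0 : (r : ℂ) ≠ 0 := by exact_mod_cast hr'.ne'
  rw [cpow_def_of_ne_zero (mul_ne_zero hr0 hw), cpow_def_of_ne_zero hw, log_ofReal_mul hr' hw,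
    add_mul, exp_add, ofReal_cpow hr, cpow_def_of_ne_zero hr0, ofReal_log hr]

/-- A path that is straight near two saddle points of `P`, the first of which has the label `true`;
`ζ' (ψ s) μ s` is the direction `lam s` of steepest descent. -/
structure IsSaddlePair (P Γ : ℂ → ℂ) (ζ ζ' : ℝ → ℂ) (ψ μ : Bool → ℝ) (lam : Bool → ℂ) (η : ℝ) :
    Prop where
  mu_pos : ∀ s, 0 < μ s
  lam_re : ∀ s, 0 < (lam s).re
  eta_pos : 0 < η
  psi_pos : 0 < ψ true
  psi_lt : ψ true < ψ false
  psi_lt_two_pi : ψ false < 2 * Real.pi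
  re : ∀ s, (ζ (ψ s)).re = ψ s
  mem_arc : ∀ s t, |t - ψ s| ≤ η → t ∈ arc
  sep : 2 * η < ψ false - ψ true
  path : ∀ s t, |t - ψ s| ≤ η → ζ t = ζ (ψ s) + lam s * ((t - ψ s) / μ s : ℝ) ∧ μ s * ζ' t = lam s
  analytic : ∀ s, AnalyticAt ℂ P (ζ (ψ s))
  crit : ∀ s, deriv P (ζ (ψ s)) = 0
  two : ∀ s, iteratedDeriv 2 P (ζ (ψ s)) / 2 * lam s ^ 2 = -1
  amp : ∀ s, AnalyticAt ℂ Γ (ζ (ψ s))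

variable {P Γ : ℂ → ℂ} {ζ ζ' : ℝ → ℂ} {ψ μ : Bool → ℝ} {lam : Bool → ℂ} {η : ℝ}

/-- The pair factor near the two saddle points, divided by `|x_j - x_k|^p` for equal labels. -/
def pairAmp (p : ℝ) (m : ℕ) {l : ℕ} (z lam : Bool → ℂ) (j k : Fin l) (x : Fin l → ℝ) : ℂ :=
  if lab m j = lab m k then
    (lam (lab m j) * csinc (lam (lab m j) * (x k - x j) / 2)) ^ (p : ℂ)
  else (2 * sin ((z (lab m k) + lam (lab m k) * x k - (z (lab m j) + lam (lab m j) * x j)) / 2)) ^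
    (p : ℂ)

/-- The amplitude of the integrand near the saddle points. -/
def amplitude (p : ℝ) (m : ℕ) {l : ℕ} (Γ : ℂ → ℂ) (z lam : Bool → ℂ) (x : Fin l → ℝ) : ℂ :=
  (∏ j, Γ (z (lab m j) + lam (lab m j) * x j) * lam (lab m j)) *
    ∏ j, ∏ k ∈ Finset.Ioi j, pairAmp p m z lam j k x

theorem IsSaddlePair.cross_mem (h : IsSaddlePair P Γ ζ ζ' ψ μ lam η) :
    2 * sin ((ζ (ψ false) - ζ (ψ true)) / 2) ∈ slitPlane := by
  refine Or.inl ?_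
  have h1 := h.re true
  have h2 := h.re false
  have h3 := h.psi_lt
  have h4 := h.psi_pos
  have h5 := h.psi_lt_two_pi
  have := re_sin_pos (w := (ζ (ψ false) - ζ (ψ true)) / 2) (by simp [h1, h2, h3])
    (by simp [h1, h2]; linarith)
  simpa using this

/-- At the origin every base lies in the slit plane: for equal labels it is the direction `lam`, of
positive real part, and for different labels it is the chord between the saddle points
(`cross_mem`). -/
theorem IsSaddlePair.analyticAt_amplitude (h : IsSaddlePair P Γ ζ ζ' ψ μ lam η) (p : ℝ) (m : ℕ)
    {l : ℕ} : AnalyticAt ℝ (amplitude p m (l := l) Γ (fun s => ζ (ψ s)) lam) 0 := by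
  have hx : ∀ j : Fin l, AnalyticAt ℝ (fun x : Fin l → ℝ => (x j : ℂ)) 0 := fun j =>
    (ofRealCLM.comp (ContinuousLinearMap.proj (R := ℝ) (φ := fun _ : Fin l => ℝ) j)).analyticAt 0
  unfold amplitude
  refine (Finset.analyticAt_fun_prod _ fun j _ => ?_).mul (Finset.analyticAt_fun_prod _ fun j _ =>
    Finset.analyticAt_fun_prod _ fun k hk => ?_)
  · refine AnalyticAt.mul ?_ analyticAt_const
    have h1 : AnalyticAt ℝ (fun x : Fin l → ℝ => ζ (ψ (lab m j)) + lam (lab m j) * x j) 0 :=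
      analyticAt_const.add (analyticAt_const.mul (hx j))
    exact AnalyticAt.fun_comp (by simpa using (h.amp (lab m j)).restrictScalars) h1
  · unfold pairAmp
    split_ifs with hs
    · have h1 : AnalyticAt ℝ (fun x : Fin l → ℝ => lam (lab m j) * (x k - x j) / 2) 0 :=
        (analyticAt_const.mul ((hx k).sub (hx j))).div_const
      refine AnalyticAt.fun_comp (g := fun w => (lam (lab m j) * csinc w) ^ (p : ℂ)) ?_ h1
      refine AnalyticAt.restrictScalars (𝕜 := ℝ) (𝕜' := ℂ) ?_
      simp only [Pi.zero_apply, ofReal_zero, sub_zero, mul_zero, zero_div]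
      refine (analyticAt_const.mul (analyticAt_csinc 0)).cpow analyticAt_const ?_
      rw [Pi.mul_apply, csinc_zero, mul_one]
      exact Or.inl (h.lam_re _)
    · obtain ⟨h1, h2⟩ := lab_of_lt (Finset.mem_Ioi.1 hk) hs
      rw [h1, h2]
      have h3 : AnalyticAt ℝ (fun x : Fin l → ℝ => (ζ (ψ false) + lam false * x k -
          (ζ (ψ true) + lam true * x j)) / 2) 0 :=
        ((analyticAt_const.add (analyticAt_const.mul (hx k))).sub
          (analyticAt_const.add (analyticAt_const.mul (hx j)))).div_const
      refine AnalyticAt.fun_comp (g := fun w => (2 * sin w) ^ (p : ℂ)) ?_ h3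
      refine AnalyticAt.restrictScalars (𝕜 := ℝ) (𝕜' := ℂ) ?_
      simp only [Pi.zero_apply, ofReal_zero, mul_zero, add_zero]
      refine (analyticAt_const.mul (differentiable_sin.analyticAt _)).cpow analyticAt_const ?_
      exact h.cross_mem

theorem amplitude_zero (p : ℝ) (m n : ℕ) (Γ : ℂ → ℂ) (z lam : Bool → ℂ) :
    amplitude p m (l := m + n) Γ z lam 0 =
      (Γ (z true) * lam true) ^ m * (Γ (z false) * lam false) ^ n *
        ((lam true ^ (p : ℂ)) ^ m.choose 2 * (lam false ^ (p : ℂ)) ^ n.choose 2 *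
          ((2 * sin ((z false - z true) / 2)) ^ (p : ℂ)) ^ (m * n)) := by
  rw [amplitude, prod_pairs_append, Fin.prod_univ_add]
  simp only [pairAmp, lab_castAdd, lab_natAdd, if_true, Pi.zero_apply, ofReal_zero, sub_zero,
    mul_zero, zero_div, csinc_zero, mul_one, prod_pairs_const, add_zero, Bool.true_eq_false,
    if_false]
  simp only [Finset.prod_const, Finset.card_univ, Fintype.card_fin, ← pow_mul]
  ring

/-- With the normalisation by `lam` the quadratic term is exactly -x²; the cubic term is odd, hence
absent from the even part. -/
theorem exists_local_phase_bound {P : ℂ → ℂ} {z₀ lam : ℂ} (hP : AnalyticAt ℂ P z₀)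
    (h1 : deriv P z₀ = 0) (h2 : iteratedDeriv 2 P z₀ / 2 * lam ^ 2 = -1) :
    ∃ C r : ℝ, 0 ≤ C ∧ 0 < r ∧
      (ContinuousOn (fun x : ℝ => P (z₀ + lam * x) - P z₀ + x ^ 2) {x | |x| < r}) ∧
      ∀ x : ℝ, |x| < r → ‖P (z₀ + lam * x) - P z₀ + x ^ 2‖ ≤ C * |x| ^ 3 ∧
        ‖(P (z₀ + lam * x) - P z₀ + x ^ 2) + (P (z₀ + lam * (-x : ℝ)) - P z₀ + (-x : ℝ) ^ 2)‖ ≤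
          C * |x| ^ 4 := by
  obtain ⟨K, r, p₃, hK, hr, hT⟩ := exists_taylor_bound hP h1
  obtain ⟨r', hr', hball⟩ := Metric.eventually_nhds_iff_ball.1 hP.eventually_analyticAt
  set ρ := min 1 (min r r' / (‖lam‖ + 1)) with hρ
  have hm : 0 < min r r' := lt_min hr hr'
  have hw : ∀ x : ℝ, |x| < ρ → ‖lam * x‖ < min r r' := fun x hx => by
    have : |x| < min r r' / (‖lam‖ + 1) := hx.trans_le (min_le_right _ _)
    rw [lt_div_iff₀ (by positivity)] at this
    rw [norm_mul, norm_real, Real.norm_eq_abs]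
    nlinarith [abs_nonneg x]
  refine ⟨‖p₃‖ * ‖lam‖ ^ 3 + 2 * (K * ‖lam‖ ^ 4), ρ, by positivity, lt_min one_pos (by positivity),
    fun x hx => ?_, fun x hx => ?_⟩
  · have : ContinuousAt P (z₀ + lam * x) := (hball _ (by
      simpa [-norm_mul] using (hw x hx).trans_le (min_le_right _ _))).continuousAt
    have h3 : ContinuousAt (fun x : ℝ => P (z₀ + lam * x)) x :=
      ContinuousAt.comp' (f := fun x : ℝ => z₀ + lam * x) this (by fun_prop)
    exact ((h3.sub continuousAt_const).add (by fun_prop)).continuousWithinAt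
  · have key : ∀ y : ℝ, |y| < ρ → ‖(P (z₀ + lam * y) - P z₀ + y ^ 2) - p₃ * (lam * y) ^ 3‖ ≤
        K * ‖lam‖ ^ 4 * |y| ^ 4 := fun y hy => by
      have := hT (lam * y) ((hw y hy).trans_le (min_le_left _ _))
      rw [mul_pow lam _ 2, ← mul_assoc, h2, norm_mul lam, norm_real, Real.norm_eq_abs] at this
      calc _ = ‖P (z₀ + lam * y) - P z₀ - -1 * (y : ℂ) ^ 2 - p₃ * (lam * y) ^ 3‖ := by
            congr 1; ring
        _ ≤ K * (‖lam‖ * |y|) ^ 4 := this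
        _ = _ := by ring
    have k1 := key x hx
    have k2 := key (-x) (by rwa [abs_neg])
    have hx1 : |x| ≤ 1 := (hx.trans_le (min_le_left _ _)).le
    rw [abs_neg] at k2
    constructor
    · have e : P (z₀ + lam * x) - P z₀ + x ^ 2 =
          ((P (z₀ + lam * x) - P z₀ + x ^ 2) - p₃ * (lam * x) ^ 3) + p₃ * (lam * x) ^ 3 := by ring
      rw [e]
      refine (norm_add_le _ _).trans ?_
      rw [norm_mul, norm_pow, norm_mul, norm_real, Real.norm_eq_abs]
      have : |x| ^ 4 ≤ |x| ^ 3 := pow_le_pow_of_le_one (abs_nonneg _) hx1 (by norm_num)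
      have : K * ‖lam‖ ^ 4 * |x| ^ 4 ≤ K * ‖lam‖ ^ 4 * |x| ^ 3 := by gcongr
      have : 0 ≤ K * ‖lam‖ ^ 4 * |x| ^ 3 := by positivity
      nlinarith
    · have e : (P (z₀ + lam * x) - P z₀ + x ^ 2) +
          (P (z₀ + lam * (-x : ℝ)) - P z₀ + (-x : ℝ) ^ 2) =
          ((P (z₀ + lam * x) - P z₀ + x ^ 2) - p₃ * (lam * x) ^ 3) +
          ((P (z₀ + lam * (-x : ℝ)) - P z₀ + (-x : ℝ) ^ 2) - p₃ * (lam * (-x : ℝ)) ^ 3) := by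
        push_cast; ring
      rw [e]
      refine (norm_add_le _ _).trans ?_
      have : 0 ≤ ‖p₃‖ * ‖lam‖ ^ 3 * |x| ^ 4 := by positivity
      linarith

end Amplitude

/-! ### The contribution of one distribution of the variables among the saddle points. -/

section Box

variable {P Γ : ℂ → ℂ} {ζ ζ' : ℝ → ℂ} {ψ μ : Bool → ℝ} {lam : Bool → ℂ} {η : ℝ}

namespace IsSaddlePair

theorem path_add (h : IsSaddlePair P Γ ζ ζ' ψ μ lam η) {s : Bool} {x r : ℝ} (hx : |x| < r)
    (hr : μ s * r ≤ η) :
    ψ s + μ s * x ∈ arc ∧ ζ (ψ s + μ s * x) = ζ (ψ s) + lam s * x ∧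
      μ s * ζ' (ψ s + μ s * x) = lam s ∧ |μ s * x| < η := by
  have hμ := h.mu_pos s
  have h1 : |ψ s + μ s * x - ψ s| < η := by
    rw [add_sub_cancel_left, abs_mul, abs_of_pos hμ]
    exact (mul_lt_mul_of_pos_left hx hμ).trans_le hr
  obtain ⟨h2, h3⟩ := h.path s _ h1.le
  rw [add_sub_cancel_left] at h1 h2
  rw [mul_div_cancel_left₀ _ hμ.ne'] at h2
  exact ⟨h.mem_arc s _ (by rw [add_sub_cancel_left]; exact h1.le), h2, h3, h1⟩

/-- For equal labels sin w = w csinc w, and the sign in `pairDist` turns x_k - x_j into its absolute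
value. For different labels the first variable is at the first saddle point, since the label `true`
comes first and the two parameter intervals are separated. -/
theorem pairDist_cpow (h : IsSaddlePair P Γ ζ ζ' ψ μ lam η) {p : ℝ} (hp : 0 < p) {m l : ℕ} {r : ℝ}
    (hr : ∀ s, μ s * r ≤ η) {x : Fin l → ℝ} (hx : ∀ j, |x j| < r) {j k : Fin l} (hjk : j < k) :
    pairDist ζ (ψ (lab m j) + μ (lab m j) * x j) (ψ (lab m k) + μ (lab m k) * x k) ^ (p : ℂ) =
      (if lab m j = lab m k then |x k - x j| ^ p else 1 : ℝ) *
        pairAmp p m (fun s => ζ (ψ s)) lam j k x := by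
  obtain ⟨-, hj, -, hj'⟩ := h.path_add (hx j) (hr (lab m j))
  obtain ⟨-, hk, -, hk'⟩ := h.path_add (hx k) (hr (lab m k))
  rw [pairAmp]
  split_ifs with hs
  · rw [← ofReal_mul_cpow (abs_nonneg _) hp, pairDist, hj, hk, ← hs]
    congr 1
    have hμ := h.mu_pos (lab m j)
    have e1 : Real.sign (ψ (lab m j) + μ (lab m j) * x k - (ψ (lab m j) + μ (lab m j) * x j)) *
        (x k - x j) = |x k - x j| := by
      rw [show ψ (lab m j) + μ (lab m j) * x k - (ψ (lab m j) + μ (lab m j) * x j) =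
        μ (lab m j) * (x k - x j) by ring]
      rcases lt_trichotomy (x k - x j) 0 with h0 | h0 | h0
      · rw [Real.sign_of_neg (mul_neg_of_pos_of_neg hμ h0), abs_of_neg h0]; ring
      · simp [h0]
      · rw [Real.sign_of_pos (mul_pos hμ h0), abs_of_pos h0]; ring
    rw [← e1, show (ζ (ψ (lab m j)) + lam (lab m j) * x k - (ζ (ψ (lab m j)) +
      lam (lab m j) * x j)) / 2 = lam (lab m j) * (x k - x j) / 2 by ring, ← mul_csinc]
    push_cast
    ring
  · obtain ⟨h1, h2⟩ := lab_of_lt hjk hs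
    rw [ofReal_one, one_mul, pairDist_of_lt, hj, hk]
    rw [h1] at hj' ⊢
    rw [h2] at hk' ⊢
    have := h.sep
    rw [abs_lt] at hj' hk'
    linarith [hj'.2, hk'.1]

/-- After the affine substitution t = ψ + μ x the straight path has constant derivative, and the
integrand takes the form needed in `exists_laplace_bound`. -/
theorem integrand_eq (h : IsSaddlePair P Γ ζ ζ' ψ μ lam η) {p : ℝ} (hp : 0 < p) {m n : ℕ} {r : ℝ}
    (hr : ∀ s, μ s * r ≤ η) {N : ℕ} {A : ℂ → ℂ}
    (hA : ∀ t ∈ arc, A (ζ t) = exp (N * P (ζ t)) * Γ (ζ t)) {x : Fin (m + n) → ℝ}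
    (hx : ∀ j, |x j| < r) :
    (∏ j : Fin (m + n), (μ (lab m j) : ℂ)) * ((∏ j, A (ζ (ψ (lab m j) + μ (lab m j) * x j)) *
      ζ' (ψ (lab m j) + μ (lab m j) * x j)) *
        interaction p ζ fun j => ψ (lab m j) + μ (lab m j) * x j) =
      exp (N * (m * P (ζ (ψ true)) + n * P (ζ (ψ false)))) *
        (((Real.exp (-N * ∑ i, x i ^ 2) * clusterProduct p m n x : ℝ) : ℂ) *
          (exp (N * ∑ j, (P (ζ (ψ (lab m j)) + lam (lab m j) * x j) - P (ζ (ψ (lab m j))) +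
            x j ^ 2)) * amplitude p m Γ (fun s => ζ (ψ s)) lam x)) := by
  have e1 : interaction p ζ (fun j => ψ (lab m j) + μ (lab m j) * x j) =
      clusterProduct p m n x * ∏ j, ∏ k ∈ Finset.Ioi j,
        pairAmp p m (fun s => ζ (ψ s)) lam j k x := by
    rw [clusterProduct, ofReal_prod, interaction, ← Finset.prod_mul_distrib]
    refine Finset.prod_congr rfl fun j _ => ?_
    rw [ofReal_prod, ← Finset.prod_mul_distrib]
    exact Finset.prod_congr rfl fun k hk => h.pairDist_cpow hp hr hx (Finset.mem_Ioi.1 hk)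
  have e2 : (∏ j : Fin (m + n), (μ (lab m j) : ℂ)) * (∏ j, A (ζ (ψ (lab m j) + μ (lab m j) * x j)) *
      ζ' (ψ (lab m j) + μ (lab m j) * x j)) =
      (∏ j, exp (N * P (ζ (ψ (lab m j)) + lam (lab m j) * x j))) *
        ∏ j, Γ (ζ (ψ (lab m j)) + lam (lab m j) * x j) * lam (lab m j) := by
    rw [← Finset.prod_mul_distrib, ← Finset.prod_mul_distrib]
    refine Finset.prod_congr rfl fun j _ => ?_
    obtain ⟨ha, hj, hj', -⟩ := h.path_add (hx j) (hr (lab m j))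
    rw [hA _ ha, hj]
    linear_combination (exp (N * P (ζ (ψ (lab m j)) + lam (lab m j) * x j)) *
      Γ (ζ (ψ (lab m j)) + lam (lab m j) * x j)) * hj'
  have e3 : ∏ j, exp (N * P (ζ (ψ (lab m j)) + lam (lab m j) * x j)) =
      exp (N * (m * P (ζ (ψ true)) + n * P (ζ (ψ false)))) * (exp (-N * ∑ i, (x i : ℂ) ^ 2) *
        exp (N * ∑ j, (P (ζ (ψ (lab m j)) + lam (lab m j) * x j) - P (ζ (ψ (lab m j))) +
            x j ^ 2))) := by
    have e4 : (m * P (ζ (ψ true)) + n * P (ζ (ψ false))) =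
        ∑ j : Fin (m + n), P (ζ (ψ (lab m j))) := by
      simp [Fin.sum_univ_add]
    rw [e4, ← exp_sum, ← exp_add, ← exp_add, Finset.sum_add_distrib, Finset.sum_sub_distrib,
      ← Finset.mul_sum]
    congr 1
    ring
  rw [← mul_assoc, e2, e1, e3, amplitude]
  push_cast
  ring

end IsSaddlePair

theorem image_ball_eq (a : ℝ) {b r : ℝ} (hb : 0 < b) :
    (fun x => a + b * x) '' Metric.ball 0 r = Metric.ball a (b * r) := by
  ext t
  simp only [Set.mem_image, Metric.mem_ball, Real.dist_eq, sub_zero]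
  constructor
  · rintro ⟨x, hx, rfl⟩
    rw [add_sub_cancel_left, abs_mul, abs_of_pos hb]
    gcongr
  · intro ht
    refine ⟨(t - a) / b, ?_, by field_simp; ring⟩
    rw [abs_div, abs_of_pos hb, div_lt_iff₀ hb]
    linarith

/-- The contribution of a neighbourhood of `(u_+, …, u_+, u_-, …, u_-)`. -/
theorem IsSaddlePair.exists_box_bound (h : IsSaddlePair P Γ ζ ζ' ψ μ lam η) {p : ℝ} (hp : 0 < p)
    (m n : ℕ) :
    ∃ r₁ > 0, ∀ r, 0 < r → r ≤ r₁ → ∃ K, ∀ (N : ℕ) (A : ℂ → ℂ), 0 < N →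
      (∀ t ∈ arc, A (ζ t) = exp (N * P (ζ t)) * Γ (ζ t)) →
      ‖(∫ t in Set.univ.pi fun j : Fin (m + n) => Metric.ball (ψ (lab m j)) (μ (lab m j) * r),
          (∏ j, A (ζ (t j)) * ζ' (t j)) * interaction p ζ t) -
        exp (N * (m * P (ζ (ψ true)) + n * P (ζ (ψ false)))) *
          (amplitude p m (l := m + n) Γ (fun s => ζ (ψ s)) lam 0 *
            ((N : ℝ) ^ (-(((m + n : ℕ) + clusterDegree p m n) / 2)) *
              ∫ x, Real.exp (-∑ i, x i ^ 2) * clusterProduct p m n x : ℝ))‖ ≤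
        ‖exp (N * (m * P (ζ (ψ true)) + n * P (ζ (ψ false))))‖ *
          (K * (N : ℝ) ^ (-(((m + n : ℕ) + clusterDegree p m n) / 2)) / N) := by
  obtain ⟨C₁, ρ₁, hC₁, hρ₁, hc₁, hq₁, hq₂⟩ :=
    exists_analytic_bounds (h.analyticAt_amplitude p m (l := m + n))
  choose C₂ ρ₂ hC₂ hρ₂ hc₂ hb₂ using fun s =>
    exists_local_phase_bound (h.analytic s) (h.crit s) (h.two s)
  set C := C₁ + (m + n : ℕ) * (C₂ true + C₂ false) with hC
  have hC0 : 0 ≤ C := by have := hC₂ true; have := hC₂ false; positivity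
  have hC₁C : C₁ ≤ C := by have := hC₂ true; have := hC₂ false; simp only [hC]; nlinarith
  have hC₂s : ∀ s, C₂ s ≤ C₂ true + C₂ false := by
    have := hC₂ true; have := hC₂ false
    rintro (_ | _) <;> linarith
  have hC₂C : (m + n : ℕ) * (C₂ true + C₂ false) ≤ C := by simp only [hC]; linarith
  -- Within the radii of the Taylor bounds of amplitude and phases, within the straight parts of the
  -- path, and with C‖x‖ ≤ 1/2, so that the cubic bound implies the bound ‖x‖²/2.
  set r₁ := min (min ρ₁ (min (ρ₂ true) (ρ₂ false))) (min (min (η / μ true) (η / μ false))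
    (1 / (2 * (C + 1)))) with hr₁
  have hη := h.eta_pos
  have hr₁ρ : ∀ s, r₁ ≤ ρ₂ s := by
    have h1 : r₁ ≤ min (ρ₂ true) (ρ₂ false) := (min_le_left _ _).trans (min_le_right _ _)
    rintro (_ | _)
    exacts [h1.trans (min_le_right _ _), h1.trans (min_le_left _ _)]
  have hr₁η : ∀ s, r₁ ≤ η / μ s := by
    have h1 : r₁ ≤ min (η / μ true) (η / μ false) := (min_le_right _ _).trans (min_le_left _ _)
    rintro (_ | _)
    exacts [h1.trans (min_le_right _ _), h1.trans (min_le_left _ _)]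
  refine ⟨r₁, lt_min (lt_min hρ₁ (lt_min (hρ₂ _) (hρ₂ _))) (lt_min (lt_min
    (div_pos hη (h.mu_pos _)) (div_pos hη (h.mu_pos _))) (by positivity)), fun r hr0 hrr => ?_⟩
  have hrη : ∀ s, μ s * r ≤ η := fun s => by
    have := hrr.trans (hr₁η s)
    rw [le_div_iff₀ (h.mu_pos s)] at this
    linarith
  set hh : (Fin (m + n) → ℝ) → ℂ := fun x => ∑ j, (P (ζ (ψ (lab m j)) + lam (lab m j) * x j) -
    P (ζ (ψ (lab m j))) + x j ^ 2) with hhdef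
  have hmem : ∀ x ∈ Metric.ball (0 : Fin (m + n) → ℝ) r, ∀ j, |x j| < r := fun x hx j =>
    (norm_le_pi_norm x j).trans_lt (by simpa using hx)
  have hcoord : ∀ (x : Fin (m + n) → ℝ) j, |x j| ≤ ‖x‖ := fun x j => norm_le_pi_norm x j
  have hh3 : ∀ x ∈ Metric.ball (0 : Fin (m + n) → ℝ) r, ‖hh x‖ ≤ C * ‖x‖ ^ 3 := fun x hx => by
    refine (norm_sum_le _ _).trans ?_
    calc _ ≤ ∑ _j : Fin (m + n), (C₂ true + C₂ false) * ‖x‖ ^ 3 := by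
          refine Finset.sum_le_sum fun j _ => ?_
          refine (hb₂ (lab m j) (x j) ((hmem x hx j).trans_le (hrr.trans (hr₁ρ _)))).1.trans ?_
          have := hC₂ true; have := hC₂ false
          gcongr
          exacts [hC₂s _, hcoord x j]
      _ = (m + n : ℕ) * (C₂ true + C₂ false) * ‖x‖ ^ 3 := by simp [mul_assoc]
      _ ≤ _ := by gcongr
  have hh4 : ∀ x ∈ Metric.ball (0 : Fin (m + n) → ℝ) r, ‖hh x + hh (-x)‖ ≤ C * ‖x‖ ^ 4 :=
    fun x hx => by
    rw [hhdef, ← Finset.sum_add_distrib]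
    refine (norm_sum_le _ _).trans ?_
    calc _ ≤ ∑ _j : Fin (m + n), (C₂ true + C₂ false) * ‖x‖ ^ 4 := by
          refine Finset.sum_le_sum fun j _ => ?_
          refine (hb₂ (lab m j) (x j) ((hmem x hx j).trans_le (hrr.trans (hr₁ρ _)))).2.trans ?_
          have := hC₂ true; have := hC₂ false
          gcongr
          exacts [hC₂s _, hcoord x j]
      _ = (m + n : ℕ) * (C₂ true + C₂ false) * ‖x‖ ^ 4 := by simp [mul_assoc]
      _ ≤ _ := by gcongr
  have hh2 : ∀ x ∈ Metric.ball (0 : Fin (m + n) → ℝ) r, ‖hh x‖ ≤ ‖x‖ ^ 2 / 2 := fun x hx => by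
    have h1 : ‖x‖ ≤ 1 / (2 * (C + 1)) :=
      (by simpa using hx : ‖x‖ < r).le.trans (hrr.trans ((min_le_right _ _).trans (min_le_right _ _)))
    rw [le_div_iff₀ (by positivity)] at h1
    have h2 : C * ‖x‖ ≤ 1 / 2 := by nlinarith [norm_nonneg x]
    calc _ ≤ C * ‖x‖ ^ 3 := hh3 x hx
      _ = (C * ‖x‖) * ‖x‖ ^ 2 := by ring
      _ ≤ 1 / 2 * ‖x‖ ^ 2 := by gcongr
      _ = _ := by ring
  have hhc : ContinuousOn hh (Metric.ball 0 r) := by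
    refine continuousOn_finsetSum _ fun j _ => ?_
    exact (hc₂ (lab m j)).comp (continuous_apply j).continuousOn fun x hx =>
      (hmem x hx j).trans_le (hrr.trans (hr₁ρ _))
  have hrρ₁ : Metric.ball (0 : Fin (m + n) → ℝ) r ⊆ Metric.ball 0 ρ₁ :=
    Metric.ball_subset_ball (hrr.trans ((min_le_left _ _).trans (min_le_left _ _)))
  obtain ⟨K, hK⟩ := exists_laplace_bound (clusterDegree_nonneg hp.le)
    (measurable_clusterProduct (p := p) (m := m) (n := n)) clusterProduct_nonneg clusterProduct_neg
    (fun c hc x => clusterProduct_smul hc x) (clusterProduct_le hp.le)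
    Metric.isOpen_ball.measurableSet (fun x hx => by simpa using hx) hr0 subset_rfl hhc
    (hc₁.mono hrρ₁) hC0 hh3 hh2 hh4
    (fun x hx => (hq₁ x (hrρ₁ hx)).trans (by gcongr))
    (fun x hx => (hq₂ x (hrρ₁ hx)).trans (by gcongr))
  refine ⟨K, fun N A hN hA => ?_⟩
  have hint : (∫ t in Set.univ.pi fun j : Fin (m + n) =>
        Metric.ball (ψ (lab m j)) (μ (lab m j) * r),
      (∏ j, A (ζ (t j)) * ζ' (t j)) * interaction p ζ t) =
      exp (N * (m * P (ζ (ψ true)) + n * P (ζ (ψ false)))) *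
        ∫ x in Metric.ball (0 : Fin (m + n) → ℝ) r,
          (((Real.exp (-N * ∑ i, x i ^ 2) * clusterProduct p m n x : ℝ) : ℂ) *
          (exp (N * hh x) * amplitude p m Γ (fun s => ζ (ψ s)) lam x)) := by
    have h1 : ∀ j : Fin (m + n), Metric.ball (ψ (lab m j)) (μ (lab m j) * r) =
        (fun x => ψ (lab m j) + μ (lab m j) * x) '' Metric.ball 0 r := fun j =>
      (image_ball_eq _ (h.mu_pos _)).symm
    have hd : ∀ (j : Fin (m + n)) (x : ℝ), HasDerivWithinAt
        (fun x => ψ (lab m j) + μ (lab m j) * x) (μ (lab m j)) (Metric.ball 0 r) x := fun j x => by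
      have := ((hasDerivAt_id x).const_mul (μ (lab m j))).const_add (ψ (lab m j))
      rw [mul_one] at this
      exact this.hasDerivWithinAt
    simp_rw [h1]
    rw [setIntegral_pi_image (φ := fun j x => ψ (lab m j) + μ (lab m j) * x)
      (φ' := fun j _ => μ (lab m j)) (fun _ => Metric.isOpen_ball.measurableSet)
      (fun j x _ => hd j x)
      (fun j => fun x _ y _ hxy => by simpa [(h.mu_pos _).ne'] using hxy), ball_pi _ hr0]
    rw [← integral_const_mul]
    refine setIntegral_congr_fun (MeasurableSet.univ_pi fun _ => Metric.isOpen_ball.measurableSet)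
      fun x hx => ?_
    have hx' : ∀ j, |x j| < r := fun j => by simpa using hx j trivial
    refine Eq.trans ?_ (h.integrand_eq hp hrη hA hx')
    simp only [abs_of_pos (h.mu_pos _), real_smul, ofReal_prod]
  rw [hint, ← mul_sub, norm_mul]
  exact mul_le_mul_of_nonneg_left (hK N hN) (norm_nonneg _)

end Box

/-! ### Splitting the cube of parameters into boxes. -/

section Decomposition

theorem prod_pairs_comp_equiv {R : Type*} [CommRing R] {l l' : ℕ} (e : Fin l' ≃ Fin l)
    {f : Fin l → Fin l → R} (hf : ∀ i j, f i j = f j i) :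
    ∏ i, ∏ j ∈ Finset.Ioi i, f (e i) (e j) = ∏ i, ∏ j ∈ Finset.Ioi i, f i j := by
  obtain rfl : l' = l := by simpa using Fintype.card_congr e
  -- An antisymmetric sign, equal to 1 on the pairs i < j. Permuting the products of a and of a f
  -- yields the sign of the permutation twice, and the two signs cancel.
  let a : Fin l' → Fin l' → R := fun i j => if i < j then 1 else if j < i then -1 else 0
  have ha : ∀ i j, a i j = -a j i := fun i j => by
    simp only [a]
    rcases lt_trichotomy i j with h | h | h
    · simp [h, h.not_gt]
    · simp [h]
    · simp [h, h.not_gt]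
  have h1 := Equiv.Perm.prod_Ioi_comp_eq_sign_mul_prod e ha
  have h2 := Equiv.Perm.prod_Ioi_comp_eq_sign_mul_prod e (f := fun i j => a i j * f i j)
    (fun i j => by rw [ha, hf]; ring)
  have h3 : ∏ i, ∏ j ∈ Finset.Ioi i, a i j = 1 :=
    Finset.prod_eq_one fun i _ => Finset.prod_eq_one fun j hj => by
      simp [a, Finset.mem_Ioi.1 hj]
  have h4 : ∏ i, ∏ j ∈ Finset.Ioi i, a i j * f i j = ∏ i, ∏ j ∈ Finset.Ioi i, f i j :=
    Finset.prod_congr rfl fun i _ => Finset.prod_congr rfl fun j hj => by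
      simp [a, Finset.mem_Ioi.1 hj]
  rw [h3, mul_one] at h1
  rw [h4] at h2
  simp only [Finset.prod_mul_distrib] at h2
  rw [h1] at h2
  have hs : ((Equiv.Perm.sign e : ℤ) : R) * ((Equiv.Perm.sign e : ℤ) : R) = 1 := by
    rw [← Int.cast_mul, Int.units_coe_mul_self, Int.cast_one]
  calc _ = ((Equiv.Perm.sign e : ℤ) : R) * ((Equiv.Perm.sign e : ℤ) *
        ∏ i, ∏ j ∈ Finset.Ioi i, f (e i) (e j)) := by rw [← mul_assoc, hs, one_mul]
    _ = _ := by rw [h2, ← mul_assoc, hs, one_mul]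

/-- The integrand of `contourIntegral`. -/
def contourIntegrand (p : ℝ) (A : ℂ → ℂ) (z z' : ℝ → ℂ) {n : ℕ} (t : Fin n → ℝ) : ℂ :=
  (∏ j, A (z (t j)) * z' (t j)) * interaction p z t

variable {p : ℝ} {A : ℂ → ℂ} {z z' : ℝ → ℂ}

theorem contourIntegrand_comp_equiv {l l' : ℕ} (e : Fin l' ≃ Fin l) (t : Fin l → ℝ) :
    contourIntegrand p A z z' (fun j => t (e j)) = contourIntegrand p A z z' t := by
  rw [contourIntegrand, contourIntegrand, interaction, interaction,
    prod_pairs_comp_equiv e (f := fun i j => pairDist z (t i) (t j) ^ (p : ℂ))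
      (fun i j => by rw [pairDist_comm]),
    Equiv.prod_comp e fun j => A (z (t j)) * z' (t j)]

theorem measurable_contourIntegrand (hA : Measurable A) (hz : Measurable z) (hz' : Measurable z')
    {n : ℕ} : Measurable (contourIntegrand p A z z' (n := n)) := by
  have := measurable_interaction p hz (n := n)
  unfold contourIntegrand
  fun_prop

theorem setIntegral_box_eq (U : Bool → Set ℝ) {l m n : ℕ} {T : Finset (Fin l)} (hm : T.card = m)
    (hn : Tᶜ.card = n) :
    ∫ t in Set.univ.pi fun j => U (decide (j ∈ T)), contourIntegrand p A z z' t =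
      ∫ t in Set.univ.pi fun j : Fin (m + n) => U (lab m j), contourIntegrand p A z z' t := by
  -- Lists the elements of T first and those of its complement afterwards, in agreement with `lab`.
  set e : Fin (m + n) ≃ Fin l := finSumFinEquiv.symm.trans (finSumEquivOfFinset hm hn) with he
  have hlab : ∀ j, decide (e j ∈ T) = lab m j := fun j => by
    refine Fin.addCases (fun i => ?_) (fun i => ?_) j
    · simp [he]
    · have := Finset.orderEmbOfFin_mem Tᶜ hn i
      rw [Finset.mem_compl] at this
      simp [he, this]
  have hmp := volume_measurePreserving_piCongrLeft (fun _ : Fin l => ℝ) e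
  have hval : ∀ (t : Fin (m + n) → ℝ) j,
      MeasurableEquiv.piCongrLeft (fun _ : Fin l => ℝ) e t (e j) = t j := fun t j =>
    Equiv.piCongrLeft_apply_apply (fun _ : Fin l => ℝ) e t j
  rw [← hmp.setIntegral_preimage_emb (MeasurableEquiv.measurableEmbedding _)]
  have hpre : (MeasurableEquiv.piCongrLeft (fun _ : Fin l => ℝ) e) ⁻¹'
      (Set.univ.pi fun j => U (decide (j ∈ T))) =
      Set.univ.pi fun j : Fin (m + n) => U (lab m j) := by
    ext t
    simp only [Set.mem_preimage, Set.mem_univ_pi]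
    rw [← e.forall_congr_right]
    simp only [hval, hlab]
  rw [hpre]
  congr 1
  ext t
  rw [← contourIntegrand_comp_equiv e]
  simp only [hval]

/-- The subset T of variables in `U true` indexes disjoint boxes; by symmetry of the integrand only
the cardinality of T matters, which gives the binomial coefficients. On the remaining set some
variable avoids both neighbourhoods. -/
theorem setIntegral_arc_eq_sum_boxes {U : Bool → Set ℝ} (hU : ∀ s, MeasurableSet (U s))
    (hdisj : Disjoint (U true) (U false)) (hsub : ∀ s, U s ⊆ arc) {l : ℕ}
    (hi : IntegrableOn (contourIntegrand p A z z' (n := l)) (Set.univ.pi fun _ => arc)) :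
    ∫ t in Set.univ.pi fun _ : Fin l => arc, contourIntegrand p A z z' t =
      (∑ m ∈ Finset.range (l + 1), (l.choose m : ℂ) *
        ∫ t in Set.univ.pi fun j : Fin (m + (l - m)) => U (lab m j), contourIntegrand p A z z' t) +
      ∫ t in (Set.univ.pi fun _ : Fin l => arc) \ {t | ∀ j, t j ∈ U true ∪ U false},
        contourIntegrand p A z z' t := by
  set B : Finset (Fin l) → Set (Fin l → ℝ) := fun T => Set.univ.pi fun j => U (decide (j ∈ T))
    with hB
  have hUd : ∀ s s', s ≠ s' → Disjoint (U s) (U s') := by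
    rintro (_ | _) (_ | _) h
    exacts [absurd rfl h, hdisj.symm, hdisj, absurd rfl h]
  have hBm : ∀ T, MeasurableSet (B T) := fun T => MeasurableSet.univ_pi fun j => hU _
  have hBd : Pairwise (Function.onFun Disjoint B) := fun T T' hne => by
    obtain ⟨j, hj⟩ : ∃ j, decide (j ∈ T) ≠ decide (j ∈ T') := by
      by_contra! hcon
      exact hne (Finset.ext fun j => by simpa using hcon j)
    rw [Function.onFun, Set.disjoint_left]
    intro t ht ht'
    exact Set.disjoint_left.1 (hUd _ _ hj) (ht j trivial) (ht' j trivial)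
  have hBs : ∀ T, B T ⊆ Set.univ.pi fun _ => arc := fun T => Set.pi_mono fun j _ => hsub _
  have hBu : ⋃ T, B T = {t | ∀ j, t j ∈ U true ∪ U false} := by
    classical
    ext t
    simp only [hB, Set.mem_iUnion, Set.mem_univ_pi, Set.mem_ofPred_eq]
    constructor
    · rintro ⟨T, hT⟩ j
      have := hT j
      by_cases hj : j ∈ T
      · exact Or.inl (by simpa [hj] using this)
      · exact Or.inr (by simpa [hj] using this)
    · intro ht
      refine ⟨Finset.univ.filter fun j => t j ∈ U true, fun j => ?_⟩
      by_cases hj : t j ∈ U true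
      · simp [hj]
      · simpa [hj] using (ht j).resolve_left hj
  have h1 : ∑ m ∈ Finset.range (l + 1), (l.choose m : ℂ) *
        ∫ t in Set.univ.pi fun j : Fin (m + (l - m)) => U (lab m j), contourIntegrand p A z z' t =
      ∫ t in ⋃ T, B T, contourIntegrand p A z z' t := by
    rw [integral_iUnion_fintype hBm hBd fun T => hi.mono_set (hBs T)]
    have h2 := Finset.sum_powerset_apply_card (x := (Finset.univ : Finset (Fin l)))
      fun m => ∫ t in Set.univ.pi fun j : Fin (m + (l - m)) => U (lab m j),
        contourIntegrand p A z z' t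
    rw [Finset.powerset_univ, Finset.card_univ, Fintype.card_fin] at h2
    simp only [nsmul_eq_mul] at h2
    rw [← h2]
    refine Finset.sum_congr rfl fun T _ => ?_
    exact (setIntegral_box_eq U rfl (by rw [Finset.card_compl, Fintype.card_fin])).symm
  rw [h1, ← hBu, ← setIntegral_union Set.disjoint_sdiff_right
    ((MeasurableSet.univ_pi fun _ => measurableSet_Ioo).diff (MeasurableSet.iUnion hBm))
    (hi.mono_set (Set.iUnion_subset hBs)) (hi.mono_set Set.sdiff_subset),
    Set.union_sdiff_cancel (Set.iUnion_subset hBs)]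

theorem prod_le_of_exists_le {l : ℕ} {g : Fin l → ℝ} {a b : ℝ} (h0 : ∀ j, 0 ≤ g j)
    (h1 : ∀ j, g j ≤ a) (hb : 0 ≤ b) (h2 : ∃ j, g j ≤ a * b) : ∏ j, g j ≤ a ^ l * b := by
  obtain ⟨j, hj⟩ := h2
  have ha : 0 ≤ a := (h0 j).trans (h1 j)
  obtain ⟨k, rfl⟩ : ∃ k, l = k + 1 := ⟨l - 1, by have := j.2; omega⟩
  rw [← Finset.mul_prod_erase _ _ (Finset.mem_univ j)]
  calc _ ≤ (a * b) * ∏ _i ∈ Finset.univ.erase j, a := by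
        gcongr with i _
        · exact Finset.prod_nonneg fun i _ => h0 i
        · exact fun i _ => h0 i
        · exact h1 i
    _ = _ := by
      rw [Finset.prod_const, Finset.card_erase_of_mem (Finset.mem_univ j), Finset.card_univ,
        Fintype.card_fin, Nat.add_sub_cancel, pow_succ]
      ring

end Decomposition

/-! ### Expansion of the integral on the descent contour. -/

section Expansion

/-- The leading contribution of the configurations with `m` variables at the first and `n`
variables at the second saddle point. -/
def saddleTerm (β : ℕ) (P Γ : ℂ → ℂ) (z lam : Bool → ℂ) (N m n : ℕ) : ℂ :=
  exp (N * (m * P (z true) + n * P (z false))) *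
    (amplitude (4 / β) m (l := m + n) Γ z lam 0 *
      ((N : ℝ) ^ (-(((m + n : ℕ) + clusterDegree (4 / β) m n) / 2)) *
        (gammaIntegral m β * gammaIntegral n β) : ℝ))

theorem eventually_exp_neg_le {δ : ℝ} (hδ : 0 < δ) (D : ℝ) :
    ∀ᶠ N : ℕ in atTop, Real.exp (-δ * N) ≤ (N : ℝ) ^ (-D) / N := by
  have h := ((isLittleO_exp_neg_mul_rpow_atTop hδ (-D - 1)).comp_tendsto
    tendsto_natCast_atTop_atTop).bound one_pos
  filter_upwards [h, eventually_gt_atTop 0] with N hN hN0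
  have hN0' : (0 : ℝ) < N := by exact_mod_cast hN0
  simp only [Function.comp_apply, Real.norm_eq_abs, Real.abs_exp, one_mul] at hN
  rwa [abs_of_nonneg (by positivity), Real.rpow_sub_one hN0'.ne'] at hN

/-- The factor Γ alone need not be bounded near the ends of the contour. Writing the integrand as
e^{(N - N₀)P} times its value at N₀ requires only a bound at the single index N₀. -/
theorem norm_amplitude_le {P Γ : ℂ → ℂ} {A : ℕ → ℂ → ℂ} {w : ℂ} {H δ C₀ : ℝ} {N₀ N : ℕ}
    (hA : ∀ N, 0 < N → A N w = exp (N * P w) * Γ w) (hN₀ : 0 < N₀) (hN : N₀ ≤ N)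
    (hC₀ : ‖A N₀ w‖ ≤ C₀) (hw : (P w).re ≤ H - δ) :
    ‖A N w‖ ≤ C₀ * Real.exp (-N₀ * H) * Real.exp (N * H) * Real.exp (-δ * (N - N₀)) := by
  have hNN : (0 : ℝ) ≤ N - N₀ := sub_nonneg.2 (by exact_mod_cast hN)
  have e : ‖A N w‖ = Real.exp ((N - N₀) * (P w).re) * ‖A N₀ w‖ := by
    rw [hA N (hN₀.trans_le hN), hA N₀ hN₀, norm_mul, norm_mul, norm_exp, norm_exp, ← mul_assoc,
      ← Real.exp_add]
    congr 2
    simp only [mul_re, natCast_re, natCast_im, zero_mul, sub_zero]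
    ring
  rw [e]
  calc _ ≤ Real.exp ((N - N₀) * (H - δ)) * C₀ := by gcongr
    _ = _ := by
      rw [mul_assoc C₀, mul_assoc C₀, ← Real.exp_add, ← Real.exp_add, mul_comm]
      congr 2
      ring

/-- Each box contributes its Laplace term with relative error 1/N; the rest of the cube is
exponentially small. The number D bounds all powers of 1/N from below, so a single error scale
serves every m. -/
theorem exists_expansion_bound {P Γ : ℂ → ℂ} {τ τ' : ℝ → ℝ} {L H η : ℝ} {ψ μ : Bool → ℝ}
    {lam : Bool → ℂ} {A : ℕ → ℂ → ℂ}
    (h : IsSaddlePair P Γ (heightPath τ 1) (fun t => 1 + I * τ' t) ψ μ lam η)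
    (hτ : IsHeight τ τ' L) (hD : Descends (fun z => (P z).re) H τ (ψ true) (ψ false))
    (hH : ∀ s, (P (heightPath τ 1 (ψ s))).re = H) (hAm : ∀ N, Measurable (A N))
    (hA : ∀ N, 0 < N → ∀ t ∈ arc, A N (heightPath τ 1 t) =
      exp (N * P (heightPath τ 1 t)) * Γ (heightPath τ 1 t))
    {N₀ : ℕ} (hN₀ : 0 < N₀) {C₀ : ℝ} (hC₀ : ∀ t ∈ arc, ‖A N₀ (heightPath τ 1 t)‖ ≤ C₀)
    {β : ℕ} (hβ : 0 < β) {D : ℝ}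
    (hDm : ∀ m ≤ β, D ≤ (β + clusterDegree (4 / β) m (β - m)) / 2) :
    ∃ K, ∀ᶠ N : ℕ in atTop,
      ‖contourIntegral β (4 / β) (A N) (heightPath τ 1) (fun t => 1 + I * τ' t) -
        ∑ m ∈ Finset.range (β + 1), (β.choose m : ℂ) *
          saddleTerm β P Γ (fun s => heightPath τ 1 (ψ s)) lam N m (β - m)‖ ≤
      Real.exp (N * (β * H)) * (K * ((N : ℝ) ^ (-D) / N)) := by
  have hp : (0 : ℝ) < 4 / β := by positivity
  set ζ := heightPath τ 1 with hζ
  set ζ' : ℝ → ℂ := fun t => 1 + I * τ' t with hζ'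
  have hL := hτ.nonneg
  -- a common radius
  choose r₁ hr₁ hbox using fun m => h.exists_box_bound hp m (β - m)
  -- Only finitely many m occur, so one radius serves all of them.
  obtain ⟨r, hr0, hr, hrη⟩ : ∃ r > 0, (∀ m ∈ Finset.range (β + 1), r ≤ r₁ m) ∧
      ∀ s, μ s * r ≤ η := by
    have e1 : ∀ᶠ r in 𝓝[>] (0 : ℝ), ∀ m ∈ Finset.range (β + 1), r ≤ r₁ m :=
      (Finset.eventually_all _).2 fun m _ =>
        ((eventually_lt_nhds (hr₁ m)).filter_mono nhdsWithin_le_nhds).mono fun r hr => hr.le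
    have e2 : ∀ s, ∀ᶠ r in 𝓝[>] (0 : ℝ), μ s * r ≤ η := fun s => by
      have : Tendsto (fun r => μ s * r) (𝓝 0) (𝓝 (μ s * 0)) := by
        exact (continuous_const.mul continuous_id).tendsto 0
      rw [mul_zero] at this
      exact ((this.eventually_lt_const h.eta_pos).filter_mono nhdsWithin_le_nhds).mono
        fun r hr => hr.le
    obtain ⟨r, ⟨⟨h1, h2⟩, h3⟩, h4⟩ := (((e1.and (e2 true)).and (e2 false)).and
      self_mem_nhdsWithin).exists
    exact ⟨r, h4, h1, by rintro (_ | _) <;> assumption⟩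
  choose! K hK using fun m (hm : m ∈ Finset.range (β + 1)) => hbox m r hr0 (hr m hm)
  set U : Bool → Set ℝ := fun s => Metric.ball (ψ s) (μ s * r) with hU
  have hUm : ∀ s, MeasurableSet (U s) := fun s => Metric.isOpen_ball.measurableSet
  have hUη : ∀ s, ∀ t ∈ U s, |t - ψ s| ≤ η := fun s t ht => by
    rw [← Real.dist_eq]
    exact (Metric.mem_ball.1 ht).le.trans (hrη s)
  have hUarc : ∀ s, U s ⊆ arc := fun s t ht => h.mem_arc s t (hUη s t ht)
  have hUdisj : Disjoint (U true) (U false) := by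
    rw [Set.disjoint_left]
    intro t h1 h2
    have h1 := abs_le.1 (hUη _ _ h1)
    have h2 := abs_le.1 (hUη _ _ h2)
    have := h.sep
    linarith [h1.2, h2.1]
  -- bounds
  obtain ⟨δ, hδ, hDδ⟩ := hD (min (μ true * r) (μ false * r))
    (lt_min (mul_pos (h.mu_pos _) hr0) (mul_pos (h.mu_pos _) hr0))
  have hPH : ∀ t ∈ arc, (P (ζ t)).re ≤ H := fun t ht => by
    by_cases h1 : t = ψ true
    · rw [h1, hH]
    by_cases h2 : t = ψ false
    · rw [h2, hH]
    obtain ⟨δ', hδ', hh⟩ := hD (min |t - ψ true| |t - ψ false|)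
      (lt_min (abs_pos.2 (sub_ne_zero.2 h1)) (abs_pos.2 (sub_ne_zero.2 h2)))
    have := hh t ht (min_le_left _ _) (min_le_right _ _)
    simp only [← hζ] at this
    linarith
  have hψarc : ψ true ∈ arc := h.mem_arc true _ (by simpa using h.eta_pos.le)
  have hC₀0 : 0 ≤ C₀ := (norm_nonneg _).trans (hC₀ _ hψarc)
  set a : ℕ → ℝ := fun N => (1 + L) * (C₀ * Real.exp (-N₀ * H)) * Real.exp (N * H) with ha
  have ha0 : ∀ N, 0 ≤ a N := fun N => by simp only [ha]; positivity
  have hζ'n : ∀ t ∈ arc, ‖ζ' t‖ ≤ 1 + L := fun t ht => by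
    refine (norm_add_le _ _).trans ?_
    rw [norm_one, norm_mul, norm_I, one_mul, norm_real, Real.norm_eq_abs]
    linarith [hτ.bound t ht]
  have hbd : ∀ δ' : ℝ, ∀ N, N₀ ≤ N → ∀ t ∈ arc, (P (ζ t)).re ≤ H - δ' →
      ‖A N (ζ t) * ζ' t‖ ≤ a N * Real.exp (-δ' * (N - N₀)) := fun δ' N hN t ht hPt => by
    rw [norm_mul]
    have := norm_amplitude_le (fun N hN => hA N hN t ht) hN₀ hN (hC₀ t ht) hPt
    calc _ ≤ (C₀ * Real.exp (-N₀ * H) * Real.exp (N * H) * Real.exp (-δ' * (N - N₀))) * (1 + L) :=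
          mul_le_mul this (hζ'n t ht) (norm_nonneg _) (by positivity)
      _ = _ := by simp only [ha]; ring
  have hbd1 : ∀ N, N₀ ≤ N → ∀ t ∈ arc, ‖A N (ζ t) * ζ' t‖ ≤ a N := fun N hN t ht => by
    have := hbd 0 N hN t ht (by simpa using hPH t ht)
    simpa using this
  set M : ℝ := ∏ j : Fin β, ∏ _k ∈ Finset.Ioi j, (2 * Real.exp (L * (2 * Real.pi))) ^ (4 / (β : ℝ))
    with hM
  have hM0 : 0 ≤ M := Finset.prod_nonneg fun j _ => Finset.prod_nonneg fun k _ => by positivity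
  have hint : ∀ t : Fin β → ℝ, (∀ j, t j ∈ arc) → ‖interaction (4 / β) ζ t‖ ≤ M := fun t ht => by
    refine norm_interaction_le hp fun j => ?_
    simpa using hτ.abs_heightPath_im_le 1 (ht j)
  set S : Set (Fin β → ℝ) := Set.univ.pi fun _ => arc with hS
  have hSfin : volume S < ⊤ := by
    rw [hS, volume_pi, Measure.pi_pi]
    simp [ENNReal.mul_lt_top_iff]
  have hζm : Measurable ζ := hτ.measurable_heightPath 1
  have hζ'm : Measurable ζ' := by have := hτ.meas'; simp only [hζ']; fun_prop
  have hi : ∀ N, N₀ ≤ N → IntegrableOn (contourIntegrand (4 / β) (A N) ζ ζ' (n := β)) S :=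
    fun N hN => by
    refine Measure.integrableOn_of_bounded (M := a N ^ β * M) hSfin.ne
      (measurable_contourIntegrand (hAm N) hζm hζ'm).aestronglyMeasurable
      ((ae_restrict_iff' (MeasurableSet.univ_pi fun _ => measurableSet_Ioo)).2
        (Eventually.of_forall fun t ht => ?_))
    rw [contourIntegrand, norm_mul, norm_prod]
    refine mul_le_mul ?_ (hint t fun j => ht j trivial) (norm_nonneg _) (pow_nonneg (ha0 N) _)
    calc _ ≤ ∏ _j : Fin β, a N := Finset.prod_le_prod (fun j _ => norm_nonneg _)
          fun j _ => hbd1 N hN _ (ht j trivial)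
      _ = _ := by simp
  have hrest : ∀ N, N₀ ≤ N →
      ‖∫ t in S \ {t | ∀ j, t j ∈ U true ∪ U false}, contourIntegrand (4 / β) (A N) ζ ζ' t‖ ≤
        a N ^ β * Real.exp (-δ * (N - N₀)) * M * volume.real S := fun N hN => by
    have hfin : volume (S \ {t | ∀ j, t j ∈ U true ∪ U false}) < ⊤ :=
      (measure_mono Set.sdiff_subset).trans_lt hSfin
    refine (norm_setIntegral_le_of_norm_le_const
      (C := a N ^ β * Real.exp (-δ * (N - N₀)) * M) hfin ?_).trans ?_
    · rintro t ⟨ht, htU⟩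
      rw [contourIntegrand, norm_mul, norm_prod]
      refine mul_le_mul ?_ (hint t fun j => ht j trivial) (norm_nonneg _)
        (mul_nonneg (pow_nonneg (ha0 N) _) (Real.exp_nonneg _))
      refine prod_le_of_exists_le (fun j => norm_nonneg _) (fun j => hbd1 N hN _ (ht j trivial))
        (Real.exp_nonneg _) ?_
      simp only [Set.mem_ofPred_eq, not_forall, Set.mem_union, not_or] at htU
      obtain ⟨j, hj1, hj2⟩ := htU
      refine ⟨j, hbd δ N hN _ (ht j trivial) (hDδ _ (ht j trivial) ?_ ?_)⟩
      · refine (min_le_left _ _).trans ?_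
        simpa [hU, Real.dist_eq] using hj1
      · refine (min_le_right _ _).trans ?_
        simpa [hU, Real.dist_eq] using hj2
    · refine mul_le_mul_of_nonneg_left ?_ (by have := ha0 N; positivity)
      exact measureReal_mono Set.sdiff_subset hSfin.ne
  refine ⟨(∑ m ∈ Finset.range (β + 1), β.choose m * |K m|) +
    ((1 + L) * (C₀ * Real.exp (-N₀ * H))) ^ β * Real.exp (δ * N₀) * M * volume.real S, ?_⟩
  filter_upwards [eventually_exp_neg_le hδ D, eventually_ge_atTop N₀] with N hexp hN
  have hN0 : 0 < N := hN₀.trans_le hN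
  have hN0' : (0 : ℝ) < N := by exact_mod_cast hN0
  have hN1 : (1 : ℝ) ≤ N := by exact_mod_cast hN0
  have hdec := setIntegral_arc_eq_sum_boxes hUm hUdisj hUarc (hi N hN)
  have hI : contourIntegral β (4 / β) (A N) ζ ζ' =
      ∫ t in S, contourIntegrand (4 / β) (A N) ζ ζ' t := rfl
  rw [hI, hdec, add_sub_right_comm, ← Finset.sum_sub_distrib, add_mul, mul_add]
  refine (norm_add_le _ _).trans (add_le_add ?_ ?_)
  · rw [Finset.sum_mul, Finset.mul_sum]
    refine (norm_sum_le _ _).trans (Finset.sum_le_sum fun m hm => ?_)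
    have hmβ : m ≤ β := Nat.lt_succ_iff.1 (Finset.mem_range.1 hm)
    rw [← mul_sub, norm_mul, norm_natCast]
    have hb := hK m hm N (A N) hN0 (hA N hN0)
    rw [integral_clusterProduct] at hb
    have hnorm : ‖exp (N * (m * P (ζ (ψ true)) + (β - m : ℕ) * P (ζ (ψ false))))‖ =
        Real.exp (N * (β * H)) := by
      rw [norm_exp]
      congr 1
      simp only [mul_re, add_re, natCast_re, natCast_im, zero_mul, sub_zero, hH]
      rw [Nat.cast_sub hmβ]; ring
    rw [hnorm] at hb
    calc _ ≤ (β.choose m : ℝ) * (Real.exp (N * (β * H)) * (K m * (N : ℝ) ^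
          (-(((m + (β - m) : ℕ) + clusterDegree (4 / β) m (β - m)) / 2)) / N)) := by
          gcongr; exact hb
      _ ≤ (β.choose m : ℝ) * (Real.exp (N * (β * H)) * (|K m| * (N : ℝ) ^ (-D) / N)) := by
          have e : ((m + (β - m) : ℕ) : ℝ) = β := by rw [Nat.add_sub_cancel' hmβ]
          gcongr
          · exact le_abs_self _
          · rw [e]; exact hDm m hmβ
      _ = _ := by ring
  · refine (hrest N hN).trans ?_
    have e : a N ^ β * Real.exp (-δ * (N - N₀)) * M * volume.real S =
        Real.exp (N * (β * H)) * ((((1 + L) * (C₀ * Real.exp (-N₀ * H))) ^ β * Real.exp (δ * N₀) *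
          M * volume.real S) * Real.exp (-δ * N)) := by
      have e1 : Real.exp (-δ * (N - N₀)) = Real.exp (δ * N₀) * Real.exp (-δ * N) := by
        rw [← Real.exp_add]; congr 1; ring
      have e2 : Real.exp (N * H) ^ β = Real.exp (N * (β * H)) := by
        rw [← Real.exp_nat_mul]; congr 1; ring
      simp only [ha]
      rw [mul_pow _ (Real.exp (N * H)), e1, e2]; ring
    rw [e]
    gcongr

end Expansion

/-! ### From the polar contour to a straightened path in the strip. -/

section Geometry

theorem exp_I_mul_heightPath {ρ : ℝ → ℝ} {σ : ℝ → ℝ} {t : ℝ} (hρ : 0 < ρ t)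
    (hσ : σ t = -Real.log (ρ t)) : exp (I * heightPath σ 1 t) = polarPath ρ t := by
  have e : I * heightPath σ 1 t = (Real.log (ρ t) : ℝ) + t * I := by
    rw [heightPath, hσ]
    push_cast
    linear_combination (-(Real.log (ρ t) : ℂ)) * I_mul_I
  rw [e, exp_add, ← ofReal_exp, Real.exp_log hρ, polarPath]

theorem exists_isHeight_of_polar {ρ : ℝ → ℝ} (hρ : ContDiffOn ℝ 1 ρ (Set.Icc 0 (2 * Real.pi)))
    (hρpos : ∀ t ∈ Set.Icc 0 (2 * Real.pi), 0 < ρ t) (hρ0 : ρ 0 = 1) (hρ1 : ρ (2 * Real.pi) = 1) :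
    ∃ σ σ' : ℝ → ℝ, ∃ L : ℝ, IsHeight σ σ' L ∧
      ∀ t ∈ arc, σ t = -Real.log (ρ t) := by
  have hpi := Real.pi_pos
  set J : Set ℝ := Set.Icc 0 (2 * Real.pi) with hJ
  have hlog : ContinuousOn (fun t => -Real.log (ρ t)) J :=
    (hρ.continuousOn.log fun t ht => (hρpos t ht).ne').neg
  have hder : ContinuousOn (fun t => -(derivWithin ρ J t / ρ t)) J :=
    ((hρ.continuousOn_derivWithin (uniqueDiffOn_Icc (by positivity)) le_rfl).div hρ.continuousOn
      fun t ht => (hρpos t ht).ne').neg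
  obtain ⟨L, hL⟩ := isCompact_Icc.exists_bound_of_continuousOn hder
  have hsub : arc ⊆ J := Set.Ioo_subset_Icc_self
  -- Cut off outside the interval, so that both functions are measurable on the whole line.
  refine ⟨J.indicator fun t => -Real.log (ρ t),
    arc.indicator fun t => -(derivWithin ρ J t / ρ t), L, ⟨?_, ?_, ?_, ?_, ?_, ?_, ?_⟩, ?_⟩
  · classical
    rw [← Set.piecewise_eq_indicator]
    exact hlog.measurable_piecewise continuousOn_const measurableSet_Icc
  · classical
    rw [← Set.piecewise_eq_indicator]
    exact (hder.mono hsub).measurable_piecewise continuousOn_const measurableSet_Ioo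
  · rw [Set.indicator_of_mem (by simp [hJ, hpi.le]), hρ0]; simp
  · rw [Set.indicator_of_mem (by simp [hJ, hpi.le]), hρ1]; simp
  · exact hlog.congr fun t ht => Set.indicator_of_mem ht _
  · intro t ht
    have hJt : J ∈ 𝓝 t := Icc_mem_nhds ht.1 ht.2
    rw [Set.indicator_of_mem ht]
    have h1 : HasDerivAt ρ (derivWithin ρ J t) t :=
      ((hρ.differentiableOn one_ne_zero t (hsub ht)).hasDerivWithinAt).hasDerivAt hJt
    refine ((h1.log (hρpos t (hsub ht)).ne').neg).congr_of_eventuallyEq ?_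
    filter_upwards [hJt] with s hs
    exact Set.indicator_of_mem hs _
  · intro t ht
    rw [Set.indicator_of_mem ht]
    exact hL t (hsub ht)
  · exact fun t ht => Set.indicator_of_mem (hsub ht) _

/-- The tangent of the contour at a point, in the coordinate `z = -i ln u`. -/
theorem tangent_eq {ρ σ σ' : ℝ → ℝ} {L : ℝ} (h : IsHeight σ σ' L)
    (hρpos : ∀ t ∈ arc, 0 < ρ t) (hσ : ∀ t ∈ arc, σ t = -Real.log (ρ t)) {ψ : ℝ} (hψ : ψ ∈ arc)
    {w : ℂ} (hw : HasDerivAt (polarPath ρ) w ψ) :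
    I * polarPath ρ ψ * (1 + I * σ' ψ) = w := by
  have h1 : HasDerivAt (fun t => heightPath σ 1 t) (1 + I * σ' ψ) ψ := by
    have a := (hasDerivAt_id ψ).ofReal_comp
    have b := ((h.deriv ψ hψ).ofReal_comp.const_mul (I * 1))
    have := a.add b
    simp only [mul_one, ofReal_one] at this
    refine this.congr_of_eventuallyEq (Eventually.of_forall fun t => ?_)
    simp [heightPath]
  have h2 := (h1.const_mul I).cexp
  have h3 : polarPath ρ =ᶠ[𝓝 ψ] fun t => exp (I * heightPath σ 1 t) := by
    filter_upwards [isOpen_Ioo.mem_nhds hψ] with t ht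
    exact (exp_I_mul_heightPath (hρpos t ht) (hσ t ht)).symm
  have h4 := (h2.congr_of_eventuallyEq h3).unique hw
  rw [exp_I_mul_heightPath (hρpos ψ hψ) (hσ ψ hψ)] at h4
  rw [← h4]; ring

/-- The polar contour is t - i ln ρ(t) in the coordinate z, hence a graph over its real part. Its
tangents at the saddle points are the steepest directions, so the cones of `exists_cone` surround
them and the path can be straightened there. -/
theorem exists_isSaddlePair {f₀ g : ℂ → ℂ} {u : Bool → ℂ} {ψ θ φ : Bool → ℝ} {R H : ℝ} {ρ : ℝ → ℝ}
    (hψ0 : 0 < ψ true) (hψ : ψ true < ψ false) (hψ1 : ψ false < 2 * Real.pi)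
    (hf : ∀ s, AnalyticAt ℂ f₀ (u s)) (hg : ∀ s, AnalyticAt ℂ (fun v => exp (g v)) (u s))
    (hd : ∀ s, deriv f₀ (u s) = 0) (hR : 0 < R)
    (hdd : ∀ s, iteratedDeriv 2 f₀ (u s) = R * exp (φ s * I))
    (hθ : ∀ s, exp ((2 * θ s + φ s : ℝ) * I) = -1)
    (hρ : ContDiffOn ℝ 1 ρ (Set.Icc 0 (2 * Real.pi)))
    (hρpos : ∀ t ∈ Set.Icc 0 (2 * Real.pi), 0 < ρ t) (hρ0 : ρ 0 = 1) (hρ1 : ρ (2 * Real.pi) = 1)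
    (hu : ∀ s, polarPath ρ (ψ s) = u s)
    (hdir : ∀ s, ∃ c : ℝ, 0 < c ∧ HasDerivAt (polarPath ρ) (c * exp (θ s * I)) (ψ s))
    (hH : ∀ s, (f₀ (u s)).re = H)
    (hdescent : ∀ η : ℝ, 0 < η → ∃ δ : ℝ, 0 < δ ∧ ∀ t ∈ Set.Ioo 0 (2 * Real.pi),
      η ≤ |t - ψ true| → η ≤ |t - ψ false| → (f₀ (polarPath ρ t)).re ≤ H - δ) :
    ∃ τ τ' : ℝ → ℝ, ∃ L η : ℝ, ∃ μ : Bool → ℝ, ∃ lam : Bool → ℂ,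
      IsSaddlePair (fun z => f₀ (exp (I * z))) (fun z => exp (g (exp (I * z))) * (I * exp (I * z)))
        (heightPath τ 1) (fun t => 1 + I * τ' t) ψ μ lam η ∧
      IsHeight τ τ' L ∧
      Descends (fun z => (f₀ (exp (I * z))).re) H τ (ψ true) (ψ false) ∧
      (∀ s, exp (I * heightPath τ 1 (ψ s)) = u s) ∧
      ∀ s, I * u s * lam s = (√(2 / R) : ℝ) * exp (θ s * I) := by
  obtain ⟨σ, σ', L, hσ, hσρ⟩ := exists_isHeight_of_polar hρ hρpos hρ0 hρ1
  have hρpos' : ∀ t ∈ arc, 0 < ρ t := fun t ht => hρpos t (Set.Ioo_subset_Icc_self ht)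
  have hψarc : ∀ s, ψ s ∈ arc := by
    rintro (_ | _)
    exacts [⟨by linarith, by linarith⟩, ⟨by linarith, by linarith⟩]
  have hpolar : ∀ t ∈ arc, exp (I * heightPath σ 1 t) = polarPath ρ t := fun t ht =>
    exp_I_mul_heightPath (hρpos' t ht) (hσρ t ht)
  choose c hc hcd using hdir
  set κ : Bool → ℂ := fun s => 1 + I * σ' (ψ s) with hκ
  have htan : ∀ s, I * u s * κ s = c s * exp (θ s * I) := fun s => by
    rw [← hu s]
    exact tangent_eq hσ hρpos' hσρ (hψarc s) (hcd s)
  set z : Bool → ℂ := fun s => heightPath σ 1 (ψ s) with hz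
  have hzu : ∀ s, exp (I * z s) = u s := fun s => by rw [← hu s]; exact hpolar _ (hψarc s)
  set P : ℂ → ℂ := fun z => f₀ (exp (I * z)) with hP
  have hPa : ∀ s, AnalyticAt ℂ P (z s) := fun s =>
    analyticAt_comp_exp (by rw [hzu]; exact hf s)
  have hPd : ∀ s, deriv P (z s) = 0 := fun s => by
    rw [(deriv_comp_exp (by rw [hzu]; exact hf s)).eq_of_nhds, hzu, hd, zero_mul]
  have hPdd : ∀ s, iteratedDeriv 2 P (z s) / 2 * κ s ^ 2 = -((R * c s ^ 2 / 2 : ℝ) : ℂ) := fun s => by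
    rw [iteratedDeriv_two_comp_exp (by rw [hzu]; exact hf s) (by rw [hzu]; exact hd s), hzu, hdd]
    have e : exp ((2 * θ s + φ s : ℝ) * I) = exp (θ s * I) ^ 2 * exp (φ s * I) := by
      rw [← exp_nat_mul, ← exp_add]
      congr 1
      push_cast
      ring
    rw [hθ] at e
    calc _ = R * exp (φ s * I) / 2 * (I * u s * κ s) ^ 2 := by ring
      _ = R * c s ^ 2 / 2 * (exp (θ s * I) ^ 2 * exp (φ s * I)) := by rw [htan]; ring
      _ = _ := by rw [← e]; push_cast; ring
  -- Scales the tangent vector so that half the second derivative times its square is -1: without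
  -- the scaling this product is -R c²/2.
  set μ : Bool → ℝ := fun s => √(2 / R) / c s with hμ
  have hμ0 : ∀ s, 0 < μ s := fun s => div_pos (Real.sqrt_pos.2 (by positivity)) (hc s)
  have hcone : ∀ s, ∃ ε > 0, ∃ r > 0, ∃ a > 0, ∀ x y : ℝ, |x| < r → |y| ≤ ε * |x| →
      (P (z s + (1 + I * σ' (ψ s)) * x + I * y)).re ≤ H - a * x ^ 2 := fun s => by
    have := exists_cone (hPa s) (hPd s) (by have := hc s; positivity) (hPdd s)
    have hPz : (P (z s)).re = H := by simp only [hP, hzu, hH]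
    rwa [hPz] at this
  have hD : Descends (fun z => (P z).re) H σ (ψ true) (ψ false) := fun η hη => by
    obtain ⟨δ, hδ, hh⟩ := hdescent η hη
    refine ⟨δ, hδ, fun t ht h1 h2 => ?_⟩
    simp only [hP, hpolar t ht]
    exact hh t ht h1 h2
  have hgap : 0 < |ψ true - ψ false| := abs_pos.2 (sub_ne_zero.2 hψ.ne)
  -- Straightening at the first saddle point changes neither height nor slope at the second, so the
  -- cone there is still available for the second straightening.
  obtain ⟨τ₁, τ₁', L₁, η₁, hτ₁, hη₁, h1, h2, hD₁⟩ :=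
    hD.exists_straight hσ (hψarc true) hψ.ne (hcone true)
  obtain ⟨hF1, hF2⟩ := h2 (ψ false) (by rw [sub_self, abs_zero]; positivity)
  obtain ⟨τ, τ', L₂, η₂, hτ, hη₂, h3, h4, hD₂⟩ :=
    hD₁.symm.exists_straight hτ₁ (hψarc false) hψ.ne' (by
      have e : heightPath τ₁ 1 (ψ false) = z false := by simp only [heightPath, hz, hF1]
      rw [e, hF2]
      exact hcone false)
  rw [hF1, hF2] at h3
  rw [abs_sub_comm] at h4
  -- Below both straight ranges, below a third of the gap between the saddle points, and below half
  -- the distance to the ends.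
  set η := min (min (min η₁ η₂) (|ψ true - ψ false| / 3)) (min (ψ true) (2 * Real.pi - ψ false) / 2)
    with hη
  have hη0 : 0 < η := lt_min (lt_min (lt_min hη₁ hη₂) (by positivity))
    (half_pos (lt_min hψ0 (by linarith)))
  have hηgap : η ≤ |ψ true - ψ false| / 3 := (min_le_left _ _).trans (min_le_right _ _)
  have hloc : ∀ s t, |t - ψ s| ≤ η → τ t = σ (ψ s) + σ' (ψ s) * (t - ψ s) ∧ τ' t = σ' (ψ s) := by
    rintro (_ | _) t ht
    · exact h3 t (ht.trans ((min_le_left _ _).trans ((min_le_left _ _).trans (min_le_right _ _))))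
    · obtain ⟨e1, e2⟩ := h4 t (by linarith)
      rw [e1, e2]
      exact h1 t (ht.trans ((min_le_left _ _).trans ((min_le_left _ _).trans (min_le_left _ _))))
  have hτψ : ∀ s, heightPath τ 1 (ψ s) = z s := fun s => by
    have := (hloc s (ψ s) (by simpa using hη0.le)).1
    simp only [heightPath, hz, this]
    simp
  have hlam : ∀ s, I * u s * (κ s * μ s) = (√(2 / R) : ℝ) * exp (θ s * I) := fun s => by
    rw [← mul_assoc, htan]
    have : (c s : ℂ) ≠ 0 := by exact_mod_cast (hc s).ne'
    simp only [hμ]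
    push_cast
    field_simp
  refine ⟨τ, τ', L₂, η, μ, fun s => κ s * μ s, ⟨hμ0, fun s => ?_, hη0, hψ0, hψ, hψ1, fun s => ?_,
    fun s t ht => ?_, ?_, fun s t ht => ?_, fun s => ?_, fun s => ?_, fun s => ?_, fun s => ?_⟩, hτ,
    hD₂.symm, fun s => by rw [hτψ, hzu], hlam⟩
  · simpa [hκ] using hμ0 s
  · simp [heightPath]
  · have e1 : η ≤ min (ψ true) (2 * Real.pi - ψ false) / 2 := min_le_right _ _
    have e2 := min_le_left (ψ true) (2 * Real.pi - ψ false)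
    have e3 := min_le_right (ψ true) (2 * Real.pi - ψ false)
    rw [abs_le] at ht
    cases s
    · exact ⟨by linarith [ht.1], by linarith [ht.2]⟩
    · exact ⟨by linarith [ht.1], by linarith [ht.2]⟩
  · rw [abs_sub_comm, abs_of_pos (sub_pos.2 hψ)] at hηgap
    linarith
  · obtain ⟨e1, e2⟩ := hloc s t ht
    have hμc : (μ s : ℂ) ≠ 0 := by exact_mod_cast (hμ0 s).ne'
    refine ⟨?_, ?_⟩
    · rw [hτψ]
      simp only [heightPath, hz, e1, hκ]
      push_cast
      field_simp
      ring
    · simp only [e2, hκ]; ring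
  · rw [hτψ]; exact hPa s
  · rw [hτψ]; exact hPd s
  · rw [hτψ, mul_pow, ← mul_assoc, hPdd, ← ofReal_pow, ← ofReal_neg, ← ofReal_mul]
    have : -(R * c s ^ 2 / 2) * μ s ^ 2 = -1 := by
      have := (hc s).ne'
      simp only [hμ]
      rw [div_pow, Real.sq_sqrt (by positivity)]
      field_simp
    rw [this]; simp
  · rw [hτψ]
    refine (analyticAt_comp_exp (f := fun v => exp (g v)) (by rw [hzu]; exact hg s)).mul ?_
    fun_prop

end Geometry

/-! ### The circle integral in the coordinate z. -/

section Circle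

theorem exp_I_mul_mem_cutPlane {z : ℂ} (hz : z ∈ strip) : exp (I * z) ∈ cutPlane := by
  rintro ⟨r, hr, he⟩
  have h := congrArg im he
  have h' := congrArg re he
  have e : I * z = -z.im + z.re * I := by
    conv_lhs => rw [← re_add_im z]
    linear_combination (z.im : ℂ) * I_mul_I
  rw [e, exp_add, exp_mul_I, ← ofReal_cos, ← ofReal_sin, ← ofReal_neg, ← ofReal_exp] at h h'
  simp only [ofReal_im, ofReal_re, mul_im, add_im, add_re, mul_re, I_re, I_im, mul_zero, mul_one,
    zero_mul, add_zero, zero_add, sub_zero] at h h'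
  have hs : Real.sin z.re = 0 := by simpa [(Real.exp_pos _).ne'] using h.symm
  have hc : 0 ≤ Real.cos z.re := by
    have := Real.exp_pos (-z.im)
    rw [Set.mem_Ici, h'] at hr
    exact nonneg_of_mul_nonneg_right hr this
  obtain ⟨h0, h1⟩ := hz
  have hpi : z.re = Real.pi := by
    have h2 : Real.sin (z.re - Real.pi) = 0 := by rw [Real.sin_sub_pi, hs, neg_zero]
    have := (Real.sin_eq_zero_iff_of_lt_of_lt (by linarith) (by linarith)).1 h2
    linarith
  rw [hpi, Real.cos_pi] at hc
  linarith

/-- The factor `e^{N f(u)} du/dz` of the integrand, in the coordinate `z = -i ln u`. -/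
def stripFactor (f₀ g : ℂ → ℂ) (N : ℕ) : ℂ → ℂ :=
  strip.indicator fun z => exp (N * phase f₀ g N (exp (I * z))) * (I * exp (I * z))

variable {f₀ g : ℂ → ℂ} {N : ℕ}

theorem stripFactor_of_mem {z : ℂ} (hz : z ∈ strip) :
    stripFactor f₀ g N z = exp (N * phase f₀ g N (exp (I * z))) * (I * exp (I * z)) :=
  Set.indicator_of_mem hz _

theorem exp_mul_phase (hN : 0 < N) (u : ℂ) :
    exp (N * phase f₀ g N u) = exp (N * f₀ u) * exp (g u) := by
  have : (N : ℂ) ≠ 0 := by exact_mod_cast hN.ne'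
  rw [← exp_add, phase]
  congr 1
  field_simp

theorem stripFactor_eq (hN : 0 < N) {z : ℂ} (hz : z ∈ strip) :
    stripFactor f₀ g N z = exp (N * f₀ (exp (I * z))) *
      (exp (g (exp (I * z))) * (I * exp (I * z))) := by
  rw [stripFactor_of_mem hz, exp_mul_phase hN, mul_assoc]

theorem differentiableOn_stripFactor
    (h : DifferentiableOn ℂ (fun u => exp (N * phase f₀ g N u)) cutPlane) :
    DifferentiableOn ℂ (stripFactor f₀ g N) strip := by
  have h1 : DifferentiableOn ℂ (fun z => exp (N * phase f₀ g N (exp (I * z)))) strip :=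
    h.comp (f := fun z => exp (I * z)) (Differentiable.differentiableOn (by fun_prop))
      fun z hz => exp_I_mul_mem_cutPlane hz
  have h2 : DifferentiableOn ℂ (fun z => I * exp (I * z)) strip :=
    Differentiable.differentiableOn (by fun_prop)
  exact (h1.mul h2).congr fun z hz => stripFactor_of_mem hz

theorem measurable_stripFactor
    (h : DifferentiableOn ℂ (fun u => exp (N * phase f₀ g N u)) cutPlane) :
    Measurable (stripFactor f₀ g N) := by
  classical
  have h1 := (differentiableOn_stripFactor h).continuousOn
  have h2 : stripFactor f₀ g N = strip.piecewise (stripFactor f₀ g N) 0 := by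
    rw [Set.piecewise_eq_indicator, stripFactor, Set.indicator_indicator, Set.inter_self]
  rw [h2]
  exact h1.measurable_piecewise continuousOn_const isOpen_strip.measurableSet

theorem isBigO_stripFactor
    (h : (fun u => exp (N * phase f₀ g N u)) =O[𝓝[cutPlane] 1] (fun _ => (1 : ℝ))) {z₀ : ℂ}
    (hz₀ : exp (I * z₀) = 1) : stripFactor f₀ g N =O[𝓝[strip] z₀] fun _ => (1 : ℝ) := by
  have hc : Continuous fun z : ℂ => exp (I * z) := by fun_prop
  have ht : Tendsto (fun z => exp (I * z)) (𝓝[strip] z₀) (𝓝[cutPlane] 1) := by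
    refine tendsto_nhdsWithin_iff.2 ⟨?_, ?_⟩
    · rw [← hz₀]
      exact (hc.tendsto z₀).mono_left nhdsWithin_le_nhds
    · filter_upwards [self_mem_nhdsWithin] with z hz using exp_I_mul_mem_cutPlane hz
  have h1 := h.comp_tendsto ht
  have h2 : (fun z : ℂ => I * exp (I * z)) =O[𝓝[strip] z₀] fun _ => (1 : ℝ) :=
    (((continuous_const.mul hc).tendsto z₀).mono_left nhdsWithin_le_nhds).isBigO_one ℝ
  have h3 := h1.mul h2
  simp only [Function.comp_def, mul_one] at h3
  refine h3.congr' ?_ EventuallyEq.rfl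
  filter_upwards [self_mem_nhdsWithin] with z hz using (stripFactor_of_mem hz).symm

/-- The chord length 2 sin((t' - t)/2); the half angle lies in [0, π], where the sine is
nonnegative. -/
theorem norm_exp_sub_exp {t t' : ℝ} (ht : t ∈ arc) (ht' : t' ∈ arc) :
    (‖exp (t * I) - exp (t' * I)‖ : ℂ) = pairDist (fun t => (t : ℂ)) t t' := by
  wlog h : t ≤ t' generalizing t t'
  · rw [pairDist_comm, norm_sub_rev]
    exact this ht' ht (not_le.1 h).le
  rcases h.eq_or_lt with rfl | h
  · simp [pairDist]
  have e : exp (t * I) - exp (t' * I) = -exp (t * I) * (exp (I * (t' - t : ℝ)) - 1) := by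
    rw [neg_mul, mul_sub, ← exp_add, mul_one]
    have : (t : ℂ) * I + I * (t' - t : ℝ) = t' * I := by push_cast; ring
    rw [this]; ring
  have hs : 0 ≤ Real.sin ((t' - t) / 2) :=
    Real.sin_nonneg_of_nonneg_of_le_pi (by linarith) (by linarith [ht.1, ht'.2])
  rw [pairDist_of_lt _ h, e, norm_mul, norm_neg, norm_exp_ofReal_mul_I, one_mul,
    norm_exp_I_mul_ofReal_sub_one, Real.norm_of_nonneg (by positivity)]
  push_cast
  rfl

theorem interaction_ofReal {β : ℕ} {t : Fin β → ℝ} (ht : ∀ j, t j ∈ arc) :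
    interaction (4 / β) (fun t => (t : ℂ)) t = (pairProduct β fun j => exp (t j * I) : ℂ) := by
  rw [interaction, pairProduct, ofReal_prod]
  refine Finset.prod_congr rfl fun j _ => ?_
  rw [ofReal_prod]
  refine Finset.prod_congr rfl fun k _ => ?_
  rw [← norm_exp_sub_exp (ht j) (ht k), ofReal_cpow (norm_nonneg _)]

theorem circleBetaIntegral_eq (β : ℕ) :
    circleBetaIntegral β N (phase f₀ g N) =
      contourIntegral β (4 / β) (stripFactor f₀ g N) (fun t => t) fun _ => 1 := by
  have hae : (Set.univ.pi fun _ : Fin β => Set.Ioc (0 : ℝ) (2 * Real.pi)) =ᵐ[volume]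
      Set.univ.pi fun _ => arc :=
    (Measure.univ_pi_Ioc_ae_eq_Icc (f := fun _ : Fin β => (0 : ℝ))
      (g := fun _ => 2 * Real.pi)).trans (Measure.univ_pi_Ioo_ae_eq_Icc).symm
  rw [circleBetaIntegral, contourIntegral, setIntegral_congr_set hae]
  refine setIntegral_congr_fun (MeasurableSet.univ_pi fun _ => measurableSet_Ioo) fun t ht => ?_
  have ht' : ∀ j, t j ∈ arc := fun j => ht j trivial
  rw [interaction_ofReal ht']
  congr 1
  refine Finset.prod_congr rfl fun j _ => ?_
  have : ((t j : ℝ) : ℂ) ∈ strip := by simpa [strip] using ht' j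
  rw [stripFactor_of_mem this, mul_one, mul_comm I (t j : ℂ)]

theorem le_clusterDegree {β m : ℕ} (hβ : 0 < β) (hm : m ≤ β) :
    (β : ℝ) - 1 ≤ (β + clusterDegree (4 / β) m (β - m)) / 2 := by
  have hβ' : (0 : ℝ) < β := by exact_mod_cast hβ
  rw [clusterDegree]
  push_cast [Nat.cast_choose_two, Nat.cast_sub hm]
  -- The exponent of 1/N exceeds β - 1 by (β - 2m)²/(2β); it is smallest for equally filled saddle
  -- points.
  have e : (β + 4 / (β : ℝ) * ((m : ℝ) * (m - 1) / 2 + (β - m) * (β - m - 1) / 2)) / 2 =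
      β - 1 + (β - 2 * m) ^ 2 / (2 * β) := by field_simp; ring
  rw [e]
  have : 0 ≤ ((β : ℝ) - 2 * m) ^ 2 / (2 * β) := by positivity
  linarith

end Circle

/-! ### The expansion of the circle integral. -/

section Combine

/-- Analyticity of g itself is not assumed; e^g is the quotient of the integrand for N = 1 by
e^{f₀}. -/
theorem analyticAt_exp_of_cutPlane {f₀ g : ℂ → ℂ}
    (h : DifferentiableOn ℂ (fun u => exp ((1 : ℕ) * phase f₀ g 1 u)) cutPlane) {u : ℂ}
    (hu : cutPlane ∈ 𝓝 u) (hf : AnalyticAt ℂ f₀ u) : AnalyticAt ℂ (fun v => exp (g v)) u := by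
  have h1 : AnalyticAt ℂ (fun u => exp ((1 : ℕ) * phase f₀ g 1 u)) u := h.analyticAt hu
  have h2 : AnalyticAt ℂ (fun u => exp (-f₀ u)) u := hf.neg.cexp
  refine (h1.mul h2).congr (Eventually.of_forall fun v => ?_)
  simp only [Pi.mul_apply]
  rw [← exp_add, phase]
  congr 1
  push_cast
  ring

theorem isOpen_cutPlane : IsOpen cutPlane :=
  ((isometry_ofReal.isClosedEmbedding.isClosedMap _) isClosed_Ici).isOpen_compl

theorem exists_circle_expansion {β : ℕ} (hβ : 0 < β) {f₀ g : ℂ → ℂ}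
    (hanalytic : ∀ N : ℕ, 1 ≤ N → DifferentiableOn ℂ (fun u => exp (N * phase f₀ g N u)) cutPlane)
    (hone : ∀ᶠ N : ℕ in atTop,
      (fun u => exp (N * phase f₀ g N u)) =O[𝓝[cutPlane] 1] (fun _ => (1 : ℝ)))
    {u : Bool → ℂ} {ψ θ φ : Bool → ℝ} {R H : ℝ} {ρ : ℝ → ℝ}
    (hψ0 : 0 < ψ true) (hψ : ψ true < ψ false) (hψ1 : ψ false < 2 * Real.pi)
    (hf : ∀ s, AnalyticAt ℂ f₀ (u s)) (hd : ∀ s, deriv f₀ (u s) = 0) (hR : 0 < R)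
    (hdd : ∀ s, iteratedDeriv 2 f₀ (u s) = R * exp (φ s * I))
    (hθ : ∀ s, exp ((2 * θ s + φ s : ℝ) * I) = -1)
    (hρ : ContDiffOn ℝ 1 ρ (Set.Icc 0 (2 * Real.pi)))
    (hρpos : ∀ t ∈ Set.Icc 0 (2 * Real.pi), 0 < ρ t) (hρ0 : ρ 0 = 1) (hρ1 : ρ (2 * Real.pi) = 1)
    (hu : ∀ s, polarPath ρ (ψ s) = u s)
    (hdir : ∀ s, ∃ c : ℝ, 0 < c ∧ HasDerivAt (polarPath ρ) (c * exp (θ s * I)) (ψ s))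
    (hH : ∀ s, (f₀ (u s)).re = H)
    (hdescent : ∀ η : ℝ, 0 < η → ∃ δ : ℝ, 0 < δ ∧ ∀ t ∈ Set.Ioo 0 (2 * Real.pi),
      η ≤ |t - ψ true| → η ≤ |t - ψ false| → (f₀ (polarPath ρ t)).re ≤ H - δ) :
    ∃ z lam : Bool → ℂ, (∀ s, exp (I * z s) = u s) ∧ (∀ s, (z s).re = ψ s) ∧
      (∀ s, 0 < (lam s).re) ∧ (∀ s, I * u s * lam s = (√(2 / R) : ℝ) * exp (θ s * I)) ∧
      ∃ K, ∀ᶠ N : ℕ in atTop,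
        ‖circleBetaIntegral β N (phase f₀ g N) -
          ∑ m ∈ Finset.range (β + 1), (β.choose m : ℂ) *
            saddleTerm β (fun z => f₀ (exp (I * z)))
              (fun z => exp (g (exp (I * z))) * (I * exp (I * z))) z lam N m (β - m)‖ ≤
        Real.exp (N * (β * H)) * (K * ((N : ℝ) ^ (-((β : ℝ) - 1)) / N)) := by
  have hψarc : ∀ s, ψ s ∈ arc := by
    rintro (_ | _)
    exacts [⟨by linarith, by linarith⟩, ⟨by linarith, by linarith⟩]
  have hucut : ∀ s, u s ∈ cutPlane := fun s => by
    have h1 := exp_I_mul_heightPath (σ := fun t => -Real.log (ρ t))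
      (hρpos _ (Set.Ioo_subset_Icc_self (hψarc s))) rfl
    rw [← hu, ← h1]
    exact exp_I_mul_mem_cutPlane (by simpa [strip, heightPath] using hψarc s)
  have hg : ∀ s, AnalyticAt ℂ (fun v => exp (g v)) (u s) := fun s =>
    analyticAt_exp_of_cutPlane (hanalytic 1 le_rfl) (isOpen_cutPlane.mem_nhds (hucut s)) (hf s)
  obtain ⟨τ, τ', L, η, μ, lam, hS, hτ, hD, hzu, hlam⟩ := exists_isSaddlePair hψ0 hψ hψ1 hf hg hd hR
    hdd hθ hρ hρpos hρ0 hρ1 hu hdir hH hdescent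
  have hp : (0 : ℝ) < 4 / β := by positivity
  have e0 : exp (I * (0 : ℂ)) = 1 := by simp
  have e1 : exp (I * ((2 * Real.pi : ℝ) : ℂ)) = 1 := by
    rw [mul_comm]; push_cast; exact exp_two_pi_mul_I
  obtain ⟨N₀, hN₀⟩ := eventually_atTop.1 hone
  have hmem : ∀ t ∈ arc, heightPath τ 1 t ∈ strip := fun t ht =>
    hτ.heightPath_mem_strip (by simp) ht
  set N₁ := max N₀ 1 with hN₁
  have hN₁1 : 1 ≤ N₁ := le_max_right _ _
  have hbd : ∃ C₀, ∀ t ∈ arc, ‖stripFactor f₀ g N₁ (heightPath τ 1 t)‖ ≤ C₀ := by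
    have hb := hN₀ N₁ (le_max_left _ _)
    obtain ⟨C₀, hC₀⟩ := hτ.exists_bound (s₀ := 1)
      (differentiableOn_stripFactor (hanalytic N₁ hN₁1)).continuousOn
      (isBigO_stripFactor hb e0) (isBigO_stripFactor hb e1) (by simp)
    exact ⟨C₀, hC₀.self_of_nhds⟩
  obtain ⟨C₀, hC₀⟩ := hbd
  -- No hypothesis covers N = 0; the value 0 there makes every `A N` measurable.
  set A : ℕ → ℂ → ℂ := fun N => if 1 ≤ N then stripFactor f₀ g N else 0 with hA
  have hAeq : ∀ N, 1 ≤ N → A N = stripFactor f₀ g N := fun N hN => if_pos hN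
  have hAm : ∀ N, Measurable (A N) := fun N => by
    by_cases hN : 1 ≤ N
    · rw [hAeq N hN]; exact measurable_stripFactor (hanalytic N hN)
    · simp only [hA, if_neg hN]; exact measurable_const
  obtain ⟨K, hK⟩ := exists_expansion_bound hS hτ hD (fun s => by simp only [hzu, hH]) hAm
    (fun N hN t ht => by rw [hAeq N hN]; exact stripFactor_eq hN (hmem t ht))
    hN₁1 (by rw [hAeq N₁ hN₁1]; exact hC₀) hβ (D := (β : ℝ) - 1)
    (fun m hm => le_clusterDegree hβ hm)
  refine ⟨fun s => heightPath τ 1 (ψ s), lam, hzu, hS.re, hS.lam_re, hlam, K, ?_⟩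
  filter_upwards [hK, eventually_ge_atTop N₁] with N hN hNN
  have hN1 : 1 ≤ N := hN₁1.trans hNN
  have hb := hN₀ N ((le_max_left _ _).trans hNN)
  rw [hAeq N hN1, ← hτ.contourIntegral_eq β hp (measurable_stripFactor (hanalytic N hN1))
    (differentiableOn_stripFactor (hanalytic N hN1)) (isBigO_stripFactor hb e0)
    (isBigO_stripFactor hb e1), ← circleBetaIntegral_eq] at hN
  exact hN

end Combine

/-! ### Branches of the powers. -/

section Logarithms

/-- The value of `ln u` for the argument `a` of `u`. -/
def argLog (u : ℂ) (a : ℝ) : ℂ := Real.log ‖u‖ + a * I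

theorem exp_argLog {u : ℂ} {a : ℝ} (hu : u ≠ 0) (h : u = ‖u‖ * exp (a * I)) :
    exp (argLog u a) = u := by
  rw [argLog, exp_add, ← ofReal_exp, Real.exp_log (norm_pos_iff.2 hu), ← h]

theorem exp_cpow {w : ℂ} (h1 : -Real.pi < w.im) (h2 : w.im ≤ Real.pi) (p : ℂ) :
    exp w ^ p = exp (p * w) := by
  rw [cpow_def_of_ne_zero (exp_ne_zero _), log_exp h1 h2, mul_comm]

/-- The power of the direction of steepest descent. -/
theorem direction_cpow {u lam : ℂ} {a θ R : ℝ} (hR : 0 < R) (hu : u ≠ 0)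
    (ha : u = ‖u‖ * exp (a * I)) (hθ : θ ∈ Set.Ioo a (a + Real.pi))
    (hlam : I * u * lam = (√(2 / R) : ℝ) * exp (θ * I)) (p : ℂ) :
    lam ^ p = exp (p * (Real.log (2 / R) / 2 + θ * I - Real.pi / 2 * I - argLog u a)) := by
  have h2R : 0 < 2 / R := by positivity
  rw [← exp_cpow]
  · congr 1
    have hI : exp (-(Real.pi / 2 * I)) = -I := by
      rw [exp_neg, exp_pi_div_two_mul_I, inv_I]
    have hs : ((√(2 / R) : ℝ) : ℂ) = exp (Real.log (2 / R) / 2) := by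
      rw [← Real.exp_log (Real.sqrt_pos.2 h2R), Real.log_sqrt h2R.le]
      push_cast; rfl
    rw [sub_eq_add_neg, sub_eq_add_neg, exp_add, exp_add, exp_add, hI, exp_neg, exp_argLog hu ha,
      ← hs]
    field_simp
    linear_combination (-I) * hlam + (u * lam) * I_sq
  all_goals
    -- The exponent has imaginary part θ - π/2 - a in (-π/2, π/2), by the normalisation of θ
    -- relative to the argument a of u; it is thus the principal logarithm of `lam`.
    have e : (Real.log (2 / R) / 2 + θ * I - Real.pi / 2 * I - argLog u a : ℂ) =
        ((Real.log (2 / R) / 2 - Real.log ‖u‖ : ℝ) : ℂ) + ((θ - Real.pi / 2 - a : ℝ) : ℂ) * I := by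
      rw [argLog]; push_cast; ring
    rw [e, add_im, ofReal_im, im_ofReal_mul, I_im]
    linarith [hθ.1, hθ.2, Real.pi_pos]

/-- The power of the chord between the saddle points, in the coordinate `z = -i ln u`. -/
theorem chord_cpow {uP uM zP zM : ℂ} {ψP ψM α : ℝ}
    (hPM : uP ≠ uM) (hzP : exp (I * zP) = uP) (hzM : exp (I * zM) = uM) (hrP : zP.re = ψP)
    (hrM : zM.re = ψM) (hα : uP - uM = ‖uP - uM‖ * exp (α * I))
    (hαmem : α ∈ Set.Ioo ((ψP + ψM) / 2 - Real.pi) ((ψP + ψM) / 2)) (p : ℂ) :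
    (2 * sin ((zM - zP) / 2)) ^ p = exp (p * (argLog (uP - uM) α -
      (argLog uP ψP + argLog uM (ψM - 2 * Real.pi)) / 2 - Real.pi / 2 * I)) := by
  have hlog : ∀ {z u : ℂ}, exp (I * z) = u → z.im = -Real.log ‖u‖ := fun {z u} h => by
    rw [← h, norm_exp, Real.log_exp]; simp
  have hIP : I * zP = argLog uP ψP := by
    rw [argLog, ← hrP, ← re_add_im (I * zP)]
    simp [hlog hzP]
  -- The strip gives u_- the argument ψ_-, the formula uses ψ_- - 2π. The difference turns the
  -- factor i of the chord into -i.
  have hIM : I * zM = argLog uM (ψM - 2 * Real.pi) + 2 * Real.pi * I := by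
    rw [argLog, ← re_add_im (I * zM)]
    simp only [I_mul_re, I_mul_im, hlog hzM, hrM]
    push_cast
    ring
  have hd : uP - uM ≠ 0 := sub_ne_zero.2 hPM
  rw [← exp_cpow]
  · congr 1
    have hI : exp (Real.pi / 2 * I) = I := exp_pi_div_two_mul_I
    have e : argLog (uP - uM) α - (argLog uP ψP + argLog uM (ψM - 2 * Real.pi)) / 2 -
        Real.pi / 2 * I = argLog (uP - uM) α + (Real.pi / 2 * I + (-(I * zP + I * zM) / 2)) := by
      rw [hIP, hIM]; ring
    rw [e, exp_add, exp_argLog hd hα, exp_add, hI, two_sin, ← hzP, ← hzM]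
    have e1 : exp (I * zP) * exp (-(I * zP + I * zM) / 2) = exp (-((zM - zP) / 2) * I) := by
      rw [← exp_add]; congr 1; ring
    have e2 : exp (I * zM) * exp (-(I * zP + I * zM) / 2) = exp ((zM - zP) / 2 * I) := by
      rw [← exp_add]; congr 1; ring
    rw [← e1, ← e2]
    ring
  all_goals
    -- The imaginary part is α - (ψ_+ + ψ_-)/2 + π/2, which the interval for α places in (-π/2,
    -- π/2).
    have e : argLog (uP - uM) α - (argLog uP ψP + argLog uM (ψM - 2 * Real.pi)) / 2 -
        Real.pi / 2 * I = ((Real.log ‖uP - uM‖ - (Real.log ‖uP‖ + Real.log ‖uM‖) / 2 : ℝ) : ℂ) +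
          ((α - (ψP + ψM) / 2 + Real.pi / 2 : ℝ) : ℂ) * I := by
      simp only [argLog]; push_cast; ring
    rw [e, add_im, ofReal_im, im_ofReal_mul, I_im]
    linarith [hαmem.1, hαmem.2, Real.pi_pos]

/-- Everything except the two Γ integrals is an exponential, so the proof is a comparison of
exponents, using n = 2b - m and writing them in terms of m - b. -/
theorem saddleTerm_eq {b m n N : ℕ} (hb : 0 < b) (hN : 0 < N) (hmn : m + n = 2 * b)
    {P Γ : ℂ → ℂ} {z lam : Bool → ℂ} {FP FM gP gM LP LM δ : ℂ} {θP θM R : ℝ} (hR : 0 < R)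
    (hP : Γ (z true) * lam true = exp (gP + (Real.log (2 / R) / 2 + θP * I)))
    (hM : Γ (z false) * lam false = exp (gM + (Real.log (2 / R) / 2 + θM * I)))
    (hlP : lam true ^ ((4 / (2 * b : ℕ) : ℝ) : ℂ) = exp (((4 / (2 * b : ℕ) : ℝ) : ℂ) *
      (Real.log (2 / R) / 2 + θP * I - Real.pi / 2 * I - LP)))
    (hlM : lam false ^ ((4 / (2 * b : ℕ) : ℝ) : ℂ) = exp (((4 / (2 * b : ℕ) : ℝ) : ℂ) *
      (Real.log (2 / R) / 2 + θM * I - Real.pi / 2 * I - LM)))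
    (hX : (2 * sin ((z false - z true) / 2)) ^ ((4 / (2 * b : ℕ) : ℝ) : ℂ) =
      exp (((4 / (2 * b : ℕ) : ℝ) : ℂ) * (δ - (LP + LM) / 2 - Real.pi / 2 * I)))
    (hFP : N * FP = N * P (z true) + gP - (2 - 1 / b) * LP)
    (hFM : N * FM = N * P (z false) + gM - (2 - 1 / b) * LM) :
    saddleTerm (2 * b) P Γ z lam N m n =
      -((gammaIntegral m (2 * b) * gammaIntegral n (2 * b) : ℝ) *
        exp (N * (m * FP + n * FM) + (2 * b - 1 + ((m : ℂ) - b) ^ 2 / b) *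
          (Real.log (2 / (N * R)) + (θP + θM) * I) +
          ((m : ℂ) - b) * (3 - 1 / b) * (θP - θM) * I + (2 * b - 2 * ((m : ℂ) - b) ^ 2 / b) * δ)) := by
  have hb' : (b : ℂ) ≠ 0 := by exact_mod_cast hb.ne'
  have hbr : (b : ℝ) ≠ 0 := by exact_mod_cast hb.ne'
  have hNr : (0 : ℝ) < N := by exact_mod_cast hN
  have hn : (n : ℂ) = 2 * b - m := by
    rw [eq_sub_iff_add_eq, add_comm]; exact_mod_cast hmn
  have hnr : (n : ℝ) = 2 * b - m := by
    rw [eq_sub_iff_add_eq, add_comm]; exact_mod_cast hmn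
  have hpow : ((N : ℝ) ^ (-(((m + n : ℕ) + clusterDegree (4 / (2 * b : ℕ)) m n) / 2)) : ℝ) =
      Real.exp (-Real.log N * (2 * b - 1 + ((m : ℝ) - b) ^ 2 / b)) := by
    rw [Real.rpow_def_of_pos hNr, clusterDegree]
    push_cast [Nat.cast_choose_two]
    rw [hnr]
    congr 1
    field_simp
    ring
  have hlog : Real.log (2 / (N * R)) = Real.log (2 / R) - Real.log N := by
    rw [← Real.log_div (by positivity) hNr.ne']
    congr 1
    field_simp
  -- Each of the b(2b - 1) pairs contributes a quarter turn -iπ/2 to the power 2/b, whether its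
  -- labels agree or not. The total is -(2b - 1)πi, the origin of the minus sign in the formula.
  have hsign : exp (-((2 * b - 1 : ℕ) * (Real.pi * I))) = -1 := by
    rw [exp_neg, exp_nat_mul, exp_pi_mul_I, Odd.neg_one_pow (by
      obtain ⟨c, rfl⟩ : ∃ c, b = c + 1 := ⟨b - 1, by omega⟩
      exact ⟨c, by omega⟩)]
    norm_num
  have hbn : ((2 * b - 1 : ℕ) : ℂ) = 2 * b - 1 := by
    rw [Nat.cast_sub (by omega)]; push_cast; ring
  rw [saddleTerm, amplitude_zero, hP, hM, hlP, hlM, hX, hpow]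
  rw [ofReal_mul, mul_comm (((Real.exp _ : ℝ)) : ℂ), ofReal_exp]
  simp only [← exp_nat_mul]
  rw [← neg_one_mul (((gammaIntegral m (2 * b) * gammaIntegral n (2 * b) : ℝ) : ℂ) * _), ← hsign]
  rw [mul_left_comm _ (((gammaIntegral m (2 * b) * gammaIntegral n (2 * b) : ℝ) : ℂ)),
    mul_left_comm _ (((gammaIntegral m (2 * b) * gammaIntegral n (2 * b) : ℝ) : ℂ)),
    mul_left_comm _ (((gammaIntegral m (2 * b) * gammaIntegral n (2 * b) : ℝ) : ℂ))]
  congr 1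
  simp only [← exp_add]
  congr 1
  rw [hlog, hbn]
  have eFP : (N : ℂ) * (m * FP + n * FM) = m * (N * FP) + n * (N * FM) := by ring
  rw [eFP, hFP, hFM]
  push_cast [Nat.cast_choose_two]
  rw [hn]
  field_simp
  ring

end Logarithms

/-! ### From the saddle terms to the oscillatory sum. -/

section Assembly

theorem sum_range_two_mul_add_one {M : Type*} [AddCommMonoid M] (b : ℕ) (a : ℕ → M) :
    ∑ m ∈ Finset.range (2 * b + 1), a m = a b + ∑ k ∈ Finset.Icc 1 b, (a (b + k) + a (b - k)) := by
  have h1 : ∑ k ∈ Finset.Icc 1 b, (a (b + k) + a (b - k)) =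
      ∑ i ∈ Finset.range b, (a (b + (i + 1)) + a (b - 1 - i)) := by
    rw [← Finset.Ico_succ_right_eq_Icc, Finset.sum_Ico_eq_sum_range]
    simp only [Order.succ_eq_add_one, Nat.add_sub_cancel]
    refine Finset.sum_congr rfl fun i _ => ?_
    congr 2 <;> omega
  rw [h1, Finset.sum_add_distrib, Finset.sum_range_reflect a b, two_mul, add_assoc,
    Finset.sum_range_add, Finset.sum_range_succ', add_zero]
  abel

/-- The factor in front of the oscillatory sum. -/
def prefactor (β N : ℕ) (R θP θM : ℝ) (d FP FM : ℂ) : ℂ :=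
  -((β.choose (β / 2) : ℂ) * (gammaIntegral (β / 2) β : ℂ) ^ 2 * d ^ β *
    ((2 / (N * R) : ℝ) : ℂ) ^ (β - 1) * exp (β * N * (FP + FM) / 2) *
    exp (I * ((β : ℂ) - 1) * (θP + θM)))

/-- The coefficient of the cosine in the oscillatory sum. -/
def oscCoeff (β N : ℕ) (R θP θM : ℝ) (d : ℂ) (α : ℝ) (k : ℕ) : ℂ :=
  ((∏ j ∈ Finset.Icc 1 k, Real.Gamma (1 + 2 * (j : ℝ) / β) /
      Real.Gamma (1 + 2 * ((j : ℝ) - k) / β) : ℝ) : ℂ) *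
    (exp (I * (2 * (k : ℂ) ^ 2 * (θP + θM) / β)) /
      (argPow d α (4 * (k : ℝ) ^ 2 / β) *
        (((N : ℝ) * R) ^ (2 * (k : ℝ) ^ 2 / β) : ℝ)))

/-- The argument of the cosine in the oscillatory sum. -/
def oscArg (β N : ℕ) (θP θM : ℝ) (FP FM : ℂ) (k : ℕ) : ℂ :=
  -I * k * N * (FP - FM) + k * (θP - θM) * (3 - 2 / (β : ℂ))

theorem oscSum_eq (β N : ℕ) (R θP θM : ℝ) (d : ℂ) (α : ℝ) (FP FM : ℂ) :
    oscSum β N R θP θM d α FP FM =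
      1 + 2 * ∑ k ∈ Finset.Icc 1 ⌊Real.sqrt ((β : ℝ) / 2)⌋₊,
        oscCoeff β N R θP θM d α k * cos (oscArg β N θP θM FP FM k) := rfl

theorem argPow_eq {d : ℂ} (hd : d ≠ 0) (α s : ℝ) : argPow d α s = exp (s * argLog d α) := by
  rw [argPow, Real.rpow_def_of_pos (norm_pos_iff.2 hd), ofReal_exp, ← exp_add, argLog]
  congr 1
  push_cast
  ring

/-- The sign σ = ±1 treats m = b + k and m = b - k together; it survives only in the exponential
that becomes the cosine, since all other dependence on m - b is through its square. -/
theorem choose_mul_eq_prefactor_mul {b m n N k : ℕ} (hb : 0 < b) (hN : 0 < N) {σ : ℂ}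
    (hσ : σ ^ 2 = 1) (hm : (m : ℂ) - b = σ * k) (hn : (n : ℂ) - b = -(σ * k))
    {R θP θM α : ℝ} (hR : 0 < R) {d FP FM : ℂ} (hd : d ≠ 0) (hα : d = ‖d‖ * exp (α * I))
    (hcoef : ((2 * b).choose m : ℝ) * (gammaIntegral m (2 * b) * gammaIntegral n (2 * b)) =
      (2 * b).choose b * gammaIntegral b (2 * b) ^ 2 * 2 ^ (-((k : ℝ) ^ 2 / b)) *
        ∏ j ∈ Finset.Icc 1 k, Real.Gamma (1 + 2 * (j : ℝ) / (2 * b : ℕ)) /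
          Real.Gamma (1 + 2 * ((j : ℝ) - k) / (2 * b : ℕ))) :
    ((2 * b).choose m : ℂ) * -((gammaIntegral m (2 * b) * gammaIntegral n (2 * b) : ℝ) *
        exp (N * (m * FP + n * FM) + (2 * b - 1 + ((m : ℂ) - b) ^ 2 / b) *
          (Real.log (2 / (N * R)) + (θP + θM) * I) +
          ((m : ℂ) - b) * (3 - 1 / b) * (θP - θM) * I +
          (2 * b - 2 * ((m : ℂ) - b) ^ 2 / b) * argLog d α)) =
      prefactor (2 * b) N R θP θM d FP FM *
        (oscCoeff (2 * b) N R θP θM d α k * exp (σ * (I * oscArg (2 * b) N θP θM FP FM k))) := by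
  have hb' : (b : ℂ) ≠ 0 := by exact_mod_cast hb.ne'
  have hNR : 0 < (N : ℝ) * R := by have : (0 : ℝ) < N := by exact_mod_cast hN
                                   positivity
  have h2 : ((2 ^ (-((k : ℝ) ^ 2 / b)) : ℝ) : ℂ) = exp (-(Real.log 2 * ((k : ℂ) ^ 2 / b))) := by
    rw [Real.rpow_def_of_pos two_pos, ofReal_exp]
    congr 1
    push_cast
    ring
  have h3 : ((((N : ℝ) * R) ^ (2 * (k : ℝ) ^ 2 / (2 * b : ℕ)) : ℝ) : ℂ) =
      exp (Real.log (N * R) * ((k : ℂ) ^ 2 / b)) := by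
    rw [Real.rpow_def_of_pos hNR, ofReal_exp]
    congr 1
    push_cast
    field_simp
  have h4 : ((2 / (N * R) : ℝ) : ℂ) ^ (2 * b - 1) =
      exp ((2 * b - 1) * (Real.log 2 - Real.log (N * R))) := by
    rw [← Real.exp_log (show 0 < 2 / (N * R) by positivity), ofReal_exp, ← exp_nat_mul,
      Real.log_div two_ne_zero hNR.ne', Nat.cast_sub (by omega)]
    push_cast
    rfl
  have h5 : d ^ (2 * b) = exp (2 * b * argLog d α) := by
    conv_lhs => rw [← exp_argLog hd hα]
    rw [← exp_nat_mul]
    push_cast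
    rfl
  have h6 : Real.log (2 / (N * R)) = Real.log 2 - Real.log (N * R) :=
    Real.log_div two_ne_zero hNR.ne'
  have hc := congrArg ((↑) : ℝ → ℂ) hcoef
  rw [ofReal_mul, ofReal_mul (_ * _), ofReal_mul (_ * _), h2] at hc
  rw [mul_neg, ← mul_assoc, ← ofReal_natCast ((2 * b).choose m), hc, prefactor, oscCoeff,
    argPow_eq hd, h3, h4, h5, h6, Nat.mul_div_cancel_left b two_pos, hm]
  set G : ℝ := ∏ j ∈ Finset.Icc 1 k, Real.Gamma (1 + 2 * (j : ℝ) / (2 * b : ℕ)) /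
          Real.Gamma (1 + 2 * ((j : ℝ) - k) / (2 * b : ℕ))
  have hexp : exp (-(Real.log 2 * ((k : ℂ) ^ 2 / b))) *
      exp (N * (m * FP + n * FM) + (2 * b - 1 + (σ * k) ^ 2 / b) *
          ((Real.log 2 - Real.log (N * R) : ℝ) + (θP + θM) * I) +
          (σ * k) * (3 - 1 / b) * (θP - θM) * I +
          (2 * b - 2 * (σ * k) ^ 2 / b) * argLog d α) =
      exp (2 * b * argLog d α) * exp ((2 * b - 1) * (Real.log 2 - Real.log (N * R))) *
        exp ((2 * b : ℕ) * N * (FP + FM) / 2) * exp (I * (((2 * b : ℕ) : ℂ) - 1) * (θP + θM)) *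
        (exp (I * (2 * (k : ℂ) ^ 2 * (θP + θM) / (2 * b : ℕ))) /
          (exp ((4 * (k : ℝ) ^ 2 / (2 * b : ℕ) : ℝ) * argLog d α) *
            exp (Real.log (N * R) * ((k : ℂ) ^ 2 / b)))) *
        exp (σ * (I * oscArg (2 * b) N θP θM FP FM k)) := by
    simp only [← exp_add, ← exp_sub]
    congr 1
    have hm' : (m : ℂ) = b + σ * k := by rw [← hm]; ring
    have hn' : (n : ℂ) = b - σ * k := by linear_combination hn
    rw [oscArg, hm', hn', mul_pow, hσ]
    push_cast
    have hI := I_sq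
    field_simp
    linear_combination (2 * (σ * k * b * N * (FP - FM))) * hI
  rw [ofReal_mul, ofReal_pow, ofReal_natCast]
  linear_combination (-((((2 * b).choose b : ℕ) : ℂ) * (gammaIntegral b (2 * b) : ℂ) ^ 2 * G)) * hexp

end Assembly

section Assembly

theorem coefficient_eq {b k : ℕ} (hb : 0 < b) (hk : k ≤ b) :
    ((2 * b).choose (b + k) : ℝ) *
      (gammaIntegral (b + k) (2 * b) * gammaIntegral (b - k) (2 * b)) =
      (2 * b).choose b * gammaIntegral b (2 * b) ^ 2 * 2 ^ (-((k : ℝ) ^ 2 / b)) *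
        ∏ j ∈ Finset.Icc 1 k, Real.Gamma (1 + 2 * (j : ℝ) / (2 * b : ℕ)) /
          Real.Gamma (1 + 2 * ((j : ℝ) - k) / (2 * b : ℕ)) := by
  rw [choose_mul_gammaIntegral_mul b k hk hb, prod_Icc_gamma_eq]
  congr 1
  refine Finset.prod_congr rfl fun j _ => ?_
  have hb' : (b : ℝ) ≠ 0 := by exact_mod_cast hb.ne'
  push_cast
  rw [mul_div_mul_left _ _ two_ne_zero, mul_div_mul_left _ _ two_ne_zero]

theorem coefficient_eq' {b k : ℕ} (hb : 0 < b) (hk : k ≤ b) :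
    ((2 * b).choose (b - k) : ℝ) *
      (gammaIntegral (b - k) (2 * b) * gammaIntegral (b + k) (2 * b)) =
      (2 * b).choose b * gammaIntegral b (2 * b) ^ 2 * 2 ^ (-((k : ℝ) ^ 2 / b)) *
        ∏ j ∈ Finset.Icc 1 k, Real.Gamma (1 + 2 * (j : ℝ) / (2 * b : ℕ)) /
          Real.Gamma (1 + 2 * ((j : ℝ) - k) / (2 * b : ℕ)) := by
  rw [← coefficient_eq hb hk, mul_comm (gammaIntegral (b - k) _),
    Nat.choose_symm_of_eq_add (show 2 * b = (b - k) + (b + k) by omega)]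

theorem norm_cos_le (w : ℂ) : ‖cos w‖ ≤ Real.exp |w.im| := by
  have := norm_sin_le (w + Real.pi / 2)
  rw [sin_add_pi_div_two] at this
  convert this using 3
  rw [add_im, show (Real.pi / 2 : ℂ) = ((Real.pi / 2 : ℝ) : ℂ) by push_cast; rfl, ofReal_im,
    add_zero]

/-- The power (N R)^{-2k²/β} is at most a constant over N once 2k² ≥ β. The cosine stays bounded
because the real part of N(f̃_+ - f̃_-) does not depend on N. -/
theorem exists_oscTerm_bound {β k : ℕ} (hβ : 0 < β) (hk : β ≤ 2 * k ^ 2) {R θP θM α c : ℝ}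
    (hR : 0 < R) {d : ℂ} (hd : d ≠ 0) {FP FM : ℕ → ℂ}
    (hF : ∀ N : ℕ, 0 < N → (N * (FP N - FM N)).re = c) :
    ∃ K, ∀ N : ℕ, 0 < N →
      ‖oscCoeff β N R θP θM d α k * cos (oscArg β N θP θM (FP N) (FM N) k)‖ ≤ K / N := by
  set e : ℝ := 2 * (k : ℝ) ^ 2 / β with he
  have hβ' : (0 : ℝ) < β := by exact_mod_cast hβ
  have he1 : 1 ≤ e := by
    rw [he, one_le_div hβ']
    exact_mod_cast hk
  set G : ℝ := ∏ j ∈ Finset.Icc 1 k, Real.Gamma (1 + 2 * (j : ℝ) / β) /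
      Real.Gamma (1 + 2 * ((j : ℝ) - k) / β) with hG
  have hdn : 0 < ‖d‖ := norm_pos_iff.2 hd
  refine ⟨|G| * (1 / (‖d‖ ^ (4 * (k : ℝ) ^ 2 / β) * R ^ e)) * Real.exp (k * |c|), fun N hN => ?_⟩
  have hNr : (0 : ℝ) < N := by exact_mod_cast hN
  have hN1 : (1 : ℝ) ≤ N := by exact_mod_cast hN
  have h1 : ‖exp (I * (2 * (k : ℂ) ^ 2 * (θP + θM) / β))‖ = 1 := by
    rw [show I * (2 * (k : ℂ) ^ 2 * (θP + θM) / β) =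
      ((2 * (k : ℝ) ^ 2 * (θP + θM) / β : ℝ) : ℂ) * I by push_cast; ring, norm_exp_ofReal_mul_I]
  have h2 : ‖argPow d α (4 * (k : ℝ) ^ 2 / β)‖ = ‖d‖ ^ (4 * (k : ℝ) ^ 2 / β) := by
    rw [argPow, norm_mul, ← ofReal_mul, norm_exp_ofReal_mul_I, mul_one, norm_real,
      Real.norm_of_nonneg (by positivity)]
  have h3 : ‖cos (oscArg β N θP θM (FP N) (FM N) k)‖ ≤ Real.exp (k * |c|) := by
    refine (norm_cos_le _).trans (Real.exp_le_exp.2 ?_)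
    have : oscArg β N θP θM (FP N) (FM N) k = -(I * (k * (N * (FP N - FM N)))) +
        ((k * (θP - θM) * (3 - 2 / β) : ℝ) : ℂ) := by
      rw [oscArg]; push_cast; ring
    rw [this, add_im, ofReal_im, add_zero, neg_im, I_mul_im, ← ofReal_natCast k, re_ofReal_mul,
      hF N hN, abs_neg, abs_mul, Nat.abs_cast]
  have h4 : (N : ℝ) * R ^ e ≤ (N * R) ^ e := by
    rw [Real.mul_rpow hNr.le hR.le]
    gcongr
    calc (N : ℝ) = (N : ℝ) ^ (1 : ℝ) := (Real.rpow_one _).symm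
      _ ≤ _ := Real.rpow_le_rpow_of_exponent_le hN1 he1
  rw [oscCoeff, norm_mul, norm_mul, norm_div, norm_mul, h1, h2, norm_real, norm_real,
    Real.norm_eq_abs, Real.norm_of_nonneg (by positivity)]
  calc _ ≤ |G| * (1 / (‖d‖ ^ (4 * (k : ℝ) ^ 2 / β) * (N * R ^ e))) * Real.exp (k * |c|) := by
        gcongr
    _ = _ := by field_simp

/-- The modulus is exactly a constant times the error scale of the expansion without its 1/N, so
dividing by the prefactor leaves an error O(1/N). -/
theorem exists_norm_prefactor_eq {b : ℕ} (hb : 0 < b) {R θP θM c H : ℝ} (hR : 0 < R) {d : ℂ}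
    (hd : d ≠ 0) {FP FM : ℕ → ℂ}
    (hF : ∀ N : ℕ, 0 < N → (N * (FP N + FM N)).re = 2 * N * H + c) :
    ∃ C > 0, ∀ N : ℕ, 0 < N → ‖prefactor (2 * b) N R θP θM d (FP N) (FM N)‖ =
      C * (Real.exp (N * ((2 * b : ℕ) * H)) * (N : ℝ) ^ (-(((2 * b : ℕ) : ℝ) - 1))) := by
  have hdn : 0 < ‖d‖ := norm_pos_iff.2 hd
  have hΓ := gammaIntegral_pos b (β := 2 * b) (by omega)
  have hch : 0 < ((2 * b).choose b : ℝ) := by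
    exact_mod_cast Nat.choose_pos (by omega)
  refine ⟨(2 * b).choose b * gammaIntegral b (2 * b) ^ 2 * ‖d‖ ^ (2 * b) *
    (2 / R) ^ (2 * b - 1) * Real.exp (b * c), by positivity, fun N hN => ?_⟩
  have hNr : (0 : ℝ) < N := by exact_mod_cast hN
  have h1 : ‖exp (I * (((2 * b : ℕ) : ℂ) - 1) * (θP + θM))‖ = 1 := by
    rw [show I * (((2 * b : ℕ) : ℂ) - 1) * (θP + θM) =
      ((((2 * b : ℕ) : ℝ) - 1) * (θP + θM) : ℝ) * I by push_cast; ring, norm_exp_ofReal_mul_I]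
  have h2 : ‖exp ((2 * b : ℕ) * N * (FP N + FM N) / 2)‖ =
      Real.exp (N * ((2 * b : ℕ) * H)) * Real.exp (b * c) := by
    rw [norm_exp, ← Real.exp_add]
    congr 1
    rw [show ((2 * b : ℕ) : ℂ) * N * (FP N + FM N) / 2 = (b : ℝ) * (N * (FP N + FM N)) by
      push_cast; ring, re_ofReal_mul, hF N hN]
    push_cast
    ring
  have h3 : (N : ℝ) ^ (-(((2 * b : ℕ) : ℝ) - 1)) = ((N : ℝ) ^ (2 * b - 1))⁻¹ := by
    rw [Real.rpow_neg hNr.le, ← Real.rpow_natCast, Nat.cast_sub (by omega)]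
    push_cast
    rfl
  rw [prefactor, norm_neg, norm_mul, norm_mul, norm_mul, norm_mul, norm_mul, norm_pow, norm_pow,
    norm_pow, h1, h2, h3, norm_natCast, norm_real, norm_real, Nat.mul_div_cancel_left b two_pos,
    Real.norm_of_nonneg hΓ.le, Real.norm_of_nonneg (by positivity)]
  rw [show 2 / ((N : ℝ) * R) = 2 / R * (N : ℝ)⁻¹ by field_simp, mul_pow, inv_pow]
  ring

end Assembly

section Assembly

/-- The sum is centred at m = b; the terms b + k and b - k have equal coefficients and opposite
phases and add up to twice a cosine. -/
theorem sum_choose_mul_saddleTerm_eq {b N : ℕ} (hb : 0 < b) (hN : 0 < N)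
    {P Γ : ℂ → ℂ} {z lam : Bool → ℂ} {d FP FM gP gM LP LM : ℂ} {θP θM α R : ℝ} (hR : 0 < R)
    (hd : d ≠ 0) (hα : d = ‖d‖ * exp (α * I))
    (hP : Γ (z true) * lam true = exp (gP + (Real.log (2 / R) / 2 + θP * I)))
    (hM : Γ (z false) * lam false = exp (gM + (Real.log (2 / R) / 2 + θM * I)))
    (hlP : lam true ^ ((4 / (2 * b : ℕ) : ℝ) : ℂ) = exp (((4 / (2 * b : ℕ) : ℝ) : ℂ) *
      (Real.log (2 / R) / 2 + θP * I - Real.pi / 2 * I - LP)))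
    (hlM : lam false ^ ((4 / (2 * b : ℕ) : ℝ) : ℂ) = exp (((4 / (2 * b : ℕ) : ℝ) : ℂ) *
      (Real.log (2 / R) / 2 + θM * I - Real.pi / 2 * I - LM)))
    (hX : (2 * sin ((z false - z true) / 2)) ^ ((4 / (2 * b : ℕ) : ℝ) : ℂ) =
      exp (((4 / (2 * b : ℕ) : ℝ) : ℂ) * (argLog d α - (LP + LM) / 2 - Real.pi / 2 * I)))
    (hFP : N * FP = N * P (z true) + gP - (2 - 1 / b) * LP)
    (hFM : N * FM = N * P (z false) + gM - (2 - 1 / b) * LM) :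
    ∑ m ∈ Finset.range (2 * b + 1),
        ((2 * b).choose m : ℂ) * saddleTerm (2 * b) P Γ z lam N m (2 * b - m) =
      prefactor (2 * b) N R θP θM d FP FM * (1 + 2 * ∑ k ∈ Finset.Icc 1 b,
        oscCoeff (2 * b) N R θP θM d α k * cos (oscArg (2 * b) N θP θM FP FM k)) := by
  have key : ∀ {m n k : ℕ} {σ : ℂ}, m + n = 2 * b → σ ^ 2 = 1 → (m : ℂ) - b = σ * k →
      ((2 * b).choose m : ℝ) * (gammaIntegral m (2 * b) * gammaIntegral n (2 * b)) =
      (2 * b).choose b * gammaIntegral b (2 * b) ^ 2 * 2 ^ (-((k : ℝ) ^ 2 / b)) *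
        ∏ j ∈ Finset.Icc 1 k, Real.Gamma (1 + 2 * (j : ℝ) / (2 * b : ℕ)) /
          Real.Gamma (1 + 2 * ((j : ℝ) - k) / (2 * b : ℕ)) →
      ((2 * b).choose m : ℂ) * saddleTerm (2 * b) P Γ z lam N m n =
        prefactor (2 * b) N R θP θM d FP FM * (oscCoeff (2 * b) N R θP θM d α k *
          exp (σ * (I * oscArg (2 * b) N θP θM FP FM k))) := by
    intro m n k σ hmn hσ hm hcoef
    have hn : (n : ℂ) - b = -(σ * k) := by
      have : (m : ℂ) + n = 2 * b := by exact_mod_cast hmn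
      linear_combination this - hm
    rw [saddleTerm_eq hb hN hmn hR hP hM hlP hlM hX hFP hFM,
      choose_mul_eq_prefactor_mul hb hN hσ hm hn hR hd hα hcoef]
  have hmid : ((2 * b).choose b : ℂ) * saddleTerm (2 * b) P Γ z lam N b (2 * b - b) =
      prefactor (2 * b) N R θP θM d FP FM := by
    have := key (m := b) (n := 2 * b - b) (k := 0) (σ := 1) (by omega) (by simp) (by simp) (by
      rw [show 2 * b - b = b by omega]
      simpa using coefficient_eq hb (Nat.zero_le b))
    rw [this]
    simp [oscCoeff, oscArg, argPow]
  rw [sum_range_two_mul_add_one, hmid, mul_add, mul_one, Finset.mul_sum, Finset.mul_sum]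
  congr 1
  refine Finset.sum_congr rfl fun k hk => ?_
  have hkb := (Finset.mem_Icc.1 hk).2
  rw [key (m := b + k) (n := 2 * b - (b + k)) (k := k) (σ := 1) (by omega) (by simp)
      (by push_cast; ring)
      (by rw [show 2 * b - (b + k) = b - k by omega]; exact coefficient_eq hb hkb),
    key (m := b - k) (n := 2 * b - (b - k)) (k := k) (σ := -1) (by omega) (by simp)
      (by rw [Nat.cast_sub hkb]; ring)
      (by rw [show 2 * b - (b - k) = b + k by omega]; exact coefficient_eq' hb hkb)]
  rw [mul_left_comm (2 : ℂ), two_cos]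
  rw [show I * oscArg (2 * b) N θP θM FP FM k = oscArg (2 * b) N θP θM FP FM k * I by ring,
    one_mul, neg_one_mul, neg_mul]
  ring

end Assembly

section Assembly

/-- Beyond the integer part of √b one has k² > b, that is 2k² > β, so each of the finitely many
omitted terms is O(1/N). -/
theorem exists_oscSum_tail_bound {b : ℕ} (hb : 0 < b) {R θP θM α c : ℝ}
    (hR : 0 < R) {d : ℂ} (hd : d ≠ 0) {FP FM : ℕ → ℂ}
    (hF : ∀ N : ℕ, 0 < N → (N * (FP N - FM N)).re = c) :
    ∃ K, ∀ N : ℕ, 0 < N →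
      ‖1 + 2 * ∑ k ∈ Finset.Icc 1 b, oscCoeff (2 * b) N R θP θM d α k *
          cos (oscArg (2 * b) N θP θM (FP N) (FM N) k) -
        oscSum (2 * b) N R θP θM d α (FP N) (FM N)‖ ≤ K / N := by
  set M := ⌊Real.sqrt (((2 * b : ℕ) : ℝ) / 2)⌋₊ with hM
  have hbr : (((2 * b : ℕ) : ℝ) / 2) = b := by push_cast; ring
  have hMb : M ≤ b := by
    rw [hM, hbr]
    refine Nat.floor_le_of_le (Real.sqrt_le_iff.2 ⟨by positivity, ?_⟩)
    have : (1 : ℝ) ≤ b := by exact_mod_cast hb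
    nlinarith
  have hterm : ∀ k : ℕ, ∃ K, M < k → ∀ N : ℕ, 0 < N →
      ‖oscCoeff (2 * b) N R θP θM d α k * cos (oscArg (2 * b) N θP θM (FP N) (FM N) k)‖ ≤
        K / N := fun k => by
    by_cases hk : M < k
    · have h1 : Real.sqrt b < k := by
        rw [← hbr]
        exact (Nat.floor_lt (Real.sqrt_nonneg _)).1 hk
      have h2 : (b : ℝ) < (k : ℝ) ^ 2 := (Real.sqrt_lt' (by
        exact_mod_cast (Nat.zero_le M).trans_lt hk)).1 h1
      have h3 : b < k ^ 2 := by exact_mod_cast h2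
      obtain ⟨K, hK⟩ := exists_oscTerm_bound (β := 2 * b) (k := k) (α := α) (θP := θP) (θM := θM)
        (by omega) (by omega) hR hd hF
      exact ⟨K, fun _ => hK⟩
    · exact ⟨0, fun h => absurd h hk⟩
  choose K hK using hterm
  refine ⟨2 * ∑ k ∈ Finset.Icc 1 b \ Finset.Icc 1 M, K k, fun N hN => ?_⟩
  rw [oscSum_eq, ← hM, add_sub_add_left_eq_sub, ← mul_sub,
    ← Finset.sum_sdiff (Finset.Icc_subset_Icc_right hMb), add_sub_cancel_right, norm_mul,
    norm_ofNat, mul_div_assoc, Finset.sum_div]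
  refine mul_le_mul_of_nonneg_left (norm_sum_le_of_le _ fun k hk => ?_) zero_le_two
  simp only [Finset.mem_sdiff, Finset.mem_Icc] at hk
  exact hK k (by omega) N hN

theorem natCast_mul_fTilde {b N : ℕ} (hb : 0 < b) (hN : 0 < N) (f₀ g : ℂ → ℂ) (u : ℂ) (a : ℝ) :
    (N : ℂ) * fTilde (2 * b) N (phase f₀ g N) u a =
      N * f₀ u + g u - (2 - 1 / b) * argLog u a := by
  have hN' : (N : ℂ) ≠ 0 := by exact_mod_cast hN.ne'
  have hb' : (b : ℂ) ≠ 0 := by exact_mod_cast hb.ne'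
  rw [fTilde, phase, argLog]
  push_cast
  field_simp

/-- The passage from the expansion in the numbers of variables at the two saddle points to the
oscillatory sum. -/
theorem exists_remainder {b : ℕ} (hb : 0 < b) {R θP θM α c c' H K : ℝ} (hR : 0 < R) {d : ℂ}
    (hd : d ≠ 0) {FP FM A : ℕ → ℂ}
    (hF : ∀ N : ℕ, 0 < N → (N * (FP N - FM N)).re = c)
    (hF' : ∀ N : ℕ, 0 < N → (N * (FP N + FM N)).re = 2 * N * H + c')
    (hA : ∀ᶠ N : ℕ in atTop, ‖A N - prefactor (2 * b) N R θP θM d (FP N) (FM N) *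
        (1 + 2 * ∑ k ∈ Finset.Icc 1 b, oscCoeff (2 * b) N R θP θM d α k *
          cos (oscArg (2 * b) N θP θM (FP N) (FM N) k))‖ ≤
      Real.exp (N * ((2 * b : ℕ) * H)) * (K * ((N : ℝ) ^ (-(((2 * b : ℕ) : ℝ) - 1)) / N))) :
    ∃ ε : ℕ → ℂ, ε =O[atTop] (fun N : ℕ => 1 / (N : ℝ)) ∧ ∀ᶠ N : ℕ in atTop,
      A N = prefactor (2 * b) N R θP θM d (FP N) (FM N) *
        (oscSum (2 * b) N R θP θM d α (FP N) (FM N) + ε N) := by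
  obtain ⟨K', hK'⟩ := exists_oscSum_tail_bound (θP := θP) (θM := θM) (α := α) hb hR hd hF
  obtain ⟨C, hC, hpre⟩ := exists_norm_prefactor_eq (θP := θP) (θM := θM) hb hR hd hF'
  have hne : ∀ N : ℕ, 0 < N → prefactor (2 * b) N R θP θM d (FP N) (FM N) ≠ 0 := fun N hN => by
    have : (0 : ℝ) < N := by exact_mod_cast hN
    rw [← norm_pos_iff, hpre N hN]
    positivity
  refine ⟨fun N => A N / prefactor (2 * b) N R θP θM d (FP N) (FM N) -
    oscSum (2 * b) N R θP θM d α (FP N) (FM N), IsBigO.of_bound (K / C + K') ?_, ?_⟩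
  · filter_upwards [hA, eventually_gt_atTop 0] with N hAN hN
    have hN' : (0 : ℝ) < N := by exact_mod_cast hN
    have hp := norm_pos_iff.2 (hne N hN)
    refine (norm_sub_le_norm_sub_add_norm_sub _ (1 + 2 * ∑ k ∈ Finset.Icc 1 b,
      oscCoeff (2 * b) N R θP θM d α k * cos (oscArg (2 * b) N θP θM (FP N) (FM N) k)) _).trans ?_
    rw [Real.norm_of_nonneg (by positivity), add_mul]
    refine add_le_add ?_ ((hK' N hN).trans_eq (div_eq_mul_one_div _ _))
    rw [div_sub' (hne N hN), norm_div, div_le_iff₀ hp, hpre N hN]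
    refine hAN.trans (le_of_eq ?_)
    field_simp
  · filter_upwards [eventually_gt_atTop 0] with N hN
    rw [add_sub_cancel, mul_div_cancel₀ _ (hne N hN)]

end Assembly

end BetaLaguerre

end

/-! ### The asymptotic formula. -/

open BetaLaguerre in
theorem mainTheorem6
    (β : ℕ) (hβ : Even β) (hβ0 : 0 < β)
    (f₀ g : ℂ → ℂ)
    -- the integrand is analytic on the cut plane and bounded near the end point `1` of the contours
    (hanalytic : ∀ N : ℕ, 1 ≤ N →
      DifferentiableOn ℂ (fun u => Complex.exp (N * phase f₀ g N u)) cutPlane)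
    (hone : ∀ᶠ N : ℕ in atTop,
      (fun u => Complex.exp (N * phase f₀ g N u)) =O[𝓝[cutPlane] 1] (fun _ => (1 : ℝ)))
    -- the saddle points `uP = u_+` and `uM = u_-`, with `ψP = arg u_+` and `ψM = arg u_-`
    (uP uM : ℂ) (ψP ψM : ℝ)
    (hψP : 0 < ψP) (hψ : ψP < ψM) (hψM : ψM < 2 * Real.pi)
    (hfP : AnalyticAt ℂ f₀ uP) (hfM : AnalyticAt ℂ f₀ uM)
    (hdP : deriv f₀ uP = 0) (hdM : deriv f₀ uM = 0)
    (R φP φM : ℝ) (hR : 0 < R)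
    (hddP : iteratedDeriv 2 f₀ uP = R * Complex.exp (φP * Complex.I))
    (hddM : iteratedDeriv 2 f₀ uM = R * Complex.exp (φM * Complex.I))
    -- the directions of steepest descent, oriented counterclockwise
    (θP θM : ℝ)
    (hcosP : Real.cos (2 * θP + φP) = -1) (hsinP : Real.sin (2 * θP + φP) = 0)
    (hcosM : Real.cos (2 * θM + φM) = -1) (hsinM : Real.sin (2 * θM + φM) = 0)
    (hθP : θP ∈ Set.Ioo ψP (ψP + Real.pi))
    (hθM : θM ∈ Set.Ioo (ψM - 2 * Real.pi) (ψM - Real.pi))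
    -- the argument of `u_+ - u_-`
    (α : ℝ) (hα : uP - uM = ‖uP - uM‖ * Complex.exp (α * Complex.I))
    (hαmem : α ∈ Set.Ioo ((ψP + ψM) / 2 - Real.pi) ((ψP + ψM) / 2))
    -- the descent contour: it goes counterclockwise round the origin from `1` to `1`, runs through
    -- the two saddle points in the directions of steepest descent, and away from them `Re f₀`
    -- stays below its common value at the two saddle points
    (ρ : ℝ → ℝ) (hρ : ContDiffOn ℝ 1 ρ (Set.Icc 0 (2 * Real.pi)))
    (hρpos : ∀ t ∈ Set.Icc 0 (2 * Real.pi), 0 < ρ t)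
    (hρ0 : ρ 0 = 1) (hρ1 : ρ (2 * Real.pi) = 1)
    (huP : polarPath ρ ψP = uP) (huM : polarPath ρ ψM = uM)
    (hdirP : ∃ c : ℝ, 0 < c ∧ HasDerivAt (polarPath ρ) (c * Complex.exp (θP * Complex.I)) ψP)
    (hdirM : ∃ c : ℝ, 0 < c ∧ HasDerivAt (polarPath ρ) (c * Complex.exp (θM * Complex.I)) ψM)
    (hheight : (f₀ uP).re = (f₀ uM).re)
    (hdescent : ∀ η : ℝ, 0 < η → ∃ δ : ℝ, 0 < δ ∧ ∀ t ∈ Set.Ioo 0 (2 * Real.pi),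
      η ≤ |t - ψP| → η ≤ |t - ψM| → (f₀ (polarPath ρ t)).re ≤ (f₀ uP).re - δ) :
    ∃ ε : ℕ → ℂ, ε =O[atTop] (fun N : ℕ => 1 / (N : ℝ)) ∧
      ∀ᶠ N : ℕ in atTop,
        circleBetaIntegral β N (phase f₀ g N) =
          -((β.choose (β / 2) : ℂ) * (gammaIntegral (β / 2) β : ℂ) ^ 2 * (uP - uM) ^ β *
            ((2 / (N * R) : ℝ) : ℂ) ^ (β - 1) *
            Complex.exp (β * N * (fTilde β N (phase f₀ g N) uP ψP +
              fTilde β N (phase f₀ g N) uM (ψM - 2 * Real.pi)) / 2) *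
            Complex.exp (Complex.I * ((β : ℂ) - 1) * (θP + θM)) *
            (oscSum β N R θP θM (uP - uM) α
              (fTilde β N (phase f₀ g N) uP ψP)
              (fTilde β N (phase f₀ g N) uM (ψM - 2 * Real.pi)) + ε N)) := by
  obtain ⟨b, rfl⟩ := hβ.two_dvd
  have hb : 0 < b := by omega
  have hmemP : ψP ∈ Set.Icc 0 (2 * Real.pi) := ⟨hψP.le, by linarith⟩
  have hmemM : ψM ∈ Set.Icc 0 (2 * Real.pi) := ⟨by linarith, hψM.le⟩
  have hnorm : ∀ {t : ℝ} {u : ℂ}, t ∈ Set.Icc 0 (2 * Real.pi) → polarPath ρ t = u →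
      ‖u‖ = ρ t := fun {t u} ht hu => by
    rw [← hu, polarPath, norm_mul, norm_exp_ofReal_mul_I, mul_one, norm_real,
      Real.norm_of_nonneg (hρpos t ht).le]
  have hnP := hnorm hmemP huP
  have hnM := hnorm hmemM huM
  have huP0 : uP ≠ 0 := norm_pos_iff.1 (hnP ▸ hρpos _ hmemP)
  have huM0 : uM ≠ 0 := norm_pos_iff.1 (hnM ▸ hρpos _ hmemM)
  have haP : uP = ‖uP‖ * Complex.exp (ψP * Complex.I) := by rw [hnP, ← huP, polarPath]
  have haM' : uM = ‖uM‖ * Complex.exp (ψM * Complex.I) := by rw [hnM, ← huM, polarPath]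
  have haM : uM = ‖uM‖ * Complex.exp ((ψM - 2 * Real.pi : ℝ) * Complex.I) := by
    conv_lhs => rw [haM']
    push_cast
    rw [sub_mul, exp_sub, exp_two_pi_mul_I, div_one]
  -- Equal saddle points would have arguments differing by a multiple of 2π, whereas 0 < ψ_- - ψ_+ <
  -- 2π.
  have hPM : uP ≠ uM := fun h => by
    have h1 : Complex.exp (ψP * Complex.I) = Complex.exp (ψM * Complex.I) :=
      mul_left_cancel₀ (ofReal_ne_zero.2 (norm_ne_zero_iff.2 huM0)) (by
        rw [← haM', ← h, ← haP])
    obtain ⟨n, hn⟩ := Complex.exp_eq_exp_iff_exists_int.1 h1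
    have h2 : ψP = ψM + n * (2 * Real.pi) := by
      have := congrArg Complex.im hn
      simpa using this
    have h3 : -1 < (n : ℝ) := by nlinarith [Real.pi_pos]
    have h4 : (n : ℝ) < 0 := by nlinarith [Real.pi_pos]
    have h3' : -1 < n := by exact_mod_cast h3
    have h4' : n < 0 := by exact_mod_cast h4
    omega
  have hdir : ∀ {θ φ : ℝ}, Real.cos (2 * θ + φ) = -1 → Real.sin (2 * θ + φ) = 0 →
      Complex.exp ((2 * θ + φ : ℝ) * Complex.I) = -1 := fun {θ φ} hc hs => by
    rw [exp_mul_I, ← ofReal_cos, ← ofReal_sin, hc, hs]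
    simp
  obtain ⟨z, lam, hz, hzre, -, hlam, K, hK⟩ := exists_circle_expansion hβ0 hanalytic hone
    (u := fun s => cond s uP uM) (ψ := fun s => cond s ψP ψM) (θ := fun s => cond s θP θM)
    (φ := fun s => cond s φP φM) (R := R) (H := (f₀ uP).re) (ρ := ρ) hψP hψ hψM
    (Bool.forall_bool.2 ⟨hfM, hfP⟩) (Bool.forall_bool.2 ⟨hdM, hdP⟩) hR
    (Bool.forall_bool.2 ⟨hddM, hddP⟩)
    (Bool.forall_bool.2 ⟨hdir hcosM hsinM, hdir hcosP hsinP⟩) hρ hρpos hρ0 hρ1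
    (Bool.forall_bool.2 ⟨huM, huP⟩) (Bool.forall_bool.2 ⟨hdirM, hdirP⟩)
    (Bool.forall_bool.2 ⟨hheight.symm, rfl⟩) hdescent
  obtain ⟨hzM, hzP⟩ := Bool.forall_bool.1 hz
  obtain ⟨hrM, hrP⟩ := Bool.forall_bool.1 hzre
  obtain ⟨hlM, hlP⟩ := Bool.forall_bool.1 hlam
  simp only [cond_true, cond_false] at hzM hzP hrM hrP hlM hlP
  have hsqrt : ((√(2 / R) : ℝ) : ℂ) = Complex.exp (Real.log (2 / R) / 2) := by
    rw [Real.sqrt_eq_rpow, Real.rpow_def_of_pos (by positivity), ofReal_exp]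
    congr 1
    push_cast
    ring
  -- In N f̃ only the term N f₀ depends on N. Equal heights of the saddle points therefore make the
  -- real part of N(f̃_+ - f̃_-) constant in N.
  have hre : ∀ {N : ℕ} (u : ℂ) (a : ℝ), 0 < N →
      ((N : ℂ) * fTilde (2 * b) N (phase f₀ g N) u a).re =
        N * (f₀ u).re + (g u - (2 - 1 / b) * argLog u a).re := fun {N} u a hN => by
    rw [natCast_mul_fTilde hb hN, add_sub_assoc, add_re, ← ofReal_natCast N, re_ofReal_mul]
  have hfinal := exists_remainder (α := α) (θP := θP) (θM := θM)
    (A := fun N => circleBetaIntegral (2 * b) N (phase f₀ g N))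
    (FP := fun N => fTilde (2 * b) N (phase f₀ g N) uP ψP)
    (FM := fun N => fTilde (2 * b) N (phase f₀ g N) uM (ψM - 2 * Real.pi)) (H := (f₀ uP).re) (K := K) hb hR (sub_ne_zero.2 hPM)
    (c := (g uP - (2 - 1 / b) * argLog uP ψP).re -
      (g uM - (2 - 1 / b) * argLog uM (ψM - 2 * Real.pi)).re)
    (c' := (g uP - (2 - 1 / b) * argLog uP ψP).re +
      (g uM - (2 - 1 / b) * argLog uM (ψM - 2 * Real.pi)).re)
    (fun N hN => ?hdiff) (fun N hN => ?hsum) ?hexp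
  · obtain ⟨ε, hε, h⟩ := hfinal
    refine ⟨ε, hε, h.mono fun N hN => hN.trans ?_⟩
    rw [prefactor, neg_mul]
  · rw [mul_sub, sub_re, hre _ _ hN, hre _ _ hN, hheight]
    ring
  · rw [mul_add, add_re, hre _ _ hN, hre _ _ hN, hheight]
    ring
  · filter_upwards [hK, eventually_gt_atTop 0] with N hKN hN
    rw [← sum_choose_mul_saddleTerm_eq (z := z) (lam := lam)
      (P := fun z => f₀ (Complex.exp (Complex.I * z)))
      (Γ := fun z => Complex.exp (g (Complex.exp (Complex.I * z))) *
        (Complex.I * Complex.exp (Complex.I * z))) (gP := g uP) (gM := g uM)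
      (LP := argLog uP ψP) (LM := argLog uM (ψM - 2 * Real.pi)) hb hN hR (sub_ne_zero.2 hPM) hα
      ?_ ?_ (direction_cpow hR huP0 haP hθP hlP _)
      (direction_cpow hR huM0 haM ⟨hθM.1, by linarith [hθM.2]⟩ hlM _)
      (chord_cpow hPM hzP hzM hrP hrM hα hαmem _) ?_ ?_]
    · exact hKN
    · rw [hzP, mul_assoc, hlP, hsqrt, ← exp_add, ← exp_add]
    · rw [hzM, mul_assoc, hlM, hsqrt, ← exp_add, ← exp_add]
    · simp only [hzP]
      exact natCast_mul_fTilde hb hN f₀ g uP ψP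
    · simp only [hzM]
      exact natCast_mul_fTilde hb hN f₀ g uM (ψM - 2 * Real.pi)
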